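/- Consider a family of finite quantum lattice systems indexed by $n$ (the system size): a finite metric space $\Lambda_n$ of sites with Hilbert space $\mathcal H_n=\bigotimes_{x\in\Lambda_n}\mathbb C^{q_n(x)}$, where the lattices are uniformly of finite dimension, i.e. $|\{y\in\Lambda_n: d(x,y)\le r\}|\le C(1+r)^D$ for all $n$, $x$, $r\ge 0$, with $C,D$ independent of $n$, $x$, $r$. A *local Hamiltonian* is a family $H_n=\sum_{Z\subseteq\Lambda_n}H_{n,Z}$, with $H_{n,Z}$ Hermitian and acting only on the sites of $Z$, whose terms decay faster than any power: for every $k$, $$\sup_n\ \sup_{u\in\Lambda_n}\ \sum_{Z\ni u}\|H_{n,Z}\|\,|Z|\,(1+\operatorname{diam}Z)^k<\infty .$$ A *smooth path of local Hamiltonians* $H(g)$, $g\in[0,1]$, is a family of such sums with each $g\mapsto H_{n,Z}(g)$ of class $C^\infty$ on $[0,1]$ and, for all $k,m\ge 0$, the same bound for $\partial_g^m H_{n,Z}(g)$, uniformly in $g$, $u$ and $n$. A family of unit vectors $\Phi=(\Phi_n)$, $\Phi_n\in\mathcal H_n$, is a *gapped ground state* of $H$ if there is $\Delta>0$ independent of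 $n$ such that $\Phi_n$ is the nondegenerate ground state of $H_n$ and all other energies lie at least $\Delta$ above the ground state energy; it is a *gapped state* if it is a gapped ground state of some local Hamiltonian. Two such families $\Phi(0),\Phi(1)$ are *in the same phase* if there are a smooth path of local Hamiltonians $H(g)$ and unit vectors $\Phi_n(g)$, $g\in[0,1]$, with $\Phi_n(0)$ and $\Phi_n(1)$ the given vectors, such that $\Phi_n(g)$ is the nondegenerate ground state of $H_n(g)$ with a gap at least $\Delta>0$ independent of $n$ and $g$, and all local expectation values are smooth along the path, also in the limit of infinite size: for every operator $O$ on $\mathcal H_n$ the function $g\mapsto\langle\Phi_n(g)|O|\Phi_n(g)\rangle$ is $C^\infty$ on $[0,1]$, and for all $m$, $r$ there is $C_{m,r}$ with $|\partial_g^m\langle\Phi_n(g)|O|\Phi_n(g)\rangle|\le C_{m,r}\|O\|$ for all $n$, all $g\in[0,1]$ and all $O$ supported on a region of diameter at most $r$. They are *related by a local unitary evolution* if there is a smooth path of local Hamiltonians $\tilde H(g)$, $g\in[0,1]$, such that for all $n$ $$\Phi_n(1)=\mathcal T\!\left[e^{-i\int_0^1 \tilde H_n(g)\,dg}\right]\Phi_n(0),$$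 where $U(s)=\mathcal T[e^{-i\int_0^s \tilde H_n(g)dg}]$ is the solution of $U'(s)=-i\tilde H_n(s)U(s)$ on $[0,1]$ with $U(0)=1$. **Theorem.** Two gapped states $\Phi(0)$ and $\Phi(1)$ of the same family of systems are in the same phase if and only if they are related by a local unitary evolution. -/

import Mathlib

open scoped ContDiff

/-! ### A single finite quantum lattice system

`V` is the finite set of sites and `q x` is the dimension of the Hilbert space at the site `x`. -/

/-- The many-body Hilbert space `⨂ₓ ℂ^(q x)`, written in its orthonormal basis of configurations. -/
abbrev ManyBody {V : Type*} (q : V → ℕ) : Type _ :=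
  EuclideanSpace ℂ ((x : V) → Fin (q x))

/-- Bounded operators on a Hilbert space, with the operator norm. -/
abbrev BoundedOperator (E : Type*) [NormedAddCommGroup E] [InnerProductSpace ℂ E] : Type _ :=
  E →L[ℂ] E

/-- Operators on the many-body Hilbert space. -/
abbrev Operator {V : Type*} [Fintype V] [DecidableEq V] (q : V → ℕ) : Type _ :=
  BoundedOperator (ManyBody q)

/-- The matrix element `⟨σ| A |τ⟩` between two basis configurations. -/
noncomputable def matrixElement {V : Type*} [Fintype V] [DecidableEq V] {q : V → ℕ}
    (A : Operator q) (σ τ : (x : V) → Fin (q x)) : ℂ :=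
  A (EuclideanSpace.single τ 1) σ

/-- `A` acts only on the sites of `Z`: it has the form `B ⊗ 1` for an operator `B` on the sites
of `Z` and the identity on the remaining sites. -/
def SupportedOn {V : Type*} [Fintype V] [DecidableEq V] {q : V → ℕ}
    (Z : Finset V) (A : Operator q) : Prop :=
  ∃ B : ((x : Z) → Fin (q x)) → ((x : Z) → Fin (q x)) → ℂ,
    ∀ σ τ : (x : V) → Fin (q x),
      ((∀ x ∉ Z, σ x = τ x) → matrixElement A σ τ = B (fun x => σ x) (fun x => τ x)) ∧
      ((∃ x ∉ Z, σ x ≠ τ x) → matrixElement A σ τ = 0)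

/-- The weighted sum `∑_{Z ∋ u} ‖Ψ_Z‖ |Z| (1 + diam Z)^k` over the regions covering the site `u`. -/
noncomputable def weightAt {V : Type*} [Fintype V] [DecidableEq V] [MetricSpace V] {q : V → ℕ}
    (k : ℕ) (Ψ : Finset V → Operator q) (u : V) : ℝ :=
  ∑ Z : Finset V with u ∈ Z, ‖Ψ Z‖ * (Z.card : ℝ) * (1 + Metric.diam (Z : Set V)) ^ k

/-- `φ` is the normalized, nondegenerate ground state of `H`, and every excitation above it costs
an energy of at least `Δ`. -/
def IsGroundStateWithGap {V : Type*} [Fintype V] [DecidableEq V] {q : V → ℕ}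
    (H : Operator q) (Δ : ℝ) (φ : ManyBody q) : Prop :=
  ‖φ‖ = 1 ∧ ∃ E : ℝ, H φ = (E : ℂ) • φ ∧
    ∀ ψ : ManyBody q, inner ℂ φ ψ = 0 → (E + Δ) * ‖ψ‖ ^ 2 ≤ (inner ℂ ψ (H ψ)).re

/-- `U s = 𝒯 exp (-i ∫₀ˢ K(g) dg)` for `s ∈ [0,1]`: the solution of `U' = -i K U`, `U 0 = 1`. -/
def IsPathOrderedExp {V : Type*} [Fintype V] [DecidableEq V] {q : V → ℕ}
    (K U : ℝ → Operator q) : Prop :=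
  U 0 = 1 ∧ ∀ s ∈ Set.Icc (0 : ℝ) 1,
    HasDerivWithinAt U ((-Complex.I) • (K s * U s)) (Set.Icc 0 1) s

/-! ### Families of systems

A family of systems is indexed by `n : ι` (the system size); all constants below are uniform in
`n`, which is how statements about the limit of infinite system size are expressed. -/

/-- The lattices have finite dimension, uniformly in the family: balls grow at most polynomially
in the radius. -/
def UniformPolynomialGrowth {ι : Type*} (Λ : ι → Type*) [∀ n, Fintype (Λ n)]
    [∀ n, MetricSpace (Λ n)] : Prop :=
  ∃ C : ℝ, ∃ D : ℕ, ∀ (n : ι) (x : Λ n) (r : ℝ), 0 ≤ r →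
    ((Metric.closedBall x r).ncard : ℝ) ≤ C * (1 + r) ^ D

/-- A local Hamiltonian `∑_Z h_Z`: each `h_Z` is Hermitian and supported on `Z`, and the terms
decay faster than any negative power of the diameter of `Z`, uniformly over the sites and over
the family. (The term with `Z = ∅` is a multiple of the identity, a mere shift of energy.) -/
def IsLocalHamiltonian {ι : Type*} {Λ : ι → Type*} [∀ n, Fintype (Λ n)]
    [∀ n, DecidableEq (Λ n)] [∀ n, MetricSpace (Λ n)] {q : ∀ n, Λ n → ℕ}
    (h : ∀ n, Finset (Λ n) → Operator (q n)) : Prop :=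
  (∀ n Z, IsSelfAdjoint (h n Z) ∧ SupportedOn Z (h n Z)) ∧
  ∀ k : ℕ, ∃ C : ℝ, ∀ (n : ι) (u : Λ n), weightAt k (h n) u ≤ C

/-- A smooth path `g ↦ ∑_Z h_Z(g)`, `g ∈ [0,1]`, of local Hamiltonians: all derivatives in `g` of
the terms satisfy the locality bounds, uniformly in `g`, over the sites and over the family. -/
def IsSmoothLocalPath {ι : Type*} {Λ : ι → Type*} [∀ n, Fintype (Λ n)]
    [∀ n, DecidableEq (Λ n)] [∀ n, MetricSpace (Λ n)] {q : ∀ n, Λ n → ℕ}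
    (h : ∀ n, ℝ → Finset (Λ n) → Operator (q n)) : Prop :=
  (∀ n, ∀ g ∈ Set.Icc (0 : ℝ) 1, ∀ Z, IsSelfAdjoint (h n g Z) ∧ SupportedOn Z (h n g Z)) ∧
  (∀ n Z, ContDiffOn ℝ ∞ (fun g => h n g Z) (Set.Icc 0 1)) ∧
  ∀ k m : ℕ, ∃ C : ℝ, ∀ (n : ι), ∀ g ∈ Set.Icc (0 : ℝ) 1, ∀ u : Λ n,
    weightAt k (fun Z => iteratedDerivWithin m (fun s => h n s Z) (Set.Icc 0 1) g) u ≤ C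

/-- Along `g ↦ Φ(g)`, `g ∈ [0,1]`, the expectation value of every local operator is smooth in `g`,
and stays so in the limit of infinite system size: each derivative is bounded by a constant that
depends only on its order and on the size of the support of the (normalized) operator. -/
def HasSmoothLocalExpectations {ι : Type*} {Λ : ι → Type*} [∀ n, Fintype (Λ n)]
    [∀ n, DecidableEq (Λ n)] [∀ n, MetricSpace (Λ n)] {q : ∀ n, Λ n → ℕ}
    (Φ : ∀ n, ℝ → ManyBody (q n)) : Prop :=
  (∀ (n : ι) (O : Operator (q n)),
    ContDiffOn ℝ ∞ (fun g => inner ℂ (Φ n g) (O (Φ n g))) (Set.Icc 0 1)) ∧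
  ∀ (m : ℕ) (r : ℝ), ∃ C : ℝ, ∀ (n : ι) (Z : Finset (Λ n)) (O : Operator (q n)),
    Metric.diam (Z : Set (Λ n)) ≤ r → SupportedOn Z O → ∀ g ∈ Set.Icc (0 : ℝ) 1,
      ‖iteratedDerivWithin m (fun s => inner ℂ (Φ n s) (O (Φ n s))) (Set.Icc 0 1) g‖ ≤ C * ‖O‖

/-- `Φ` is a gapped state: the ground state of some local Hamiltonian with an energy gap that is
bounded below uniformly in the system size. -/
def IsGappedState {ι : Type*} {Λ : ι → Type*} [∀ n, Fintype (Λ n)]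
    [∀ n, DecidableEq (Λ n)] [∀ n, MetricSpace (Λ n)] {q : ∀ n, Λ n → ℕ}
    (Φ : ∀ n, ManyBody (q n)) : Prop :=
  ∃ h : ∀ n, Finset (Λ n) → Operator (q n), IsLocalHamiltonian h ∧
    ∃ Δ > 0, ∀ n, IsGroundStateWithGap (∑ Z, h n Z) Δ (Φ n)

/-- `Φ₀` and `Φ₁` are in the same phase: they are the end points of ground states `Φ(g)` of a
smooth path of local Hamiltonians whose gap stays open, and along which all local expectation
values are smooth. -/
def InSamePhase {ι : Type*} {Λ : ι → Type*} [∀ n, Fintype (Λ n)]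
    [∀ n, DecidableEq (Λ n)] [∀ n, MetricSpace (Λ n)] {q : ∀ n, Λ n → ℕ}
    (Φ₀ Φ₁ : ∀ n, ManyBody (q n)) : Prop :=
  ∃ (h : ∀ n, ℝ → Finset (Λ n) → Operator (q n)) (Φ : ∀ n, ℝ → ManyBody (q n)),
    IsSmoothLocalPath h ∧
    (∀ n, Φ n 0 = Φ₀ n) ∧ (∀ n, Φ n 1 = Φ₁ n) ∧
    (∃ Δ > 0, ∀ n, ∀ g ∈ Set.Icc (0 : ℝ) 1,
      IsGroundStateWithGap (∑ Z, h n g Z) Δ (Φ n g)) ∧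
    HasSmoothLocalExpectations Φ

/-- `Φ₀` and `Φ₁` are related by a local unitary evolution:
`Φ₁ = 𝒯 exp (-i ∫₀¹ K(g) dg) Φ₀` with `K(g) = ∑_Z k_Z(g)` a smooth path of local Hamiltonians. -/
def RelatedByLocalUnitary {ι : Type*} {Λ : ι → Type*} [∀ n, Fintype (Λ n)]
    [∀ n, DecidableEq (Λ n)] [∀ n, MetricSpace (Λ n)] {q : ∀ n, Λ n → ℕ}
    (Φ₀ Φ₁ : ∀ n, ManyBody (q n)) : Prop :=
  ∃ (k : ∀ n, ℝ → Finset (Λ n) → Operator (q n)) (U : ∀ n, ℝ → Operator (q n)),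
    IsSmoothLocalPath k ∧
    (∀ n, IsPathOrderedExp (fun g => ∑ Z, k n g Z) (U n)) ∧
    ∀ n, Φ₁ n = U n 1 (Φ₀ n)

/-!
A local unitary evolution transports a gapped ground state together with its Hamiltonian, and
conversely the quasi-adiabatic evolution of Hastings and Wen carries the ground state along a
gapped path of Hamiltonians. Both directions say that some family of operators is again a smooth
path of local Hamiltonians. The locality rests on Lieb–Robinson bounds.

**From an evolution to a phase.** Let `Φ₀` be the gapped ground state of `∑ Z, h Z`, and let `U g`
be the given evolution. The path `U g (∑ Z, h Z) (U g)⋆` has the ground state `U g Φ₀`, with the same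
gap (`IsGroundStateWithGap.conj`). The terms of `h` are first collected into one operator per site
(`siteTerm`). An evolved site term is almost local, that is, approximated by operators on balls
around the site up to errors that decay faster than any power of the radius
(`norm_opComm_heisenberg_le`, `AlmostLocal.heisenberg`). Each derivative in `g` is a commutator with
the generator, which preserves almost local operators (`DerivAlmostLocal.schrodinger`). Cutting the
evolved site terms into shells around the sites turns their sum back into a sum over regions
(`exists_isSmoothLocalPath`). Derivatives of expectation values are expectation values of commutators
with the generator; for an operator of norm one on a region of given diameter these have bounded
norm, uniformly in the system (`tempered_iteratedDeriv_expectL`).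

**From a phase to an evolution.** Let `H g` be a path with ground state projection `P g` and gap `Δ`.
A filter function `c` is built from a Schwartz function whose Fourier transform vanishes
outside `(-Δ, Δ)`, so that averaging the Heisenberg evolution over time with the weight `c` inverts
`[H, ·]`, up to a factor of `i`, on operators that only connect the ground state with excited states
(`exists_filter`, `IsGroundStateWithGap.filtered_opComm`). Since `P'` is such an operator and
`[H', P] = -[H, P']`, the operator `K = -filtered c H H'` satisfies `P' = -i [K, P]`
(`hasDerivAt_groundState_projection`). So the evolution generated by `K` carries `P 0` to `P 1`, and
the ground state itself up to a phase (`exists_phase`). The phase is produced by a constant added to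
`K`; as a term on the empty region it does not enter the decay condition, so it may depend on the
system without any bound. It remains to see that `K` is local. Its part at a site is an average of
evolutions over arbitrary times, and the evolution over a time `s` is almost local with constants that
grow like a power of `s`, together with all derivatives in `g`: these follow from Duhamel's formula
by induction on the order (`DerivAlmostLocal.heisenberg`). The rapid decay of `c` beats the powers of
`s` (`DerivAlmostLocal.filtered`).

Paths over `[0, 1]` are reparametrized by `Real.smoothTransition`, which makes them smooth on the
whole real line with bounded derivatives (`IsSmoothLocalPath.isSmoothLocalSum`) and leaves their end
points in place.
-/

set_option linter.unusedSectionVars false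

/-! ### Operators supported on a region -/

section Support

variable {V : Type*} [Fintype V] [DecidableEq V] {q : V → ℕ}

/-- The operator with prescribed matrix elements between basis configurations. -/
noncomputable def ofEntries (M : ((x : V) → Fin (q x)) → ((x : V) → Fin (q x)) → ℂ) : Operator q :=
  Matrix.toEuclideanCLM (𝕜 := ℂ) (Matrix.of M)

lemma ofEntries_apply (M : ((x : V) → Fin (q x)) → ((x : V) → Fin (q x)) → ℂ)
    (ψ : ManyBody q) (σ : (x : V) → Fin (q x)) :
    ofEntries M ψ σ = ∑ τ, M σ τ * ψ τ := by
  simp [ofEntries, Matrix.mulVec, dotProduct]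

lemma matrixElement_ofEntries (M : ((x : V) → Fin (q x)) → ((x : V) → Fin (q x)) → ℂ)
    (σ τ : (x : V) → Fin (q x)) : matrixElement (ofEntries M) σ τ = M σ τ := by
  simp [matrixElement, ofEntries_apply]

lemma operator_ext {A B : Operator q} (h : ∀ σ τ, matrixElement A σ τ = matrixElement B σ τ) :
    A = B := by
  refine ContinuousLinearMap.coe_injective
    ((EuclideanSpace.basisFun ((x : V) → Fin (q x)) ℂ).toBasis.ext fun τ => ?_)
  ext σ
  simpa [matrixElement] using h σ τ

lemma ofEntries_matrixElement (A : Operator q) : ofEntries (matrixElement A) = A :=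
  operator_ext fun _ _ => matrixElement_ofEntries _ _ _

lemma apply_eq_sum (A : Operator q) (ψ : ManyBody q) (σ : (x : V) → Fin (q x)) :
    A ψ σ = ∑ τ, matrixElement A σ τ * ψ τ := by
  conv_lhs => rw [← ofEntries_matrixElement A]
  rw [ofEntries_apply]

lemma matrixElement_mul (A B : Operator q) (σ τ : (x : V) → Fin (q x)) :
    matrixElement (A * B) σ τ = ∑ κ, matrixElement A σ κ * matrixElement B κ τ := by
  change A (B _) σ = _
  rw [apply_eq_sum]; rfl

lemma matrixElement_add (A B : Operator q) (σ τ : (x : V) → Fin (q x)) :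
    matrixElement (A + B) σ τ = matrixElement A σ τ + matrixElement B σ τ := rfl

lemma matrixElement_smul (c : ℂ) (A : Operator q) (σ τ : (x : V) → Fin (q x)) :
    matrixElement (c • A) σ τ = c * matrixElement A σ τ := rfl

lemma matrixElement_star (A : Operator q) (σ τ : (x : V) → Fin (q x)) :
    matrixElement (star A) σ τ = star (matrixElement A τ σ) := by
  have h := ContinuousLinearMap.adjoint_inner_right A (EuclideanSpace.single σ (1 : ℂ))
    (EuclideanSpace.single τ 1)
  rw [EuclideanSpace.inner_single_left, EuclideanSpace.inner_single_right] at h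
  simpa [matrixElement, ContinuousLinearMap.star_eq_adjoint] using h

/-- The configuration that equals `a` on `Z` and `b` elsewhere. -/
def merge (Z : Finset V) (a b : (x : V) → Fin (q x)) : (x : V) → Fin (q x) :=
  fun x => if x ∈ Z then a x else b x

lemma merge_of_mem {Z : Finset V} (a b : (x : V) → Fin (q x)) {x : V} (hx : x ∈ Z) :
    merge Z a b x = a x := if_pos hx

lemma merge_of_notMem {Z : Finset V} (a b : (x : V) → Fin (q x)) {x : V} (hx : x ∉ Z) :
    merge Z a b x = b x := if_neg hx

lemma merge_right_congr {Z : Finset V} {a b b' : (x : V) → Fin (q x)} (h : ∀ x ∉ Z, b x = b' x) :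
    merge Z a b = merge Z a b' := by
  funext x; by_cases hx : x ∈ Z <;> simp [merge, hx, h]

/-- Support of an operator in terms of its matrix elements: they vanish unless the two
configurations agree off `Z`, and do not depend on their common values there. -/
lemma supportedOn_iff (Z : Finset V) (A : Operator q) :
    SupportedOn Z A ↔ ∀ σ τ : (x : V) → Fin (q x),
      ((∃ x ∉ Z, σ x ≠ τ x) → matrixElement A σ τ = 0) ∧
      ((∀ x ∉ Z, σ x = τ x) → ∀ c,
        matrixElement A (merge Z σ c) (merge Z τ c) = matrixElement A σ τ) := by
  constructor
  · rintro ⟨B, hB⟩ σ τ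
    refine ⟨(hB σ τ).2, fun h c => ?_⟩
    rw [(hB σ τ).1 h, (hB _ _).1 fun x hx => by simp [merge, hx]]
    congr 1 <;> funext x <;> simp [merge]
  · intro h
    by_cases hne : Nonempty ((x : V) → Fin (q x))
    · obtain ⟨c⟩ := hne
      refine ⟨fun a b => matrixElement A (fun x => if hx : x ∈ Z then a ⟨x, hx⟩ else c x)
        (fun x => if hx : x ∈ Z then b ⟨x, hx⟩ else c x), fun σ τ => ⟨fun hst => ?_, (h σ τ).1⟩⟩
      rw [← (h σ τ).2 hst c]
      congr 1
    · exact ⟨0, fun σ => (hne ⟨σ⟩).elim⟩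

lemma SupportedOn.mono {Z W : Finset V} {A : Operator q} (hA : SupportedOn Z A) (h : Z ⊆ W) :
    SupportedOn W A := by
  rw [supportedOn_iff] at hA ⊢
  intro σ τ
  refine ⟨fun ⟨x, hx, hne⟩ => (hA σ τ).1 ⟨x, fun hz => hx (h hz), hne⟩, fun hst c => ?_⟩
  by_cases hZ : ∀ x ∉ Z, σ x = τ x
  · rw [← (hA σ τ).2 hZ c, ← (hA (merge W σ c) (merge W τ c)).2
      (fun x hx => by by_cases hw : x ∈ W <;> simp [merge, hw, hZ x hx]) c]
    congr 1 <;> funext x <;> by_cases hz : x ∈ Z <;> simp [merge, hz, @h x]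
  · push Not at hZ
    obtain ⟨x, hx, hne⟩ := hZ
    rw [(hA σ τ).1 ⟨x, hx, hne⟩, (hA _ _).1 ⟨x, hx, ?_⟩]
    have hw : x ∈ W := by by_contra hw; exact hne (hst x hw)
    simpa [merge, hw] using hne

/-- Operators with disjoint supports commute. -/
lemma SupportedOn.commute {Z W : Finset V} {A B : Operator q} (hA : SupportedOn Z A)
    (hB : SupportedOn W B) (h : Disjoint Z W) : A * B = B * A := by
  rw [supportedOn_iff] at hA hB
  refine operator_ext fun σ τ => ?_
  rw [matrixElement_mul, matrixElement_mul,
    Finset.sum_eq_single (merge Z τ σ), Finset.sum_eq_single (merge Z σ τ)]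
  · by_cases hne : ∃ x, x ∉ Z ∧ x ∉ W ∧ σ x ≠ τ x
    · obtain ⟨x, hx, hw, hne⟩ := hne
      rw [(hB (merge Z τ σ) τ).1 ⟨x, hw, by simpa [merge, hx] using hne⟩,
        (hB σ (merge Z σ τ)).1 ⟨x, hw, by simpa [merge, hx] using hne⟩]
      simp
    · push Not at hne
      have hW : ∀ x, x ∈ W → x ∉ Z := fun x hw hz => Finset.disjoint_left.1 h hz hw
      have h1 : matrixElement A (merge Z σ τ) τ = matrixElement A σ (merge Z τ σ) := by
        rw [← (hA σ (merge Z τ σ)).2 (fun x hx => by simp [merge, hx]) τ]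
        congr 1
        funext x; by_cases hx : x ∈ Z <;> simp [merge, hx]
      have h2 : matrixElement B (merge Z τ σ) τ = matrixElement B σ (merge Z σ τ) := by
        rw [← (hB (merge Z τ σ) τ).2 (fun x hx => ?_) σ]
        · congr 1 <;> funext x <;> by_cases hx : x ∈ W
          · simp [merge, hx, hW x hx]
          · simp [merge, hx]
          · simp [merge, hx, hW x hx]
          · by_cases hz : x ∈ Z <;> simp [merge, hx, hz, hne]
        · by_cases hz : x ∈ Z <;> simp [merge, hz, hne, hx]
      rw [h1, h2, mul_comm]
  · intro κ _ hκ
    by_cases h1 : ∃ x ∉ W, σ x ≠ κ x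
    · rw [(hB _ _).1 h1, zero_mul]
    · push Not at h1
      rw [(hA κ τ).1, mul_zero]
      by_contra h2
      push Not at h2
      refine hκ (funext fun x => ?_)
      by_cases hx : x ∈ Z
      · rw [merge_of_mem _ _ hx, h1 x (Finset.disjoint_left.1 h hx)]
      · rw [merge_of_notMem _ _ hx, h2 x hx]
  · simp
  · intro κ _ hκ
    by_cases h1 : ∃ x ∉ Z, σ x ≠ κ x
    · rw [(hA _ _).1 h1, zero_mul]
    · push Not at h1
      rw [(hB κ τ).1, mul_zero]
      by_contra h2
      push Not at h2
      refine hκ (funext fun x => ?_)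
      by_cases hx : x ∈ Z
      · rw [merge_of_mem _ _ hx, h2 x (Finset.disjoint_left.1 h hx)]
      · rw [merge_of_notMem _ _ hx, h1 x hx]
  · simp

/-- The matrix unit `1 ⊗ |a⟩⟨b|` on the sites off `Z`. -/
noncomputable def offUnit (Z : Finset V) (a b : (x : V) → Fin (q x)) : Operator q :=
  ofEntries fun σ τ => if (∀ x ∉ Z, σ x = a x ∧ τ x = b x) ∧ ∀ x ∈ Z, σ x = τ x then 1 else 0

lemma supportedOn_offUnit (Z : Finset V) (a b : (x : V) → Fin (q x)) :
    SupportedOn Zᶜ (offUnit Z a b) := by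
  rw [supportedOn_iff]
  intro σ τ
  simp only [offUnit, matrixElement_ofEntries]
  constructor
  · rintro ⟨x, hx, hne⟩
    rw [if_neg]
    rintro ⟨-, h⟩
    exact hne (h x (by simpa using hx))
  · intro h c
    congr 1
    simp only [eq_iff_iff]
    refine and_congr (forall₂_congr fun x hx => ?_) (forall₂_congr fun x hx => ?_)
    · simp [merge, hx]
    · simp [merge, hx, h x (by simpa using hx)]

lemma matrixElement_offUnit_mul (Z : Finset V) (a b : (x : V) → Fin (q x)) (A : Operator q)
    (σ τ : (x : V) → Fin (q x)) : matrixElement (offUnit Z a b * A) σ τ =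
      if ∀ x ∉ Z, σ x = a x then matrixElement A (merge Z σ b) τ else 0 := by
  rw [matrixElement_mul, Finset.sum_eq_single (merge Z σ b)]
  · simp only [offUnit, matrixElement_ofEntries]
    split_ifs with h1 h2 h2
    · simp
    · exact absurd (fun x hx => (h1.1 x hx).1) h2
    · refine absurd ⟨fun x hx => ⟨h2 x hx, by simp [merge, hx]⟩, fun x hx => by simp [merge, hx]⟩ h1
    · simp
  · intro κ _ hκ
    simp only [offUnit, matrixElement_ofEntries]
    rw [if_neg, zero_mul]
    rintro ⟨h1, h2⟩
    refine hκ (funext fun x => ?_)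
    by_cases hx : x ∈ Z
    · simp [merge, hx, h2]
    · simp [merge, hx, h1]
  · simp

lemma matrixElement_mul_offUnit (Z : Finset V) (a b : (x : V) → Fin (q x)) (A : Operator q)
    (σ τ : (x : V) → Fin (q x)) : matrixElement (A * offUnit Z a b) σ τ =
      if ∀ x ∉ Z, τ x = b x then matrixElement A σ (merge Z τ a) else 0 := by
  rw [matrixElement_mul, Finset.sum_eq_single (merge Z τ a)]
  · simp only [offUnit, matrixElement_ofEntries]
    split_ifs with h1 h2 h2
    · simp
    · exact absurd (fun x hx => (h1.1 x hx).2) h2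
    · refine absurd ⟨fun x hx => ⟨by simp [merge, hx], h2 x hx⟩, fun x hx => by simp [merge, hx]⟩ h1
    · simp
  · intro κ _ hκ
    simp only [offUnit, matrixElement_ofEntries]
    rw [if_neg, mul_zero]
    rintro ⟨h1, h2⟩
    refine hκ (funext fun x => ?_)
    by_cases hx : x ∈ Z
    · simp [merge, hx, h2]
    · simp [merge, hx, h1]
  · simp

/-- An operator that commutes with every operator supported off `Z` is supported on `Z`. -/
lemma supportedOn_of_commute {Z : Finset V} {A : Operator q}
    (h : ∀ B : Operator q, SupportedOn Zᶜ B → A * B = B * A) : SupportedOn Z A := by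
  rw [supportedOn_iff]
  intro σ τ
  constructor
  · rintro ⟨x, hx, hne⟩
    have h1 := congrArg (fun B => matrixElement B σ τ) (h _ (supportedOn_offUnit Z σ σ))
    simp only [matrixElement_mul_offUnit, matrixElement_offUnit_mul] at h1
    have h2 : merge Z σ σ = σ := by funext y; simp [merge]
    rw [if_neg (fun h => hne (h x hx).symm), if_pos (fun _ _ => trivial), h2] at h1
    exact h1.symm
  · intro hst c
    have h1 := congrArg (fun B => matrixElement B (merge Z σ c) τ)
      (h _ (supportedOn_offUnit Z c σ))
    simp only [matrixElement_mul_offUnit, matrixElement_offUnit_mul] at h1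
    rw [if_pos (fun x hx => (hst x hx).symm), if_pos (fun x hx => by simp [merge, hx])] at h1
    rw [h1]
    congr 1
    funext y; by_cases hy : y ∈ Z <;> simp [merge, hy]

lemma supportedOn_iff_commute (Z : Finset V) (A : Operator q) :
    SupportedOn Z A ↔ ∀ B : Operator q, SupportedOn Zᶜ B → A * B = B * A :=
  ⟨fun hA _ hB => hA.commute hB disjoint_compl_right, supportedOn_of_commute⟩

lemma supportedOn_univ (A : Operator q) : SupportedOn Finset.univ A := by
  rw [supportedOn_iff]
  intro σ τ
  refine ⟨by simp, fun _ c => ?_⟩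
  congr 1 <;> funext x <;> simp [merge]

lemma SupportedOn.mul {Z : Finset V} {A B : Operator q} (hA : SupportedOn Z A)
    (hB : SupportedOn Z B) : SupportedOn Z (A * B) := by
  rw [supportedOn_iff_commute] at *
  intro C hC
  rw [mul_assoc, hB C hC, ← mul_assoc, hA C hC, mul_assoc]

lemma SupportedOn.add {Z : Finset V} {A B : Operator q} (hA : SupportedOn Z A)
    (hB : SupportedOn Z B) : SupportedOn Z (A + B) := by
  rw [supportedOn_iff_commute] at *
  intro C hC
  rw [add_mul, mul_add, hA C hC, hB C hC]

lemma SupportedOn.smul {Z : Finset V} {A : Operator q} (c : ℂ) (hA : SupportedOn Z A) :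
    SupportedOn Z (c • A) := by
  rw [supportedOn_iff_commute] at *
  intro C hC
  rw [smul_mul_assoc, mul_smul_comm, hA C hC]

lemma SupportedOn.real_smul {Z : Finset V} {A : Operator q} (c : ℝ) (hA : SupportedOn Z A) :
    SupportedOn Z (c • A) := by
  rw [← Complex.coe_smul]; exact hA.smul _

lemma SupportedOn.neg {Z : Finset V} {A : Operator q} (hA : SupportedOn Z A) :
    SupportedOn Z (-A) := by
  rw [← neg_one_smul ℂ]; exact hA.smul _

lemma SupportedOn.sub {Z : Finset V} {A B : Operator q} (hA : SupportedOn Z A)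
    (hB : SupportedOn Z B) : SupportedOn Z (A - B) := by
  rw [sub_eq_add_neg]; exact hA.add hB.neg

lemma supportedOn_zero (Z : Finset V) : SupportedOn Z (0 : Operator q) := by
  rw [supportedOn_iff_commute]; simp

lemma supportedOn_one (Z : Finset V) : SupportedOn Z (1 : Operator q) := by
  rw [supportedOn_iff_commute]; simp

lemma SupportedOn.sum {Z : Finset V} {α : Type*} {s : Finset α} {A : α → Operator q}
    (hA : ∀ i ∈ s, SupportedOn Z (A i)) : SupportedOn Z (∑ i ∈ s, A i) := by
  classical
  induction s using Finset.induction_on with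
  | empty => simpa using supportedOn_zero Z
  | insert a s ha ih =>
    rw [Finset.sum_insert ha]
    exact (hA a (by simp)).add (ih fun i hi => hA i (by simp [hi]))

lemma SupportedOn.star {Z : Finset V} {A : Operator q} (hA : SupportedOn Z A) :
    SupportedOn Z (star A) := by
  obtain ⟨B, hB⟩ := hA
  refine ⟨fun a b => Star.star (B b a), fun σ τ => ⟨fun h => ?_, fun ⟨x, hx, hne⟩ => ?_⟩⟩
  · rw [matrixElement_star, (hB τ σ).1 fun x hx => (h x hx).symm]
  · rw [matrixElement_star, (hB τ σ).2 ⟨x, hx, hne.symm⟩, star_zero]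

/-- An operator supported on the empty region is a multiple of the identity. -/
lemma SupportedOn.eq_smul_one {A : Operator q} (hA : SupportedOn ∅ A) : ∃ c : ℂ, A = c • 1 := by
  obtain ⟨B, hB⟩ := hA
  refine ⟨B (fun x => (Finset.notMem_empty _ x.2).elim) (fun x => (Finset.notMem_empty _ x.2).elim),
    operator_ext fun σ τ => ?_⟩
  have h1 : matrixElement (1 : Operator q) σ τ = if σ = τ then 1 else 0 := by
    simp [matrixElement]
  rw [matrixElement_smul, h1]
  split_ifs with h
  · rw [(hB σ τ).1 (by simp [h]), mul_one]
    congr 1 <;> funext x <;> exact (Finset.notMem_empty _ x.2).elim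
  · rw [(hB σ τ).2, mul_zero]
    by_contra h2
    push Not at h2
    exact h (funext fun x => h2 x (by simp))

/-! ### Cutting an operator down to a region -/

variable [∀ x, NeZero (q x)]

/-- The localization of `A` to `Z`: the sites off `Z` are frozen in the configuration `0`, and the
resulting operator on `Z` is tensored with the identity. -/
noncomputable def cut (Z : Finset V) (A : Operator q) : Operator q :=
  ofEntries fun σ τ =>
    if ∀ x ∉ Z, σ x = τ x then matrixElement A (merge Z σ 0) (merge Z τ 0) else 0

lemma supportedOn_cut (Z : Finset V) (A : Operator q) : SupportedOn Z (cut Z A) := by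
  rw [supportedOn_iff]
  intro σ τ
  simp only [cut, matrixElement_ofEntries]
  refine ⟨fun ⟨x, hx, hne⟩ => if_neg fun h => hne (h x hx), fun h c => ?_⟩
  rw [if_pos h, if_pos fun x hx => by simp [merge, hx]]
  congr 1 <;> funext x <;> by_cases hx : x ∈ Z <;> simp [merge, hx]

lemma cut_eq_self {Z : Finset V} {A : Operator q} (hA : SupportedOn Z A) : cut Z A = A := by
  rw [supportedOn_iff] at hA
  refine operator_ext fun σ τ => ?_
  rw [cut, matrixElement_ofEntries]
  split_ifs with h
  · exact (hA σ τ).2 h 0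
  · push Not at h
    exact ((hA σ τ).1 h).symm

lemma cut_add (Z : Finset V) (A B : Operator q) : cut Z (A + B) = cut Z A + cut Z B := by
  refine operator_ext fun σ τ => ?_
  simp only [cut, matrixElement_add, matrixElement_ofEntries]
  split_ifs <;> simp

lemma cut_smul (Z : Finset V) (c : ℂ) (A : Operator q) : cut Z (c • A) = c • cut Z A := by
  refine operator_ext fun σ τ => ?_
  simp only [cut, matrixElement_smul, matrixElement_ofEntries]
  split_ifs <;> simp

lemma cut_star (Z : Finset V) (A : Operator q) : cut Z (star A) = star (cut Z A) := by
  refine operator_ext fun σ τ => ?_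
  simp only [cut, matrixElement_star, matrixElement_ofEntries]
  simp only [eq_comm (a := σ _)]
  split_ifs <;> simp

/-- A sum over configurations, split by their restrictions to `Z` and to its complement. -/
lemma sum_split (Z : Finset V) (f : ((x : V) → Fin (q x)) → ℝ) :
    ∑ σ, f σ = ∑ b : (x : {x // x ∉ Z}) → Fin (q x), ∑ a : (x : {x // x ∈ Z}) → Fin (q x),
      f ((Equiv.piEquivPiSubtypeProd (· ∈ Z) fun x => Fin (q x)).symm (a, b)) := by
  rw [← (Equiv.piEquivPiSubtypeProd (· ∈ Z) fun x => Fin (q x)).symm.sum_comp,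
    Fintype.sum_prod_type, Finset.sum_comm]

/-- In the decomposition of the state space into sectors of fixed configuration off `Z`, `cut Z A`
is block diagonal, and each block is a compression of `A`. -/
lemma norm_cut_le (Z : Finset V) (A : Operator q) : ‖cut Z A‖ ≤ ‖A‖ := by
  refine ContinuousLinearMap.opNorm_le_bound _ (norm_nonneg _) fun ψ => ?_
  -- `T τ ψ` moves the component of `ψ` in the sector of `τ` to the sector of the frozen sites
  let T : ((x : V) → Fin (q x)) → ManyBody q := fun τ =>
    WithLp.toLp 2 fun σ => if ∀ x ∉ Z, σ x = 0 then ψ (merge Z σ τ) else 0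
  let e := (Equiv.piEquivPiSubtypeProd (· ∈ Z) fun x => Fin (q x)).symm
  have he1 : ∀ a b x (hx : x ∈ Z), e (a, b) x = a ⟨x, hx⟩ := fun a b x hx => by
    simp [e, Equiv.piEquivPiSubtypeProd, hx]
  have he2 : ∀ a b x (hx : x ∉ Z), e (a, b) x = b ⟨x, hx⟩ := fun a b x hx => by
    simp [e, Equiv.piEquivPiSubtypeProd, hx]
  have hcut : ∀ σ, cut Z A ψ σ = A (T σ) (merge Z σ 0) := by
    intro σ
    rw [cut, ofEntries_apply, apply_eq_sum]
    simp only [T, ite_mul, zero_mul, mul_ite, mul_zero]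
    rw [← Finset.sum_filter, ← Finset.sum_filter]
    refine Finset.sum_nbij' (fun τ => merge Z τ 0) (fun κ => merge Z κ σ) ?_ ?_ ?_ ?_ ?_
    · intro τ hτ; simp +contextual [merge]
    · intro τ hτ; simp +contextual [merge]
    · intro τ hτ
      simp only [Finset.mem_filter, Finset.mem_univ, true_and] at hτ
      funext x; by_cases hx : x ∈ Z <;> simp [merge, hx, hτ]
    · intro τ hτ
      simp only [Finset.mem_filter, Finset.mem_univ, true_and] at hτ
      funext x; by_cases hx : x ∈ Z <;> simp [merge, hx, hτ]
    · intro τ hτ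
      simp only [Finset.mem_filter, Finset.mem_univ, true_and] at hτ
      refine congrArg _ (congrArg ψ (funext fun x => ?_))
      by_cases hx : x ∈ Z <;> simp [merge, hx, hτ]
  have hT : ∀ a b, T (e (a, b)) = T (e (0, b)) := by
    intro a b
    ext σ
    simp only [T]
    rw [merge_right_congr fun x hx => ?_]
    rw [he2 _ _ x hx, he2 _ _ x hx]
  have hT2 : ∀ b, ‖T (e (0, b))‖ ^ 2 = ∑ a, ‖ψ (e (a, b))‖ ^ 2 := by
    intro b
    rw [EuclideanSpace.norm_sq_eq, sum_split Z, Finset.sum_eq_single 0]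
    · refine Finset.sum_congr rfl fun a _ => ?_
      change ‖if ∀ x ∉ Z, e (a, 0) x = 0 then ψ (merge Z (e (a, 0)) (e (0, b))) else 0‖ ^ 2 = _
      have hz : ∀ x ∉ Z, e (a, 0) x = 0 := fun x hx => he2 a 0 x hx
      rw [if_pos hz]
      refine congrArg (fun σ => ‖ψ σ‖ ^ 2) (funext fun x => ?_)
      by_cases hx : x ∈ Z
      · rw [merge_of_mem _ _ hx, he1 _ _ x hx]; exact (he1 a b x hx).symm
      · rw [merge_of_notMem _ _ hx, he2 _ _ x hx, he2 _ _ x hx]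
    · intro b' _ hb'
      refine Finset.sum_eq_zero fun a _ => ?_
      simp only [T]
      rw [if_neg, norm_zero]; · norm_num
      intro h
      refine hb' (funext fun x => ?_)
      rw [← he2 a b' x.1 x.2]; exact h x.1 x.2
    · simp
  rw [← sq_le_sq₀ (norm_nonneg _) (by positivity), mul_pow, EuclideanSpace.norm_sq_eq,
    EuclideanSpace.norm_sq_eq, sum_split Z, sum_split Z, Finset.mul_sum]
  refine Finset.sum_le_sum fun b _ => ?_
  change ∑ a, ‖cut Z A ψ (e (a, b))‖ ^ 2 ≤ ‖A‖ ^ 2 * ∑ a, ‖ψ (e (a, b))‖ ^ 2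
  rw [← hT2, ← mul_pow]
  refine le_trans ?_ (pow_le_pow_left₀ (norm_nonneg _) (A.le_opNorm _) 2)
  rw [EuclideanSpace.norm_sq_eq, sum_split Z]
  refine le_trans ?_ (Finset.single_le_sum (f := fun b' =>
    ∑ a, ‖(A (T (e (0, b)))) (e (a, b'))‖ ^ 2) (fun i _ => by positivity) (Finset.mem_univ 0))
  refine le_of_eq (Finset.sum_congr rfl fun a _ => ?_)
  rw [hcut, hT]
  refine congrArg (fun σ => ‖A (T (e (0, b))) σ‖ ^ 2) (funext fun x => ?_)
  by_cases hx : x ∈ Z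
  · rw [merge_of_mem _ _ hx, he1 _ _ x hx, he1 _ _ x hx]
  · rw [merge_of_notMem _ _ hx, he2 _ _ x hx]; rfl

/-- `cut Z` as a bounded linear map. -/
noncomputable def cutL (Z : Finset V) : Operator q →L[ℂ] Operator q :=
  LinearMap.mkContinuous ⟨⟨cut Z, cut_add Z⟩, cut_smul Z⟩ 1 fun A => by
    simpa using norm_cut_le Z A

lemma cutL_apply (Z : Finset V) (A : Operator q) : cutL Z A = cut Z A := rfl

lemma cut_sub (Z : Finset V) (A B : Operator q) : cut Z (A - B) = cut Z A - cut Z B := by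
  simp only [← cutL_apply, map_sub]

/-- Up to a factor of two, `cut Z A` is the best approximation of `A` by operators on `Z`. -/
lemma norm_sub_cut_le {Z : Finset V} (A : Operator q) {B : Operator q} (hB : SupportedOn Z B) :
    ‖A - cut Z A‖ ≤ 2 * ‖A - B‖ := by
  have h : A - cut Z A = (A - B) - cut Z (A - B) := by rw [cut_sub, cut_eq_self hB]; abel
  rw [h]
  linarith [norm_sub_le (A - B) (cut Z (A - B)), norm_cut_le Z (A - B)]

end Support

/-! ### Time-ordered exponentials -/

section Propagator

variable {𝔸 : Type*} [CStarAlgebra 𝔸]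

/-- The commutator `AB - BA`. -/
def opComm (A B : 𝔸) : 𝔸 := A * B - B * A

/-- `U` is the time-ordered exponential of `-i K`, for all times. -/
def IsPropagator (K U : ℝ → 𝔸) : Prop :=
  U 0 = 1 ∧ ∀ t, HasDerivAt U ((-Complex.I) • (K t * U t)) t

/-- The terms of the Dyson series. -/
noncomputable def dysonTerm (K : ℝ → 𝔸) : ℕ → ℝ → 𝔸
  | 0 => fun _ => 1
  | n + 1 => fun t => ∫ x in (0 : ℝ)..t, (-Complex.I) • (K x * dysonTerm K n x)

lemma continuous_dysonTerm {K : ℝ → 𝔸} (hK : Continuous K) (n : ℕ) :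
    Continuous (dysonTerm K n) := by
  induction n with
  | zero => exact continuous_const
  | succ n ih =>
    have h : Continuous fun x => (-Complex.I) • (K x * dysonTerm K n x) :=
      (hK.mul ih).const_smul _
    exact intervalIntegral.continuous_primitive (fun a b => h.intervalIntegrable a b) 0

lemma hasDerivAt_dysonTerm_succ {K : ℝ → 𝔸} (hK : Continuous K) (n : ℕ) (t : ℝ) :
    HasDerivAt (dysonTerm K (n + 1)) ((-Complex.I) • (K t * dysonTerm K n t)) t := by
  have h : Continuous fun x => (-Complex.I) • (K x * dysonTerm K n x) :=
    (hK.mul (continuous_dysonTerm hK n)).const_smul _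
  exact intervalIntegral.integral_hasDerivAt_right (h.intervalIntegrable _ _)
    (h.stronglyMeasurableAtFilter _ _) h.continuousAt

lemma norm_dysonTerm_le {K : ℝ → 𝔸} {M T : ℝ} (hM : ∀ t, |t| ≤ T → ‖K t‖ ≤ M) (n : ℕ) :
    ∀ t, |t| ≤ T → ‖dysonTerm K n t‖ ≤ ‖(1 : 𝔸)‖ * ((M * |t|) ^ n / n.factorial) := by
  induction n with
  | zero => intro t _; simp [dysonTerm]
  | succ n ih =>
    intro t ht
    have hM0 : 0 ≤ M := (norm_nonneg _).trans (hM t ht)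
    have hle : ∀ x ∈ Set.uIoc 0 t, ‖(-Complex.I) • (K x * dysonTerm K n x)‖ ≤
        ‖(1 : 𝔸)‖ * (M ^ (n + 1) / n.factorial) * |x - 0| ^ n := by
      intro x hx
      have hxt : |x| ≤ |t| := by
        have h := Set.abs_sub_left_of_mem_uIcc (Set.uIoc_subset_uIcc hx)
        simpa using h
      rw [norm_smul, norm_neg, Complex.norm_I, one_mul, sub_zero]
      calc ‖K x * dysonTerm K n x‖ ≤ ‖K x‖ * ‖dysonTerm K n x‖ := norm_mul_le _ _
        _ ≤ M * (‖(1 : 𝔸)‖ * ((M * |x|) ^ n / n.factorial)) := by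
          gcongr
          · exact hM x (hxt.trans ht)
          · exact ih x (hxt.trans ht)
        _ = _ := by rw [mul_pow]; ring
    have h1 := intervalIntegral.norm_integral_le_abs_of_norm_le
      (μ := MeasureTheory.volume) (a := 0) (b := t)
      (f := fun x => (-Complex.I) • (K x * dysonTerm K n x))
      (g := fun x => ‖(1 : 𝔸)‖ * (M ^ (n + 1) / n.factorial) * |x - 0| ^ n)
      ((MeasureTheory.ae_restrict_mem measurableSet_uIoc).mono hle)
      (Continuous.intervalIntegrable (by fun_prop) _ _)
    refine h1.trans (le_of_eq ?_)
    rw [intervalIntegral.abs_integral_eq_abs_integral_uIoc, MeasureTheory.integral_const_mul,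
      integral_pow_abs_sub_uIoc, sub_zero, abs_of_nonneg (by positivity), Nat.factorial_succ,
      mul_pow]
    push_cast
    field_simp

lemma exists_isPropagator {K : ℝ → 𝔸} (hK : Continuous K) : ∃ U, IsPropagator K U := by
  refine ⟨fun t => ∑' n, dysonTerm K n t, ?_, fun t => ?_⟩
  · change ∑' n, dysonTerm K n 0 = 1
    rw [tsum_eq_single 0]
    · rfl
    · intro n hn
      obtain ⟨m, rfl⟩ := Nat.exists_eq_succ_of_ne_zero hn
      simp [dysonTerm]
  · set T := |t| + 1 with hT
    obtain ⟨M, hM⟩ : ∃ M, ∀ s, |s| ≤ T → ‖K s‖ ≤ M := by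
      obtain ⟨M, hM⟩ := (isCompact_Icc (a := -T) (b := T)).exists_bound_of_continuousOn
        hK.continuousOn
      exact ⟨M, fun s hs => hM s (abs_le.1 hs)⟩
    have hT0 : 0 ≤ T := by positivity
    have hM0 : 0 ≤ M := (norm_nonneg _).trans (hM 0 (by simpa using hT0))
    have hb : ∀ n s, |s| ≤ T → ‖dysonTerm K n s‖ ≤ ‖(1 : 𝔸)‖ * ((M * T) ^ n / n.factorial) :=
      fun n s hs => (norm_dysonTerm_le hM n s hs).trans (by gcongr)
    have hsum : Summable fun n : ℕ => ‖(1 : 𝔸)‖ * ((M * T) ^ n / n.factorial) :=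
      (Real.summable_pow_div_factorial _).mul_left _
    have hs : ∀ s, |s| ≤ T → Summable fun n => dysonTerm K n s := fun s hs =>
      Summable.of_norm_bounded hsum fun n => hb n s hs
    let u : ℕ → ℝ := fun n => Nat.casesOn n 0 fun n => M * (‖(1 : 𝔸)‖ * ((M * T) ^ n / n.factorial))
    let D : ℕ → ℝ → 𝔸 := fun n s =>
      Nat.casesOn n 0 fun n => (-Complex.I) • (K s * dysonTerm K n s)
    have hu : Summable u := (summable_nat_add_iff 1).1 (hsum.mul_left M)
    have hd := hasDerivAt_tsum_of_isPreconnected (g := dysonTerm K) (g' := D) (u := u)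
      (t := Metric.ball 0 T) (y₀ := 0) (y := t) hu Metric.isOpen_ball
      (convex_ball _ _).isPreconnected
      (fun n s _ => by
        cases n with
        | zero => exact hasDerivAt_const s (1 : 𝔸)
        | succ n => exact hasDerivAt_dysonTerm_succ hK n s)
      (fun n s hs => by
        have hs' : |s| ≤ T := by simpa using (Metric.mem_ball.1 hs).le
        cases n with
        | zero => simp [D, u]
        | succ n =>
          change ‖(-Complex.I) • (K s * dysonTerm K n s)‖ ≤ _
          rw [norm_smul, norm_neg, Complex.norm_I, one_mul]
          refine (norm_mul_le _ _).trans ?_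
          exact mul_le_mul (hM s hs') (hb n s hs') (norm_nonneg _) hM0)
      (by simp [hT]; positivity) (hs 0 (by simpa using hT0)) (by simp [hT])
    refine hd.congr_deriv ?_
    have ht : |t| ≤ T := by simp [hT]
    have hDs : Summable fun n => D n t := by
      rw [← summable_nat_add_iff 1]
      exact ((hs t ht).mul_left (K t)).const_smul (-Complex.I)
    rw [hDs.tsum_eq_zero_add]
    change 0 + ∑' n, (-Complex.I) • (K t * dysonTerm K n t) = _
    rw [zero_add, ((hs t ht).mul_left (K t)).tsum_const_smul, (hs t ht).tsum_mul_left]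

namespace IsPropagator

variable {K U : ℝ → 𝔸}

lemma continuous (hU : IsPropagator K U) : Continuous U :=
  continuous_iff_continuousAt.2 fun t => (hU.2 t).continuousAt

lemma hasDerivAt_star (hU : IsPropagator K U) (hK : ∀ t, IsSelfAdjoint (K t)) (t : ℝ) :
    HasDerivAt (fun t => star (U t)) (Complex.I • (star (U t) * K t)) t := by
  have h := (hU.2 t).star
  simpa [star_smul, (hK t).star_eq] using h

/-- The derivative of an observable in the Heisenberg picture. -/
lemma hasDerivAt_heisenberg (hU : IsPropagator K U) (hK : ∀ t, IsSelfAdjoint (K t)) {A : ℝ → 𝔸}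
    {A' : 𝔸} {t : ℝ} (hA : HasDerivAt A A' t) :
    HasDerivAt (fun t => star (U t) * A t * U t)
      (star (U t) * (A' + Complex.I • opComm (K t) (A t)) * U t) t := by
  refine (((hU.hasDerivAt_star hK t).mul hA).mul (hU.2 t)).congr_deriv ?_
  simp only [Pi.mul_apply]
  simp only [opComm, mul_add, add_mul, mul_sub, sub_mul, smul_sub, mul_smul_comm,
    smul_mul_assoc, neg_smul, mul_assoc, mul_neg]
  abel

lemma eq_of_hasDerivAt_zero {f : ℝ → 𝔸} (h : ∀ t, HasDerivAt f 0 t) (t : ℝ) : f t = f 0 :=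
  is_const_of_deriv_eq_zero (fun t => (h t).differentiableAt) (fun t => (h t).deriv) t 0

lemma star_mul_self (hU : IsPropagator K U) (hK : ∀ t, IsSelfAdjoint (K t)) (t : ℝ) :
    star (U t) * U t = 1 := by
  have h : ∀ t, HasDerivAt (fun t => star (U t) * 1 * U t) 0 t := fun t => by
    simpa [opComm] using hU.hasDerivAt_heisenberg hK (hasDerivAt_const t (1 : 𝔸))
  simpa [hU.1] using eq_of_hasDerivAt_zero h t

variable [IsDedekindFiniteMonoid 𝔸]

lemma mul_star_self (hU : IsPropagator K U) (hK : ∀ t, IsSelfAdjoint (K t)) (t : ℝ) :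
    U t * star (U t) = 1 :=
  mul_eq_one_comm.1 (hU.star_mul_self hK t)

lemma mem_unitary (hU : IsPropagator K U) (hK : ∀ t, IsSelfAdjoint (K t)) (t : ℝ) :
    U t ∈ unitary 𝔸 :=
  ⟨hU.star_mul_self hK t, hU.mul_star_self hK t⟩

lemma eq_mul_of_hasDerivAt (hU : IsPropagator K U) (hK : ∀ t, IsSelfAdjoint (K t)) {X : ℝ → 𝔸}
    (hX : ∀ t, HasDerivAt X ((-Complex.I) • (K t * X t)) t) (t : ℝ) : X t = U t * X 0 := by
  have h : ∀ t, HasDerivAt (fun t => star (U t) * X t) 0 t := fun t => by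
    refine ((hU.hasDerivAt_star hK t).mul (hX t)).congr_deriv ?_
    simp [mul_assoc]
  have h1 := eq_of_hasDerivAt_zero h t
  simp only [hU.1, star_one, one_mul] at h1
  rw [← h1, ← mul_assoc, hU.mul_star_self hK, one_mul]

/-- The propagator commutes with whatever commutes with its generator. -/
lemma commute (hU : IsPropagator K U) (hK : ∀ t, IsSelfAdjoint (K t)) {B : 𝔸}
    (hB : ∀ t, K t * B = B * K t) (t : ℝ) : U t * B = B * U t := by
  have h : ∀ t, HasDerivAt (fun t => B * U t) ((-Complex.I) • (K t * (B * U t))) t := fun t => by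
    refine ((hU.2 t).const_mul B).congr_deriv ?_
    rw [mul_smul_comm, ← mul_assoc, ← mul_assoc, hB]
  have h1 := hU.eq_mul_of_hasDerivAt hK h t
  simp only [hU.1, mul_one] at h1
  exact h1.symm

/-- The propagator from time `s` on. -/
lemma shift (hU : IsPropagator K U) (hK : ∀ t, IsSelfAdjoint (K t)) (s : ℝ) :
    IsPropagator (fun x => K (s + x)) (fun x => U (s + x) * star (U s)) := by
  refine ⟨by simp [hU.mul_star_self hK], fun t => ?_⟩
  have h := ((hU.2 (s + t)).scomp t ((hasDerivAt_id t).const_add s)).mul_const (star (U s))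
  simpa [mul_assoc] using h

/-- The propagator run backwards from time `s`, over one unit of rescaled time. -/
lemma reverse (hU : IsPropagator K U) (hK : ∀ t, IsSelfAdjoint (K t)) (s : ℝ) :
    IsPropagator (fun x => (-s) • K (s * (1 - x))) (fun x => U (s * (1 - x)) * star (U s)) := by
  refine ⟨by simp [hU.mul_star_self hK], fun t => ?_⟩
  have h1 : HasDerivAt (fun x : ℝ => s * (1 - x)) (-s) t := by
    simpa using ((hasDerivAt_id t).const_sub 1).const_mul s
  have h := ((hU.2 (s * (1 - t))).scomp t h1).mul_const (star (U s))
  refine h.congr_deriv ?_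
  rw [smul_mul_assoc, smul_mul_assoc, smul_comm, mul_assoc, smul_mul_assoc]

end IsPropagator

lemma norm_star_mul_mul {U : 𝔸} (hU : U ∈ unitary 𝔸) (A : 𝔸) : ‖star U * A * U‖ = ‖A‖ := by
  rw [CStarRing.norm_mul_mem_unitary _ hU, CStarRing.norm_mem_unitary_mul _ (Unitary.star_mem hU)]

lemma norm_opComm_le (A B : 𝔸) : ‖opComm A B‖ ≤ 2 * ‖A‖ * ‖B‖ := by
  rw [opComm]
  refine (norm_sub_le _ _).trans ?_
  linarith [norm_mul_le A B, norm_mul_le B A, mul_comm ‖A‖ ‖B‖]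

lemma star_mul_opComm_mul {U : 𝔸} (hU : U ∈ unitary 𝔸) (A B : 𝔸) :
    star U * opComm A B * U =
    opComm (star U * A * U) (star U * B * U) := by
  have h : ∀ A B : 𝔸, star U * A * U * (star U * B * U) = star U * (A * B) * U := fun A B => by
    rw [show star U * A * U * (star U * B * U) = star U * A * (U * star U) * B * U by noncomm_ring,
      Unitary.mul_star_self_of_mem hU]
    noncomm_ring
  rw [opComm, opComm, h, h]
  noncomm_ring

variable [IsDedekindFiniteMonoid 𝔸]

/-- A commutator with a self-adjoint generator does not change the norm: only the inhomogeneity `g`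
contributes to the growth of a solution of `f' = i[M, f] + g`. -/
lemma norm_le_of_hasDerivAt_opComm_add {M f g : ℝ → 𝔸} (hM : Continuous M)
    (hMs : ∀ t, IsSelfAdjoint (M t)) (hf : ∀ t, HasDerivAt f (Complex.I • opComm (M t) (f t) + g t) t)
    {b b' : ℝ → ℝ} {T : ℝ} (h0 : ‖f 0‖ ≤ b 0) (hb : ∀ t, HasDerivAt b (b' t) t)
    (hg : ∀ t ∈ Set.Ico 0 T, ‖g t‖ ≤ b' t) : ∀ t ∈ Set.Icc 0 T, ‖f t‖ ≤ b t := by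
  obtain ⟨W, hW⟩ := exists_isPropagator (K := fun t => -M t) hM.neg
  have hs : ∀ t, IsSelfAdjoint (-M t) := fun t => (hMs t).neg
  have hd : ∀ t, HasDerivAt (fun t => star (W t) * f t * W t) (star (W t) * g t * W t) t :=
    fun t => by
      have h := hW.hasDerivAt_heisenberg hs (hf t)
      refine h.congr_deriv ?_
      simp only [opComm, neg_mul, mul_neg, smul_sub, smul_neg]
      noncomm_ring
  intro t ht
  rw [← norm_star_mul_mul (hW.mem_unitary hs t)]
  refine image_norm_le_of_norm_deriv_right_le_deriv_boundary
    (f := fun t => star (W t) * f t * W t)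
    (fun t _ => (hd t).continuousAt.continuousWithinAt) (fun t _ => (hd t).hasDerivWithinAt)
    ?_ hb (fun t ht => ?_) ht
  · rwa [norm_star_mul_mul (hW.mem_unitary hs 0)]
  · rw [norm_star_mul_mul (hW.mem_unitary hs t)]
    exact hg t ht

/-- Duhamel's formula, as a bound for the difference of two Heisenberg evolutions. -/
lemma norm_heisenberg_sub_le {K K' U U' : ℝ → 𝔸} (hU : IsPropagator K U)
    (hK : ∀ t, IsSelfAdjoint (K t)) (hU' : IsPropagator K' U') (hK' : ∀ t, IsSelfAdjoint (K' t))
    (A : 𝔸) {c : ℝ} (h : ∀ s ∈ Set.Ico (0 : ℝ) 1, ‖opComm (K s - K' s)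
      (star (U' 1 * star (U' s)) * A * (U' 1 * star (U' s)))‖ ≤ c) :
    ‖star (U 1) * A * U 1 - star (U' 1) * A * U' 1‖ ≤ c := by
  -- interpolate between the two evolutions: run `U'` backwards from time `1`, then `U` forwards
  let D : ℝ → 𝔸 := fun s => U' s * (star (U' 1) * A * U' 1) * star (U' s)
  have hD : ∀ s, HasDerivAt D ((-Complex.I) • opComm (K' s) (D s)) s := fun s => by
    refine (((hU'.2 s).mul_const _).mul (hU'.hasDerivAt_star hK' s)).congr_deriv ?_
    simp only [D, opComm, smul_mul_assoc, mul_smul_comm, smul_sub, neg_smul, mul_assoc, neg_mul]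
    abel
  have hf : ∀ s, HasDerivAt (fun s => star (U s) * D s * U s)
      (star (U s) * (Complex.I • opComm (K s - K' s) (D s)) * U s) s := fun s => by
    refine (hU.hasDerivAt_heisenberg hK (hD s)).congr_deriv ?_
    simp only [opComm, neg_smul, sub_mul, mul_sub, smul_sub]
    noncomm_ring
  have hfin := norm_image_sub_le_of_norm_deriv_le_segment_01'
    (f := fun s => star (U s) * D s * U s) (C := c)
    (fun s _ => (hf s).hasDerivWithinAt) (fun s hs => by
      rw [norm_star_mul_mul (hU.mem_unitary hK s), norm_smul, Complex.norm_I, one_mul]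
      refine le_trans (le_of_eq ?_) (h s hs)
      simp [D, mul_assoc])
  have h1 : D 1 = A := by
    simp only [D]
    rw [← mul_assoc, ← mul_assoc, hU'.mul_star_self hK', one_mul, mul_assoc,
      hU'.mul_star_self hK', mul_one]
  simpa [h1, D, hU.1, hU'.1] using hfin

end Propagator

/-- One-sided inverses are two-sided, by finite dimension: an isometric propagator is unitary. -/
instance {V : Type*} [Fintype V] [DecidableEq V] (q : V → ℕ) :
    IsDedekindFiniteMonoid (Operator q) where
  mul_eq_one_symm {A B} h := by
    let e := Matrix.toEuclideanCLM (𝕜 := ℂ) (n := (x : V) → Fin (q x))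
    have h1 : e.symm A * e.symm B = 1 := by rw [← map_mul, h, map_one]
    have h2 := mul_eq_one_comm.1 h1
    rw [← map_mul, ← map_one e.symm] at h2
    exact e.symm.injective h2

/-! ### Lieb–Robinson bounds -/

section LiebRobinson

variable {V : Type*} [Fintype V] [DecidableEq V] {q : V → ℕ}

lemma opComm_sum_left {𝔸 α : Type*} [CStarAlgebra 𝔸] (s : Finset α) (f : α → 𝔸) (B : 𝔸) :
    opComm (∑ i ∈ s, f i) B = ∑ i ∈ s, opComm (f i) B := by
  simp [opComm, Finset.sum_mul, Finset.mul_sum]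

lemma SupportedOn.opComm_eq_zero {Z W : Finset V} {A B : Operator q} (hA : SupportedOn Z A)
    (hB : SupportedOn W B) (h : Disjoint Z W) : opComm A B = 0 :=
  sub_eq_zero.2 (hA.commute hB h)

lemma SupportedOn.opComm {Z : Finset V} {A B : Operator q} (hA : SupportedOn Z A)
    (hB : SupportedOn Z B) : SupportedOn Z (opComm A B) :=
  (hA.mul hB).sub (hB.mul hA)

lemma sum_not_disjoint_le {f : Finset V → ℝ} (hf : ∀ Z, 0 ≤ f Z) (X : Finset V) :
    ∑ Z with ¬Disjoint Z X, f Z ≤ ∑ u ∈ X, ∑ Z with u ∈ Z, f Z := by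
  have h : ∀ Z : Finset V, (if ¬Disjoint Z X then f Z else 0) ≤
      ∑ u ∈ X, if u ∈ Z then f Z else 0 := by
    intro Z
    have h0 : ∀ u ∈ X, 0 ≤ if u ∈ Z then f Z else 0 := fun u _ => by
      by_cases hu : u ∈ Z <;> simp [hu, hf]
    by_cases h : Disjoint Z X
    · rw [if_neg (not_not.2 h)]
      exact Finset.sum_nonneg h0
    · rw [if_pos h]
      obtain ⟨u, hu, hX⟩ := Finset.not_disjoint_iff.1 h
      exact le_trans (by simp [hu]) (Finset.single_le_sum h0 hX)
  calc _ = ∑ Z, if ¬Disjoint Z X then f Z else 0 := Finset.sum_filter _ _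
    _ ≤ ∑ Z, ∑ u ∈ X, if u ∈ Z then f Z else 0 := Finset.sum_le_sum fun Z _ => h Z
    _ = _ := by
      rw [Finset.sum_comm]
      exact Finset.sum_congr rfl fun u _ => (Finset.sum_filter _ _).symm

variable [MetricSpace V]

lemma weightAt_nonneg (k : ℕ) (Ψ : Finset V → Operator q) (u : V) : 0 ≤ weightAt k Ψ u :=
  Finset.sum_nonneg fun Z _ => by
    have := Metric.diam_nonneg (s := (Z : Set V)); positivity

lemma sum_weight_le {Ψ : Finset V → Operator q} {k : ℕ} {C : ℝ} (hC : ∀ u, weightAt k Ψ u ≤ C)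
    (X : Finset V) :
    ∑ Z with ¬Disjoint Z X, ‖Ψ Z‖ * Z.card * (1 + Metric.diam (Z : Set V)) ^ k ≤ X.card * C := by
  refine (sum_not_disjoint_le (fun Z => ?_) X).trans ?_
  · have := Metric.diam_nonneg (s := (Z : Set V)); positivity
  · rw [← nsmul_eq_mul, ← Finset.sum_const]
    exact Finset.sum_le_sum fun u _ => hC u

lemma sum_norm_mul_diam_le {Ψ : Finset V → Operator q} {k : ℕ} {C : ℝ}
    (hC : ∀ u, weightAt k Ψ u ≤ C) (X : Finset V) :
    ∑ Z with ¬Disjoint Z X, ‖Ψ Z‖ * (1 + Metric.diam (Z : Set V)) ^ k ≤ X.card * C := by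
  refine le_trans (Finset.sum_le_sum fun Z hZ => ?_) (sum_weight_le hC X)
  obtain ⟨x, hx, -⟩ := Finset.not_disjoint_iff.1 (Finset.mem_filter.1 hZ).2
  have h1 : (1 : ℝ) ≤ Z.card := by exact_mod_cast Finset.card_pos.2 ⟨x, hx⟩
  have := Metric.diam_nonneg (s := (Z : Set V))
  have h2 : ‖Ψ Z‖ ≤ ‖Ψ Z‖ * Z.card := le_mul_of_one_le_right (norm_nonneg _) h1
  gcongr

lemma sum_norm_le {Ψ : Finset V → Operator q} {C : ℝ}
    (hC : ∀ u, weightAt 0 Ψ u ≤ C) (X : Finset V) :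
    ∑ Z with ¬Disjoint Z X, ‖Ψ Z‖ ≤ X.card * C := by
  simpa using sum_norm_mul_diam_le hC X

/-- Only the terms that meet the support of `A` contribute to a commutator with `A`. -/
lemma opComm_sum_eq {Ψ : Finset V → Operator q} (hΨ : ∀ Z, SupportedOn Z (Ψ Z)) {X : Finset V}
    {A : Operator q} (hA : SupportedOn X A) :
    opComm (∑ Z, Ψ Z) A = opComm (∑ Z with ¬Disjoint Z X, Ψ Z) A := by
  rw [opComm_sum_left, opComm_sum_left, Finset.sum_filter]
  refine Finset.sum_congr rfl fun Z _ => ?_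
  split_ifs with h
  · exact (hΨ Z).opComm_eq_zero hA h
  · rfl

/-- Lieb–Robinson bound for a generator of range `R`: a commutator with an operator at distance
more than `N R` needs a chain of at least `N` terms, which costs `(2 J t)^N / N!`. -/
theorem norm_opComm_heisenberg_le {G : ℝ → Finset V → Operator q} {U : ℝ → Operator q}
    (hU : IsPropagator (fun t => ∑ Z, G t Z) U) (hc : ∀ Z, Continuous fun t => G t Z)
    (hsa : ∀ t Z, IsSelfAdjoint (G t Z)) (hsupp : ∀ t Z, SupportedOn Z (G t Z)) {R J : ℝ}
    (hR0 : 0 ≤ R) (hR : ∀ t (Z : Finset V), R < Metric.diam (Z : Set V) → G t Z = 0)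
    (hJ : ∀ t u, weightAt 0 (G t) u ≤ J) (N : ℕ) :
    ∀ (X W : Finset V) (A B : Operator q), SupportedOn X A → SupportedOn W B →
      (∀ x ∈ X, ∀ z ∈ W, N * R < dist x z) → ∀ t ∈ Set.Icc (0 : ℝ) 1,
      ‖opComm (star (U t) * A * U t) B‖ ≤
        2 * ‖A‖ * ‖B‖ * X.card * ((2 * J * t) ^ N / N.factorial) := by
  have hsas : ∀ t, IsSelfAdjoint (∑ Z, G t Z) := fun t => isSelfAdjoint_sum _ fun Z _ => hsa t Z
  have hun := fun t => hU.mem_unitary hsas t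
  induction N with
  | zero =>
    intro X W A B hA hB _ t ht
    rcases X.eq_empty_or_nonempty with rfl | hX
    · obtain ⟨c, rfl⟩ := hA.eq_smul_one
      have : opComm (star (U t) * (c • 1) * U t) B = 0 := by
        simp [opComm, hU.star_mul_self hsas t]
      rw [this]; simp
    · have h1 : (1 : ℝ) ≤ X.card := by exact_mod_cast Finset.card_pos.2 hX
      refine (norm_opComm_le _ _).trans ?_
      rw [norm_star_mul_mul (hun t)]
      simpa using le_mul_of_one_le_right (by positivity) h1
  | succ N ih =>
    intro X W A B hA hB hd
    have hNR : (0 : ℝ) ≤ ((N + 1 : ℕ) : ℝ) * R := by positivity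
    have hXW : Disjoint X W := Finset.disjoint_left.2 fun x hx hw => by
      have := hd x hx x hw
      rw [dist_self] at this
      linarith
    let GX : ℝ → Operator q := fun t => ∑ Z with ¬Disjoint Z X, G t Z
    let M : ℝ → Operator q := fun t => star (U t) * GX t * U t
    let a : ℝ → Operator q := fun t => star (U t) * A * U t
    have hUc := hU.continuous
    have hMc : Continuous M := (hUc.star.mul (continuous_finsetSum _ fun Z _ => hc Z)).mul hUc
    have hMs : ∀ t, IsSelfAdjoint (M t) := fun t =>
      (isSelfAdjoint_sum _ fun Z _ => hsa t Z : IsSelfAdjoint (GX t)).conjugate' (U t)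
    have hf : ∀ t, HasDerivAt (fun t => opComm (a t) B) (Complex.I • opComm (M t) (opComm (a t) B) +
        (-Complex.I) • opComm (a t) (opComm (M t) B)) t := by
      intro t
      have h1 : HasDerivAt a (Complex.I • opComm (M t) (a t)) t := by
        refine (hU.hasDerivAt_heisenberg hsas (hasDerivAt_const t A)).congr_deriv ?_
        rw [opComm_sum_eq (hsupp t) hA, zero_add, mul_smul_comm, smul_mul_assoc,
          star_mul_opComm_mul (hun t)]
      refine ((h1.mul_const B).sub (h1.const_mul B)).congr_deriv ?_
      simp only [smul_mul_assoc, mul_smul_comm, neg_smul, ← smul_sub, ← smul_neg, ← smul_add]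
      congr 1
      simp only [opComm]
      noncomm_ring
    intro t ht
    refine norm_le_of_hasDerivAt_opComm_add hMc hMs hf
      (b := fun t => 2 * ‖A‖ * ‖B‖ * X.card * ((2 * J * t) ^ (N + 1) / (N + 1).factorial))
      (b' := fun t => 2 * ‖A‖ * (X.card * J * (2 * ‖B‖ * ((2 * J * t) ^ N / N.factorial))))
      (T := 1) ?_ ?_ ?_ t ht
    · have h0 : opComm (a 0) B = 0 := by
        simpa [a, hU.1] using hA.opComm_eq_zero hB hXW
      simp [h0]
    · intro t
      refine ((((hasDerivAt_id t).const_mul (2 * J)).pow (N + 1)).div_const _ |>.const_mul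
        _).congr_deriv ?_
      rw [Nat.factorial_succ]
      push_cast
      simp only [id]
      field_simp
    · intro t ht
      have ht' : t ∈ Set.Icc (0 : ℝ) 1 := ⟨ht.1, ht.2.le⟩
      have hM : ‖opComm (M t) B‖ ≤ X.card * J * (2 * ‖B‖ * ((2 * J * t) ^ N / N.factorial)) := by
        have h1 : M t = ∑ Z with ¬Disjoint Z X, star (U t) * G t Z * U t := by
          simp only [M, GX, Finset.mul_sum, Finset.sum_mul]
        rw [h1, opComm_sum_left]
        rcases X.eq_empty_or_nonempty with rfl | ⟨x0, -⟩
        · simp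
        have hJ0 : 0 ≤ J := (weightAt_nonneg 0 (G t) x0).trans (hJ t x0)
        have hp : 0 ≤ (2 * J * t) ^ N / N.factorial := by have := ht.1; positivity
        calc _ ≤ ∑ Z with ¬Disjoint Z X, ‖opComm (star (U t) * G t Z * U t) B‖ :=
              norm_sum_le _ _
          _ ≤ ∑ Z with ¬Disjoint Z X, (‖G t Z‖ * Z.card * (1 + Metric.diam (Z : Set V)) ^ 0) *
                (2 * ‖B‖ * ((2 * J * t) ^ N / N.factorial)) := by
              refine Finset.sum_le_sum fun Z hZ => ?_
              by_cases hdz : R < Metric.diam (Z : Set V)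
              · simp [hR t Z hdz, opComm]
              · refine (ih Z W (G t Z) B (hsupp t Z) hB ?_ t ht').trans (le_of_eq (by ring))
                intro z hz w hw
                obtain ⟨x, hx, hxX⟩ := Finset.not_disjoint_iff.1 (Finset.mem_filter.1 hZ).2
                have h2 : dist x z ≤ Metric.diam (Z : Set V) :=
                  Metric.dist_le_diam_of_mem Z.finite_toSet.isBounded hx hz
                have h3 := hd x hxX w hw
                have h4 := dist_triangle x z w
                push_cast at h3
                push Not at hdz
                linarith
          _ ≤ _ := by
              rw [← Finset.sum_mul]
              exact mul_le_mul_of_nonneg_right (sum_weight_le (hJ t) X) (by positivity)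
      rw [norm_smul, norm_neg, Complex.norm_I, one_mul]
      refine (norm_opComm_le _ _).trans ?_
      rw [norm_star_mul_mul (hun t)]
      gcongr

/-- The ball of radius `r` as a finite set. -/
noncomputable def ball (u : V) (r : ℝ) : Finset V := Finset.univ.filter fun x => dist x u ≤ r

lemma mem_ball {u x : V} {r : ℝ} : x ∈ ball u r ↔ dist x u ≤ r := by simp [ball]

lemma ball_mono (u : V) {r s : ℝ} (h : r ≤ s) : ball u r ⊆ ball u s := fun _ hx =>
  mem_ball.2 ((mem_ball.1 hx).trans h)

set_option maxHeartbeats 1000000 in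
/-- Quasi-locality of the Heisenberg evolution: the evolution of an operator on `ball u ρ` is
approximated by the one generated by the terms of range at most `R` inside `ball u r`. -/
theorem exists_supportedOn_norm_heisenberg_sub_le {G : ℝ → Finset V → Operator q}
    {U : ℝ → Operator q} (hU : IsPropagator (fun t => ∑ Z, G t Z) U)
    (hc : ∀ Z, Continuous fun t => G t Z) (hsa : ∀ t Z, IsSelfAdjoint (G t Z))
    (hsupp : ∀ t Z, SupportedOn Z (G t Z)) {J C : ℝ} {k : ℕ}
    (hJ : ∀ t u, weightAt 0 (G t) u ≤ J) (hC : ∀ t u, weightAt k (G t) u ≤ C)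
    {u : V} {ρ r R : ℝ} {N : ℕ} (hR0 : 0 ≤ R) (hr : ρ + R + N * R ≤ r)
    {A : Operator q} (hA : SupportedOn (ball u ρ) A) :
    ∃ A', SupportedOn (ball u r) A' ∧ ‖star (U 1) * A * U 1 - A'‖ ≤
      2 * ‖A‖ * ((ball u r).card * (C / (1 + R) ^ k +
        J * min 1 ((ball u ρ).card * ((2 * J) ^ N / N.factorial)))) := by
  classical
  set Y := ball u r with hY
  set X := ball u ρ with hX
  let G' : ℝ → Finset V → Operator q := fun t Z =>
    if Z ⊆ Y ∧ Metric.diam (Z : Set V) ≤ R then G t Z else 0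
  have hJ0 : 0 ≤ J := (weightAt_nonneg 0 (G 0) u).trans (hJ 0 u)
  have hNR : 0 ≤ N * R := by positivity
  have hXY : X ⊆ Y := ball_mono u (by linarith)
  have hc' : ∀ Z, Continuous fun t => G' t Z := fun Z => by
    by_cases h : Z ⊆ Y ∧ Metric.diam (Z : Set V) ≤ R <;> simp [G', h, hc, continuous_const]
  have hsa' : ∀ t Z, IsSelfAdjoint (G' t Z) := fun t Z => by
    by_cases h : Z ⊆ Y ∧ Metric.diam (Z : Set V) ≤ R <;> simp [G', h, hsa]
  have hsupp' : ∀ t Z, SupportedOn Z (G' t Z) := fun t Z => by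
    by_cases h : Z ⊆ Y ∧ Metric.diam (Z : Set V) ≤ R <;> simp [G', h, hsupp, supportedOn_zero]
  have hR' : ∀ t (Z : Finset V), R < Metric.diam (Z : Set V) → G' t Z = 0 := fun t Z h =>
    if_neg fun h' => absurd h'.2 (not_le.2 h)
  have hnorm' : ∀ t Z, ‖G' t Z‖ ≤ ‖G t Z‖ := fun t Z => by
    by_cases h : Z ⊆ Y ∧ Metric.diam (Z : Set V) ≤ R <;> simp [G', h]
  have hJ' : ∀ t u, weightAt 0 (G' t) u ≤ J := fun t u => by
    refine le_trans (Finset.sum_le_sum fun Z _ => ?_) (hJ t u)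
    have := hnorm' t Z
    gcongr
  have hsas : ∀ t, IsSelfAdjoint (∑ Z, G t Z) := fun t => isSelfAdjoint_sum _ fun Z _ => hsa t Z
  have hsas' : ∀ t, IsSelfAdjoint (∑ Z, G' t Z) := fun t =>
    isSelfAdjoint_sum _ fun Z _ => hsa' t Z
  obtain ⟨U', hU'⟩ := exists_isPropagator (K := fun t => ∑ Z, G' t Z)
    (continuous_finsetSum _ fun Z _ => hc' Z)
  have hun := fun t => hU.mem_unitary hsas t
  have hun' := fun t => hU'.mem_unitary hsas' t
  have hGY : ∀ t, SupportedOn Y (∑ Z, G' t Z) := fun t => SupportedOn.sum fun Z _ => by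
    by_cases h : Z ⊆ Y ∧ Metric.diam (Z : Set V) ≤ R
    · exact (hsupp' t Z).mono h.1
    · simp [G', h, supportedOn_zero]
  have hUY : ∀ t, SupportedOn Y (U' t) := fun t => by
    rw [supportedOn_iff_commute]
    exact fun B hB => hU'.commute hsas' (fun t => (hGY t).commute hB disjoint_compl_right) t
  set A' := star (U' 1) * A * U' 1 with hA'
  have hA'Y : SupportedOn Y A' := ((hUY 1).star.mul (hA.mono hXY)).mul (hUY 1)
  refine ⟨A', hA'Y, ?_⟩
  -- Only the terms missing from `G'` contribute. Those of range more than `R` are small; those of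
  -- range at most `R` reach out of `Y`, hence are far from `X`, and the Lieb–Robinson bound applies.
  refine norm_heisenberg_sub_le hU hsas hU' hsas' A fun s hs => ?_
  set D := star (U' 1 * star (U' s)) * A * (U' 1 * star (U' s)) with hD
  have hDn : ‖D‖ = ‖A‖ := norm_star_mul_mul (mul_mem (hun' 1) (Unitary.star_mem (hun' s))) A
  have hDY : SupportedOn Y D :=
    (((hUY 1).mul (hUY s).star).star.mul (hA.mono hXY)).mul ((hUY 1).mul (hUY s).star)
  rw [← Finset.sum_sub_distrib, opComm_sum_left]
  set ε := min 1 (X.card * ((2 * J) ^ N / N.factorial) : ℝ) with hε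
  have hε0 : 0 ≤ ε := le_min zero_le_one (by positivity)
  have hLR : ∀ Z : Finset V, (∀ x ∈ X, ∀ z ∈ Z, N * R < dist x z) →
      ‖opComm (G s Z) D‖ ≤ 2 * ‖A‖ * (‖G s Z‖ * ε) := by
    intro Z hZ
    have h1 := norm_opComm_heisenberg_le (hU'.shift hsas' s)
      (fun Z => (hc' Z).comp (continuous_const_add s))
      (fun t Z => hsa' _ Z) (fun t Z => hsupp' _ Z) hR0 (fun t Z => hR' _ Z)
      (fun t u => hJ' _ u) N X Z A (G s Z) hA (hsupp s Z) hZ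
      (1 - s) ⟨by linarith [hs.2], by linarith [hs.1]⟩
    rw [add_sub_cancel, ← hD] at h1
    have hflip : ‖opComm (G s Z) D‖ = ‖opComm D (G s Z)‖ := by
      rw [← norm_neg]; simp [opComm]
    have hpow : (2 * J * (1 - s)) ^ N ≤ (2 * J) ^ N :=
      pow_le_pow_left₀ (mul_nonneg (by positivity) (by linarith [hs.2]))
        (mul_le_of_le_one_right (by positivity) (by linarith [hs.1])) N
    rw [hε, mul_min_of_nonneg _ _ (norm_nonneg _), mul_min_of_nonneg _ _ (by positivity)]
    refine le_min ?_ ?_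
    · refine (norm_opComm_le _ _).trans (le_of_eq ?_)
      rw [hDn]; ring
    · rw [hflip]
      refine h1.trans ?_
      calc _ ≤ 2 * ‖A‖ * ‖G s Z‖ * X.card * ((2 * J) ^ N / N.factorial) := by gcongr
        _ = _ := by ring
  have hterm : ∀ Z, ‖opComm (G s Z - G' s Z) D‖ ≤ if ¬Disjoint Z Y then
      2 * ‖A‖ * (‖G s Z‖ * (1 + Metric.diam (Z : Set V)) ^ k / (1 + R) ^ k + ‖G s Z‖ * ε)
      else 0 := by
    intro Z
    have hdiam := Metric.diam_nonneg (s := (Z : Set V))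
    by_cases hdis : Disjoint Z Y
    · rw [((hsupp s Z).sub (hsupp' s Z)).opComm_eq_zero (hDY) hdis]
      simp [hdis]
    rw [if_pos hdis]
    by_cases h : Z ⊆ Y ∧ Metric.diam (Z : Set V) ≤ R
    · have : opComm (G s Z - G' s Z) D = 0 := by simp [G', h, opComm]
      rw [this, norm_zero]
      positivity
    have hG : G s Z - G' s Z = G s Z := by simp [G', h]
    have htriv : ‖opComm (G s Z) D‖ ≤ 2 * ‖A‖ * ‖G s Z‖ := by
      refine (norm_opComm_le _ _).trans (le_of_eq ?_)
      rw [hDn]; ring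
    rw [hG]
    by_cases hdR : Metric.diam (Z : Set V) ≤ R
    · have hZY : ¬ Z ⊆ Y := fun h' => h ⟨h', hdR⟩
      obtain ⟨z, hz, hzY⟩ := Finset.not_subset.1 hZY
      have h5 := hLR Z fun x hx w hw => by
        have h1 : dist z w ≤ Metric.diam (Z : Set V) :=
          Metric.dist_le_diam_of_mem Z.finite_toSet.isBounded hz hw
        have h2 : r < dist z u := not_le.1 fun h' => hzY (mem_ball.2 h')
        have h3 := mem_ball.1 hx
        have h4 := dist_triangle4 z w x u
        rw [dist_comm w x] at h4
        linarith
      refine h5.trans ?_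
      gcongr
      have : 0 ≤ ‖G s Z‖ * (1 + Metric.diam (Z : Set V)) ^ k / (1 + R) ^ k := by positivity
      linarith
    · push Not at hdR
      have h5 : ‖G s Z‖ ≤ ‖G s Z‖ * (1 + Metric.diam (Z : Set V)) ^ k / (1 + R) ^ k := by
        rw [mul_div_assoc]
        refine le_mul_of_one_le_right (norm_nonneg _) ((one_le_div (by positivity)).2 ?_)
        gcongr
      refine htriv.trans ?_
      have : 0 ≤ ‖G s Z‖ * ε := by positivity
      gcongr
      linarith
  calc _ ≤ ∑ Z, ‖opComm (G s Z - G' s Z) D‖ := norm_sum_le _ _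
    _ ≤ ∑ Z, if ¬Disjoint Z Y then 2 * ‖A‖ * (‖G s Z‖ * (1 + Metric.diam (Z : Set V)) ^ k /
          (1 + R) ^ k + ‖G s Z‖ * ε) else 0 := Finset.sum_le_sum fun Z _ => hterm Z
    _ = 2 * ‖A‖ * ((∑ Z with ¬Disjoint Z Y, ‖G s Z‖ * (1 + Metric.diam (Z : Set V)) ^ k) /
          (1 + R) ^ k + (∑ Z with ¬Disjoint Z Y, ‖G s Z‖) * ε) := by
        rw [← Finset.sum_filter, ← Finset.mul_sum, Finset.sum_add_distrib, Finset.sum_div,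
          Finset.sum_mul]
    _ ≤ 2 * ‖A‖ * (Y.card * C / (1 + R) ^ k + Y.card * J * ε) := by
        have := sum_norm_mul_diam_le (hC s) Y
        have := sum_norm_le (hJ s) Y
        gcongr
    _ = _ := by ring

end LiebRobinson

/-! ### Elementary estimates -/

section Elementary

lemma exists_one_add_pow_le (k : ℕ) : ∃ c : ℝ, 0 ≤ c ∧ ∀ N : ℕ, (1 + N : ℝ) ^ k ≤ c * 2 ^ N := by
  have h := tendsto_pow_const_mul_const_pow_of_abs_lt_one k (r := (1 / 2 : ℝ)) (by norm_num)
  obtain ⟨c, hc⟩ := h.bddAbove_range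
  refine ⟨|c| * 2, by positivity, fun N => ?_⟩
  have h1 : ((N + 1 : ℕ) : ℝ) ^ k * (1 / 2) ^ (N + 1) ≤ |c| :=
    (hc ⟨N + 1, rfl⟩).trans (le_abs_self c)
  rw [one_div, inv_pow, ← div_eq_mul_inv, div_le_iff₀ (by positivity)] at h1
  push_cast at h1
  rw [add_comm, mul_assoc, ← pow_succ']
  exact h1

/-- Below the light cone `N ≫ x` the Lieb–Robinson factor is negligible; above it, it is replaced
by `1`. Both are dominated by any negative power of `N / x`. -/
lemma exists_min_one_le (k : ℕ) : ∃ c : ℝ, 0 ≤ c ∧ ∀ (x : ℝ) (N : ℕ), 0 ≤ x →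
    min 1 (x ^ N / N.factorial) * (1 + N) ^ k ≤ c * (1 + x) ^ k := by
  obtain ⟨c, hc0, hc⟩ := exists_one_add_pow_le k
  refine ⟨c + 6 ^ k, by positivity, fun x N hx => ?_⟩
  have hx1 : 1 ≤ (1 + x) ^ k := one_le_pow₀ (by linarith)
  by_cases h : (1 + N : ℝ) ≤ 6 * (1 + x)
  · calc min 1 (x ^ N / N.factorial) * (1 + N) ^ k ≤ 1 * (6 * (1 + x)) ^ k := by
          gcongr
          exact min_le_left _ _
      _ = 6 ^ k * (1 + x) ^ k := by rw [one_mul, mul_pow]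
      _ ≤ _ := by gcongr; linarith
  · push Not at h
    have hN : 0 < (N : ℝ) := by linarith
    have h1 : (N : ℝ) ^ N / N.factorial ≤ 3 ^ N := by
      refine (Real.pow_div_factorial_le_exp N hN.le N).trans ?_
      rw [← mul_one (N : ℝ), Real.exp_nat_mul]
      gcongr
      linarith [Real.exp_one_lt_d9]
    have h2 : x ^ N / N.factorial ≤ (1 / 2) ^ N := by
      calc x ^ N / N.factorial ≤ (N / 6) ^ N / N.factorial := by
            gcongr
            linarith
        _ = (1 / 6) ^ N * (N ^ N / N.factorial) := by rw [div_pow, div_pow, one_pow]; ring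
        _ ≤ (1 / 6) ^ N * 3 ^ N := by gcongr
        _ = (1 / 2) ^ N := by rw [← mul_pow]; norm_num
    calc min 1 (x ^ N / N.factorial) * (1 + N) ^ k ≤ (1 / 2) ^ N * (c * 2 ^ N) := by
          gcongr
          · exact (min_le_right _ _).trans h2
          · exact hc N
      _ = c := by rw [mul_left_comm, ← mul_pow]; norm_num
      _ ≤ (c + 6 ^ k) * (1 + x) ^ k := by
          nlinarith [pow_pos (by norm_num : (0 : ℝ) < 6) k]

lemma exists_sum_inv_sq_le : ∃ S : ℝ, 0 ≤ S ∧ ∀ n : ℕ,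
    ∑ r ∈ Finset.range n, (1 : ℝ) / (1 + r) ^ 2 ≤ S := by
  have h : Summable fun r : ℕ => (1 : ℝ) / (1 + r) ^ 2 := by
    have := (summable_nat_add_iff 1).2 (Real.summable_one_div_nat_pow.2 (by norm_num : 1 < 2))
    refine this.congr fun r => ?_
    push_cast
    rw [add_comm]
  exact ⟨_, tsum_nonneg fun r => by positivity, fun n => h.sum_le_tsum _ fun r _ => by positivity⟩

/-- `F` is bounded by a power of the weight `wt`. -/
def Tempered {J : Type*} (wt F : J → ℝ) : Prop :=
  ∃ (C : ℝ) (p : ℕ), 0 ≤ C ∧ ∀ j, F j ≤ C * wt j ^ p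

namespace Tempered

variable {J : Type*} {wt F G : J → ℝ}

lemma mono (hG : Tempered wt G) (h : ∀ j, F j ≤ G j) : Tempered wt F := by
  obtain ⟨C, p, hC, hb⟩ := hG
  exact ⟨C, p, hC, fun j => (h j).trans (hb j)⟩

lemma const (c : ℝ) : Tempered wt fun _ => c :=
  ⟨|c|, 0, abs_nonneg c, fun _ => by simpa using le_abs_self c⟩

lemma self : Tempered wt wt := ⟨1, 1, zero_le_one, fun j => by simp⟩

lemma add (hwt : ∀ j, 1 ≤ wt j) (hF : Tempered wt F) (hG : Tempered wt G) :
    Tempered wt fun j => F j + G j := by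
  obtain ⟨C, p, hC, hb⟩ := hF
  obtain ⟨C', p', hC', hb'⟩ := hG
  refine ⟨C + C', p + p', by positivity, fun j => ?_⟩
  have h1 : wt j ^ p ≤ wt j ^ (p + p') := pow_le_pow_right₀ (hwt j) (by omega)
  have h2 : wt j ^ p' ≤ wt j ^ (p + p') := pow_le_pow_right₀ (hwt j) (by omega)
  rw [add_mul]
  exact add_le_add ((hb j).trans (by gcongr)) ((hb' j).trans (by gcongr))

lemma mul (hwt : ∀ j, 1 ≤ wt j) (hF : Tempered wt F) (hG : Tempered wt G) (hG0 : ∀ j, 0 ≤ G j) :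
    Tempered wt fun j => F j * G j := by
  obtain ⟨C, p, hC, hb⟩ := hF
  obtain ⟨C', p', hC', hb'⟩ := hG
  refine ⟨C * C', p + p', by positivity, fun j => ?_⟩
  have := hwt j
  calc F j * G j ≤ (C * wt j ^ p) * (C' * wt j ^ p') :=
        mul_le_mul (hb j) (hb' j) (hG0 j) (by positivity)
    _ = _ := by ring

lemma pow (hwt : ∀ j, 1 ≤ wt j) (hF : Tempered wt F) (hF0 : ∀ j, 0 ≤ F j) (n : ℕ) :
    Tempered wt fun j => F j ^ n := by
  induction n with
  | zero => simpa using const 1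
  | succ n ih => simpa only [pow_succ] using ih.mul hwt hF hF0

lemma comp (hF : Tempered wt F) {J' : Type*} (g : J' → J) :
    Tempered (fun j => wt (g j)) fun j => F (g j) := by
  obtain ⟨C, p, hC, hb⟩ := hF
  exact ⟨C, p, hC, fun j => hb (g j)⟩

lemma trans (hwt0 : ∀ j, 0 ≤ wt j) (hF : Tempered wt F) {wt' : J → ℝ} (h : Tempered wt' wt) :
    Tempered wt' F := by
  obtain ⟨C, p, hC, hb⟩ := hF
  obtain ⟨C', p', hC', hb'⟩ := h
  refine ⟨C * C' ^ p, p' * p, by positivity, fun j => (hb j).trans ?_⟩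
  rw [mul_assoc, pow_mul, ← mul_pow]
  gcongr
  · exact hwt0 j
  · exact hb' j

end Tempered

end Elementary

/-! ### Almost local operators in a family of systems

Estimates have to be uniform in the system, in a base point, and in parameters such as the
position on a path or an evolution time. All of these are collected in an index `j : J`, with
`f j` the system that it refers to and `u j` the base point; the constants may grow like a power
of a weight `wt j`. -/

section AlmostLocal

variable {ι : Type*} {Λ : ι → Type*} [∀ n, Fintype (Λ n)] [∀ n, DecidableEq (Λ n)]
  [∀ n, MetricSpace (Λ n)] {q : ∀ n, Λ n → ℕ}

/-- The growth condition in terms of `ball`, for integer radii and with a constant that is at least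
`1`. -/
lemma UniformPolynomialGrowth.exists_card_ball_le (hΛ : UniformPolynomialGrowth Λ) :
    ∃ (C : ℝ) (D : ℕ), 1 ≤ C ∧ ∀ (n : ι) (x : Λ n) (r : ℕ),
      ((ball x (r : ℝ)).card : ℝ) ≤ C * (1 + r) ^ D := by
  obtain ⟨C, D, h⟩ := hΛ
  refine ⟨max C 1, D, le_max_right _ _, fun n x r => ?_⟩
  have h1 : (Metric.closedBall x (r : ℝ)).ncard = (ball x (r : ℝ)).card := by
    rw [← Set.ncard_coe_finset]
    congr 1
    ext y; simp [mem_ball]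
  rw [← h1]
  refine (h n x r (by positivity)).trans ?_
  gcongr
  exact le_max_left _ _

/-- A family of formal sums `∑_Z G_Z` of operators on regions `Z`, with terms that decay faster
than any power of the diameter of `Z`. -/
def IsLocalSum {J : Type*} (f : J → ι) (wt : J → ℝ)
    (G : ∀ j, Finset (Λ (f j)) → Operator (q (f j))) : Prop :=
  (∀ j Z, SupportedOn Z (G j Z)) ∧
  ∀ k, Tempered (fun p : Σ j, Λ (f j) => wt p.1) fun p => weightAt k (G p.1) p.2

lemma IsLocalSum.comp {J J' : Type*} {f : J → ι} {wt : J → ℝ}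
    {G : ∀ j, Finset (Λ (f j)) → Operator (q (f j))} (hG : IsLocalSum f wt G) (g : J' → J) :
    IsLocalSum (fun j => f (g j)) (fun j => wt (g j)) fun j => G (g j) :=
  ⟨fun j => hG.1 (g j), fun k => (hG.2 k).comp fun p : Σ j, Λ (f (g j)) => ⟨g p.1, p.2⟩⟩

lemma IsLocalSum.trans {J : Type*} {f : J → ι} {wt wt' : J → ℝ}
    {G : ∀ j, Finset (Λ (f j)) → Operator (q (f j))} (hG : IsLocalSum f wt G)
    (hwt0 : ∀ j, 0 ≤ wt j) (h : Tempered wt' wt) : IsLocalSum f wt' G :=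
  ⟨hG.1, fun k => (hG.2 k).trans (fun p => hwt0 p.1) (h.comp _)⟩

variable [∀ n x, NeZero (q n x)]

/-- A family of operators `A j`, localized around the sites `u j` up to errors that decay faster
than any power of the distance. -/
def AlmostLocal {J : Type*} (f : J → ι) (u : ∀ j, Λ (f j)) (wt : J → ℝ)
    (A : ∀ j, Operator (q (f j))) : Prop :=
  Tempered wt (fun j => ‖A j‖) ∧ ∀ k : ℕ, Tempered (fun p : J × ℕ => wt p.1)
    fun p => ‖A p.1 - cut (ball (u p.1) p.2) (A p.1)‖ * (1 + p.2) ^ k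

variable {J : Type*} {f : J → ι} {u : ∀ j, Λ (f j)} {wt : J → ℝ}

namespace AlmostLocal

variable {A B : ∀ j, Operator (q (f j))}

lemma comp (hA : AlmostLocal f u wt A) {J' : Type*} (g : J' → J) :
    AlmostLocal (fun j => f (g j)) (fun j => u (g j)) (fun j => wt (g j)) fun j => A (g j) :=
  ⟨hA.1.comp g, fun k => (hA.2 k).comp fun p : J' × ℕ => (g p.1, p.2)⟩

lemma trans (hA : AlmostLocal f u wt A) (hwt0 : ∀ j, 0 ≤ wt j) {wt' : J → ℝ} (h : Tempered wt' wt) :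
    AlmostLocal f u wt' A :=
  ⟨hA.1.trans hwt0 h, fun k => (hA.2 k).trans (fun p => hwt0 p.1) (h.comp _)⟩

lemma of_approx (hn : Tempered wt fun j => ‖A j‖)
    (h : ∀ k, ∃ (C : ℝ) (p : ℕ), 0 ≤ C ∧ ∀ j (s : ℕ), ∃ A', SupportedOn (ball (u j) s) A' ∧
      ‖A j - A'‖ * (1 + s) ^ k ≤ C * wt j ^ p) : AlmostLocal f u wt A := by
  refine ⟨hn, fun k => ?_⟩
  obtain ⟨C, p, hC, hb⟩ := h k
  refine ⟨2 * C, p, by positivity, fun ⟨j, s⟩ => ?_⟩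
  obtain ⟨A', hs, hA'⟩ := hb j s
  refine (mul_le_mul_of_nonneg_right (norm_sub_cut_le _ hs) (by positivity)).trans ?_
  rw [mul_assoc, mul_assoc]
  exact mul_le_mul_of_nonneg_left hA' zero_le_two

lemma add (hwt : ∀ j, 1 ≤ wt j) (hA : AlmostLocal f u wt A) (hB : AlmostLocal f u wt B) :
    AlmostLocal f u wt fun j => A j + B j := by
  refine ⟨(hA.1.add hwt hB.1).mono fun j => norm_add_le _ _, fun k =>
    ((hA.2 k).add (fun p : J × ℕ => hwt p.1) (hB.2 k)).mono fun p => ?_⟩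
  rw [cut_add, ← add_mul, add_sub_add_comm]
  gcongr
  exact norm_add_le _ _

lemma smul (hwt : ∀ j, 1 ≤ wt j) (hA : AlmostLocal f u wt A) {c : J → ℂ}
    (hc : Tempered wt fun j => ‖c j‖) : AlmostLocal f u wt fun j => c j • A j := by
  refine ⟨(hA.1.mul hwt hc fun j => norm_nonneg _).mono fun j => ?_, fun k =>
    ((hA.2 k).mul (fun p : J × ℕ => hwt p.1) (hc.comp Prod.fst) fun j => norm_nonneg _).mono fun p => ?_⟩
  · rw [norm_smul, mul_comm]
  · rw [cut_smul, ← smul_sub, norm_smul]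
    exact le_of_eq (by ring)

lemma const_smul (hwt : ∀ j, 1 ≤ wt j) (hA : AlmostLocal f u wt A) (c : ℂ) :
    AlmostLocal f u wt fun j => c • A j :=
  hA.smul hwt (Tempered.const _)

end AlmostLocal

/-! ### Decomposition into shells -/

/-- The part of `A` that is resolved on the ball of radius `r` around `u`, but not on smaller
balls. -/
noncomputable def shell {V : Type*} [Fintype V] [DecidableEq V] [MetricSpace V] {q : V → ℕ}
    [∀ x, NeZero (q x)] (u : V) (r : ℕ) (A : Operator q) : Operator q :=
  match r with
  | 0 => cut (ball u (0 : ℕ)) A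
  | r + 1 => cut (ball u (r + 1 : ℕ)) A - cut (ball u r) A

section Shell

variable {V : Type*} [Fintype V] [DecidableEq V] [MetricSpace V] {q : V → ℕ} [∀ x, NeZero (q x)]

lemma supportedOn_shell (u : V) (r : ℕ) (A : Operator q) : SupportedOn (ball u r) (shell u r A) := by
  cases r with
  | zero => exact supportedOn_cut _ _
  | succ r =>
    exact (supportedOn_cut _ _).sub ((supportedOn_cut _ _).mono (ball_mono u (by simp)))

lemma sum_shell (u : V) (A : Operator q) (n : ℕ) :
    ∑ r ∈ Finset.range (n + 1), shell u r A = cut (ball u n) A := by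
  induction n with
  | zero => simp [shell]
  | succ n ih => rw [Finset.sum_range_succ, ih]; simp [shell]

/-- A number of shells that exhausts a finite system from any of its sites. -/
noncomputable def numShells (V : Type*) [Fintype V] [MetricSpace V] : ℕ :=
  ⌈Metric.diam (Set.univ : Set V)⌉₊ + 1

lemma sum_shell_eq (u : V) (A : Operator q) :
    ∑ r ∈ Finset.range (numShells V), shell u r A = A := by
  rw [numShells, sum_shell]
  refine cut_eq_self ?_
  convert supportedOn_univ A
  ext x
  simp only [mem_ball, Finset.mem_univ, iff_true]
  exact (Metric.dist_le_diam_of_mem Set.finite_univ.isBounded (Set.mem_univ _)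
    (Set.mem_univ _)).trans (Nat.le_ceil _)

lemma norm_shell_succ_le (u : V) (r : ℕ) (A : Operator q) : ‖shell u (r + 1) A‖ ≤
    ‖A - cut (ball u (r + 1 : ℕ)) A‖ + ‖A - cut (ball u r) A‖ := by
  have h : shell u (r + 1) A = (A - cut (ball u r) A) - (A - cut (ball u (r + 1 : ℕ)) A) := by
    simp [shell]
  rw [h]
  exact (norm_sub_le _ _).trans (add_comm _ _).le

lemma shell_star (u : V) (r : ℕ) (A : Operator q) : shell u r (star A) = star (shell u r A) := by
  cases r <;> simp [shell, cut_star]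

end Shell

lemma AlmostLocal.shell {A : ∀ j, Operator (q (f j))} (hwt : ∀ j, 1 ≤ wt j)
    (hA : AlmostLocal f u wt A) (k : ℕ) : Tempered (fun p : J × ℕ => wt p.1)
      fun p => ‖shell (u p.1) p.2 (A p.1)‖ * (1 + p.2) ^ k := by
  obtain ⟨C, p, hC, hb⟩ := hA.1
  obtain ⟨C', p', hC', hb'⟩ := hA.2 k
  refine ⟨C + 2 * 2 ^ k * C', p + p', by positivity, fun ⟨j, r⟩ => ?_⟩
  have h0 := hwt j
  have h1 : wt j ^ p ≤ wt j ^ (p + p') := pow_le_pow_right₀ h0 (by omega)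
  have h2 : wt j ^ p' ≤ wt j ^ (p + p') := pow_le_pow_right₀ h0 (by omega)
  cases r with
  | zero =>
    have h3 : 0 ≤ 2 * 2 ^ k * C' * wt j ^ (p + p') := by positivity
    have h4 : ‖_root_.shell (u j) 0 (A j)‖ ≤ C * wt j ^ (p + p') :=
      (norm_cut_le _ _).trans ((hb j).trans (by gcongr))
    simpa [add_mul] using h4.trans (by linarith)
  | succ r =>
    have h3 := hb' (j, r)
    have h4 := hb' (j, r + 1)
    have h5 : ‖_root_.shell (u j) (r + 1) (A j)‖ ≤ ‖A j - cut (ball (u j) (r + 1 : ℕ)) (A j)‖ +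
        ‖A j - cut (ball (u j) r) (A j)‖ := by
      exact norm_shell_succ_le _ _ _
    have h6 : (1 + ((r + 1 : ℕ) : ℝ)) ^ k ≤ 2 ^ k * (1 + r) ^ k := by
      rw [← mul_pow]
      gcongr
      push_cast
      linarith [(Nat.cast_nonneg r : (0 : ℝ) ≤ r)]
    have h7 : (1 : ℝ) ≤ 2 ^ k := one_le_pow₀ (by norm_num)
    simp only at h3 h4 ⊢
    generalize ‖A j - cut (ball (u j) (r + 1 : ℕ)) (A j)‖ = a at h4 h5
    have hb0 : 0 ≤ ‖A j - cut (ball (u j) r) (A j)‖ := norm_nonneg _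
    generalize ‖A j - cut (ball (u j) r) (A j)‖ = b at h3 h5 hb0
    calc _ ≤ (a + b) * (1 + ((r + 1 : ℕ) : ℝ)) ^ k :=
          mul_le_mul_of_nonneg_right h5 (by positivity)
      _ ≤ a * (1 + ((r + 1 : ℕ) : ℝ)) ^ k + b * (2 ^ k * (1 + r) ^ k) := by
          rw [add_mul]; gcongr
      _ ≤ C' * wt j ^ p' + 2 ^ k * (C' * wt j ^ p') := by
          refine add_le_add h4 ?_
          rw [mul_left_comm]
          gcongr
      _ ≤ 2 ^ k * (C' * wt j ^ p') + 2 ^ k * (C' * wt j ^ p') := by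
          exact add_le_add (le_mul_of_one_le_left (by positivity) h7) le_rfl
      _ = 2 * 2 ^ k * C' * wt j ^ p' := by ring
      _ ≤ 2 * 2 ^ k * C' * wt j ^ (p + p') := by gcongr
      _ ≤ _ := by
          have : 0 ≤ C * wt j ^ (p + p') := by positivity
          rw [add_mul]; linarith

/-- A linear map preserves almost local operators if its effect on an operator on a ball is
controlled by a power of the radius of the ball. -/
theorem AlmostLocal.map {A : ∀ j, Operator (q (f j))} (hwt : ∀ j, 1 ≤ wt j)
    (hA : AlmostLocal f u wt A) (L : ∀ j, Operator (q (f j)) →+ Operator (q (f j)))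
    (hn : ∃ (C : ℝ) (p a : ℕ), 0 ≤ C ∧ ∀ j (r : ℕ) B, SupportedOn (ball (u j) r) B →
      ‖L j B‖ ≤ C * wt j ^ p * (1 + r) ^ a * ‖B‖)
    (hL : ∀ k, ∃ (C : ℝ) (p a : ℕ), 0 ≤ C ∧ ∀ j (r s : ℕ) B, SupportedOn (ball (u j) r) B →
      ∃ B', SupportedOn (ball (u j) s) B' ∧
        ‖L j B - B'‖ * (1 + s) ^ k ≤ C * wt j ^ p * (1 + r) ^ a * ‖B‖) :
    AlmostLocal f u wt fun j => L j (A j) := by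
  obtain ⟨S, hS0, hS⟩ := exists_sum_inv_sq_le
  have key : ∀ (C : ℝ) (p a : ℕ), 0 ≤ C → ∃ (C' : ℝ) (p' : ℕ), 0 ≤ C' ∧ ∀ j,
      ∑ r ∈ Finset.range (numShells (Λ (f j))),
        C * wt j ^ p * (1 + (r : ℝ)) ^ a * ‖_root_.shell (u j) r (A j)‖ ≤ C' * wt j ^ p' := by
    intro C p a hC
    obtain ⟨C', p', hC', hb⟩ := hA.shell hwt (a + 2)
    refine ⟨C * C' * S, p + p', by positivity, fun j => ?_⟩
    have := hwt j
    calc _ ≤ ∑ r ∈ Finset.range (numShells (Λ (f j))),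
          C * C' * wt j ^ (p + p') * (1 / (1 + (r : ℝ)) ^ 2) := by
          refine Finset.sum_le_sum fun r _ => ?_
          have h1 := hb (j, r)
          simp only [pow_add] at h1
          rw [mul_one_div, le_div_iff₀ (by positivity)]
          calc _ = C * wt j ^ p * (‖_root_.shell (u j) r (A j)‖ *
                ((1 + (r : ℝ)) ^ a * (1 + (r : ℝ)) ^ 2)) := by ring
            _ ≤ C * wt j ^ p * (C' * wt j ^ p') := by gcongr
            _ = _ := by ring
      _ = C * C' * wt j ^ (p + p') * ∑ r ∈ Finset.range (numShells (Λ (f j))),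
          (1 / (1 + (r : ℝ)) ^ 2) := by rw [Finset.mul_sum]
      _ ≤ C * C' * wt j ^ (p + p') * S := by gcongr; exact hS _
      _ = _ := by ring
  have hdec : ∀ j, L j (A j) = ∑ r ∈ Finset.range (numShells (Λ (f j))),
      L j (_root_.shell (u j) r (A j)) := fun j => by
    rw [← map_sum, sum_shell_eq]
  refine of_approx ?_ fun k => ?_
  · obtain ⟨C, p, a, hC, hb⟩ := hn
    obtain ⟨C', p', hC', hb'⟩ := key C p a hC
    refine ⟨C', p', hC', fun j => le_trans ?_ (hb' j)⟩
    change ‖L j (A j)‖ ≤ _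
    rw [hdec]
    exact (norm_sum_le _ _).trans
      (Finset.sum_le_sum fun r _ => hb j r _ (supportedOn_shell _ _ _))
  · obtain ⟨C, p, a, hC, hb⟩ := hL k
    obtain ⟨C', p', hC', hb'⟩ := key C p a hC
    refine ⟨C', p', hC', fun j s => ?_⟩
    choose B' hB' hB using fun r : ℕ => hb j r s _ (supportedOn_shell (u j) r (A j))
    refine ⟨∑ r ∈ Finset.range (numShells (Λ (f j))), B' r, SupportedOn.sum fun r _ => hB' r,
      le_trans ?_ (hb' j)⟩
    rw [hdec, ← Finset.sum_sub_distrib]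
    refine le_trans (mul_le_mul_of_nonneg_right (norm_sum_le _ _) (by positivity)) ?_
    rw [Finset.sum_mul]
    exact Finset.sum_le_sum fun r _ => hB r

/-- `B ↦ A B - B A` as an additive map. -/
def opCommHom {𝔸 : Type*} [CStarAlgebra 𝔸] (A : 𝔸) : 𝔸 →+ 𝔸 where
  toFun := opComm A
  map_zero' := by simp [opComm]
  map_add' B C := by simp only [opComm]; noncomm_ring

/-- `A ↦ U* A U` as an additive map. -/
def conjHom {𝔸 : Type*} [CStarAlgebra 𝔸] (U : 𝔸) : 𝔸 →+ 𝔸 where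
  toFun A := star U * A * U
  map_zero' := by simp
  map_add' B C := by noncomm_ring

section Commutator

variable {V : Type*} [Fintype V] [DecidableEq V] [MetricSpace V] {q : V → ℕ}

lemma norm_opComm_sum_le {G : Finset V → Operator q} (hG : ∀ Z, SupportedOn Z (G Z)) {J : ℝ}
    (hJ : ∀ v, weightAt 0 G v ≤ J) {X : Finset V} {B : Operator q} (hB : SupportedOn X B) :
    ‖opComm (∑ Z, G Z) B‖ ≤ 2 * (X.card * J) * ‖B‖ := by
  rw [opComm_sum_eq hG hB]
  refine (norm_opComm_le _ _).trans ?_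
  gcongr
  exact (norm_sum_le _ _).trans (sum_norm_le hJ X)

lemma exists_norm_opComm_sum_sub_le {G : Finset V → Operator q} (hG : ∀ Z, SupportedOn Z (G Z))
    {J : ℝ} {k : ℕ} (hJ : ∀ v, weightAt k G v ≤ J) {u : V} {r s : ℕ} (hrs : r ≤ s)
    {B : Operator q} (hB : SupportedOn (ball u r) B) :
    ∃ B', SupportedOn (ball u s) B' ∧ ‖opComm (∑ Z, G Z) B - B'‖ * (1 + s) ^ k ≤
      (ball u r).card * J * (2 * ‖B‖ * (1 + r) ^ k) := by
  classical
  set X := ball u (r : ℝ)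
  set Y := ball u (s : ℝ)
  have hXY : X ⊆ Y := ball_mono _ (by exact_mod_cast hrs)
  refine ⟨∑ Z with ¬Disjoint Z X, if Z ⊆ Y then opComm (G Z) B else 0,
    SupportedOn.sum fun Z _ => ?_, ?_⟩
  · split_ifs with h
    · exact ((hG Z).mono h).opComm (hB.mono hXY)
    · exact supportedOn_zero _
  rw [opComm_sum_eq hG hB, opComm_sum_left, ← Finset.sum_sub_distrib]
  calc _ ≤ (∑ Z with ¬Disjoint Z X, ‖opComm (G Z) B - if Z ⊆ Y then opComm (G Z) B else 0‖) *
        (1 + s) ^ k := mul_le_mul_of_nonneg_right (norm_sum_le _ _) (by positivity)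
    _ = ∑ Z with ¬Disjoint Z X, ‖opComm (G Z) B -
        if Z ⊆ Y then opComm (G Z) B else 0‖ * (1 + s) ^ k := Finset.sum_mul _ _ _
    _ ≤ ∑ Z with ¬Disjoint Z X, ‖G Z‖ * (1 + Metric.diam (Z : Set V)) ^ k *
        (2 * ‖B‖ * (1 + r) ^ k) := by
        refine Finset.sum_le_sum fun Z hZ => ?_
        have hd := Metric.diam_nonneg (s := (Z : Set V))
        by_cases h : Z ⊆ Y
        · rw [if_pos h, sub_self, norm_zero, zero_mul]
          positivity
        · rw [if_neg h, sub_zero]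
          obtain ⟨x, hx, hxX⟩ := Finset.not_disjoint_iff.1 (Finset.mem_filter.1 hZ).2
          obtain ⟨z, hz, hzY⟩ := Finset.not_subset.1 h
          have h1 : dist z x ≤ Metric.diam (Z : Set V) :=
            Metric.dist_le_diam_of_mem Z.finite_toSet.isBounded hz hx
          have h2 : (s : ℝ) < dist z u := not_le.1 fun h' => hzY (mem_ball.2 h')
          have h3 := mem_ball.1 hxX
          have h4 := dist_triangle z x u
          have h5 : (1 + s : ℝ) ≤ (1 + Metric.diam (Z : Set V)) * (1 + r) := by
            nlinarith [(Nat.cast_nonneg r : (0 : ℝ) ≤ r)]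
          have h6 : (1 + s : ℝ) ^ k ≤ (1 + Metric.diam (Z : Set V)) ^ k * (1 + r) ^ k := by
            rw [← mul_pow]; gcongr
          refine (mul_le_mul (norm_opComm_le (G Z) B) h6 (by positivity)
            (by positivity)).trans (le_of_eq (by ring))
    _ ≤ _ := by
        rw [← Finset.sum_mul]
        exact mul_le_mul_of_nonneg_right (sum_norm_mul_diam_le hJ X) (by positivity)

end Commutator

/-- The commutator of a local sum with an almost local operator is almost local. -/
theorem AlmostLocal.opComm (hΛ : UniformPolynomialGrowth Λ) {A : ∀ j, Operator (q (f j))}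
    (hwt : ∀ j, 1 ≤ wt j) {G : ∀ j, Finset (Λ (f j)) → Operator (q (f j))}
    (hG : IsLocalSum f wt G) (hA : AlmostLocal f u wt A) :
    AlmostLocal f u wt fun j => opComm (∑ Z, G j Z) (A j) := by
  obtain ⟨C, D, hC1, hball⟩ := hΛ.exists_card_ball_le
  obtain ⟨J0, p0, hJ0, hb0⟩ := hG.2 0
  have hnorm : ∀ j (r : ℕ) B, SupportedOn (ball (u j) r) B →
      ‖_root_.opComm (∑ Z, G j Z) B‖ ≤ 2 * C * J0 * wt j ^ p0 * (1 + r) ^ D * ‖B‖ := by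
    intro j r B hB
    have := hwt j
    refine (norm_opComm_sum_le (hG.1 j) (J := J0 * wt j ^ p0) (fun v => hb0 ⟨j, v⟩) hB).trans ?_
    have h1 := hball _ (u j) r
    have h2 : 0 ≤ ‖B‖ := norm_nonneg B
    generalize ‖B‖ = b at h2
    calc _ ≤ 2 * (C * (1 + r) ^ D * (J0 * wt j ^ p0)) * b := by gcongr
      _ = _ := by ring
  refine hA.map hwt (fun j => opCommHom (∑ Z, G j Z))
    ⟨2 * C * J0, p0, D, by positivity, hnorm⟩ fun k => ?_
  obtain ⟨J1, p1, hJ1, hb1⟩ := hG.2 k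
  refine ⟨2 * C * (J0 + J1), p0 + p1, D + k, by positivity, fun j r s B hB => ?_⟩
  have h0 := hwt j
  have hp0 : wt j ^ p0 ≤ wt j ^ (p0 + p1) := pow_le_pow_right₀ h0 (by omega)
  have hp1 : wt j ^ p1 ≤ wt j ^ (p0 + p1) := pow_le_pow_right₀ h0 (by omega)
  change ∃ B', _ ∧ ‖_root_.opComm (∑ Z, G j Z) B - B'‖ * (1 + s) ^ k ≤ _
  have hbn : 0 ≤ ‖B‖ := norm_nonneg B
  rcases lt_or_ge s r with hsr | hrs
  · refine ⟨0, supportedOn_zero _, ?_⟩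
    rw [sub_zero]
    have h3 := hnorm j r B hB
    have h4 : 0 ≤ ‖_root_.opComm (∑ Z, G j Z) B‖ := norm_nonneg _
    generalize ‖_root_.opComm (∑ Z, G j Z) B‖ = y at h3 h4
    generalize ‖B‖ = b at h3 hbn
    calc _ ≤ (2 * C * J0 * wt j ^ p0 * (1 + r) ^ D * b) * (1 + r) ^ k := by gcongr
      _ ≤ (2 * C * (J0 + J1) * wt j ^ (p0 + p1) * (1 + r) ^ D * b) * (1 + r) ^ k := by
          gcongr
          linarith
      _ = _ := by ring
  · obtain ⟨B', hB', hle⟩ :=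
      exists_norm_opComm_sum_sub_le (hG.1 j) (J := J1 * wt j ^ p1) (k := k)
        (fun v => hb1 ⟨j, v⟩) hrs hB
    refine ⟨B', hB', hle.trans ?_⟩
    have h1 := hball _ (u j) r
    generalize ‖B‖ = b at hbn
    calc _ ≤ (C * (1 + r) ^ D * (J1 * wt j ^ p1)) * (2 * b * (1 + r) ^ k) := by gcongr
      _ ≤ (C * (1 + r) ^ D * ((J0 + J1) * wt j ^ (p0 + p1))) * (2 * b * (1 + r) ^ k) := by
          gcongr
          linarith
      _ = _ := by ring

/-- The Heisenberg evolution over a unit of time preserves almost local operators. The generator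
may be of the order of a power of the weight, which covers evolutions over long times. -/
theorem AlmostLocal.heisenberg (hΛ : UniformPolynomialGrowth Λ) {A : ∀ j, Operator (q (f j))}
    (hwt : ∀ j, 1 ≤ wt j) {G : ∀ j, ℝ → Finset (Λ (f j)) → Operator (q (f j))}
    (hc : ∀ j Z, Continuous fun t => G j t Z) (hsa : ∀ j t Z, IsSelfAdjoint (G j t Z))
    (hG : IsLocalSum (fun p : J × ℝ => f p.1) (fun p => wt p.1) fun p => G p.1 p.2)
    {U : ∀ j, ℝ → Operator (q (f j))} (hU : ∀ j, IsPropagator (fun t => ∑ Z, G j t Z) (U j))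
    (hA : AlmostLocal f u wt A) : AlmostLocal f u wt fun j => star (U j 1) * A j * U j 1 := by
  have hsas : ∀ j t, IsSelfAdjoint (∑ Z, G j t Z) := fun j t =>
    isSelfAdjoint_sum _ fun Z _ => hsa j t Z
  have hun := fun j => (hU j).mem_unitary (hsas j) 1
  obtain ⟨C, D, hC1, hball⟩ := hΛ.exists_card_ball_le
  obtain ⟨J0, p0, hJ0, hb0⟩ := hG.2 0
  refine hA.map hwt (fun j => conjHom (U j 1)) ⟨1, 0, 0, zero_le_one, fun j r B _ => ?_⟩ fun k => ?_
  · change ‖star (U j 1) * B * U j 1‖ ≤ _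
    rw [norm_star_mul_mul (hun j)]
    simp
  obtain ⟨J1, p1, hJ1, hb1⟩ := hG.2 (2 * (D + k))
  obtain ⟨c, hc0, hcN⟩ := exists_min_one_le (2 * (D + k))
  -- the error bound, with `x = wt j`
  let E : J → ℝ := fun j => 1 + 2 * C * (J1 * wt j ^ p1 + J0 * wt j ^ p0 * (C * (c *
    (1 + 2 * (J0 * wt j ^ p0)) ^ (2 * (D + k)) * 2 ^ (2 * (D + k)))))
  have hwt' : ∀ j, 0 ≤ wt j := fun j => zero_le_one.trans (hwt j)
  have hE : Tempered wt E := by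
    have t0 : Tempered wt fun j => J0 * wt j ^ p0 := ⟨J0, p0, hJ0, fun j => le_rfl⟩
    have t1 : Tempered wt fun j => J1 * wt j ^ p1 := ⟨J1, p1, hJ1, fun j => le_rfl⟩
    have n0 : ∀ j, 0 ≤ J0 * wt j ^ p0 := fun j => by have := hwt' j; positivity
    have t2 : Tempered wt fun j => C * (c *
        (1 + 2 * (J0 * wt j ^ p0)) ^ (2 * (D + k)) * 2 ^ (2 * (D + k))) :=
      (Tempered.const C).mul hwt (((Tempered.const c).mul hwt ((((Tempered.const 1).add hwt
        ((Tempered.const 2).mul hwt t0 n0))).pow hwt (fun j => by have := n0 j; positivity) _)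
        (fun j => by have := n0 j; positivity)).mul hwt (Tempered.const _) fun j => by positivity)
        (fun j => by have := n0 j; positivity)
    exact (Tempered.const 1).add hwt ((Tempered.const (2 * C)).mul hwt (t1.add hwt
      (t0.mul hwt t2 fun j => by have := n0 j; positivity))
      fun j => by have := n0 j; have := hwt' j; positivity)
  obtain ⟨C', p', hC', hb'⟩ := hE
  refine ⟨C', p', D + k + D, hC', fun j r s B hB => ?_⟩
  change ∃ B', _ ∧ ‖star (U j 1) * B * U j 1 - B'‖ * (1 + s) ^ k ≤ _
  have h0 := hwt j
  have hr1 : (1 : ℝ) ≤ 1 + r := by linarith [(Nat.cast_nonneg r : (0 : ℝ) ≤ r)]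
  suffices h : ∃ B', SupportedOn (ball (u j) s) B' ∧
      ‖star (U j 1) * B * U j 1 - B'‖ * (1 + s) ^ k ≤ E j * (1 + r) ^ (D + k + D) * ‖B‖ by
    obtain ⟨B', h1, h2⟩ := h
    exact ⟨B', h1, h2.trans (by have := hb' j; gcongr)⟩
  rcases le_or_gt s r with hsr | hrs
  · refine ⟨0, supportedOn_zero _, ?_⟩
    have hE1 : 1 ≤ E j := by simp only [E]; linarith [show 0 ≤ 2 * C * (J1 * wt j ^ p1 +
      J0 * wt j ^ p0 * (C * (c * (1 + 2 * (J0 * wt j ^ p0)) ^ (2 * (D + k)) *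
      2 ^ (2 * (D + k))))) by positivity]
    rw [sub_zero, norm_star_mul_mul (hun j)]
    calc ‖B‖ * (1 + s) ^ k ≤ ‖B‖ * (1 + r) ^ k := by gcongr
      _ ≤ ‖B‖ * (1 + r) ^ (D + k + D) := by
          gcongr
          omega
      _ = 1 * (1 + r) ^ (D + k + D) * ‖B‖ := by ring
      _ ≤ _ := by gcongr
  · -- truncate at the range `M ≈ √(s - r)`, so that a chain across the gap has about `M` links
    set M := Nat.sqrt (s - r) with hM
    have hM1 : 1 ≤ M := Nat.sqrt_pos.2 (by omega)
    obtain ⟨N, hN⟩ : ∃ N, M = N + 1 := ⟨M - 1, by omega⟩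
    have hMs : r + M * M ≤ s := by have := Nat.sqrt_le (s - r); rw [← hM] at this; omega
    have hMs' : 1 + s ≤ (1 + r) * (1 + M) ^ 2 := by
      have h1 := Nat.succ_le_succ_sqrt (s - r)
      rw [← hM] at h1
      have h2 : 1 + s ≤ (1 + r) * (1 + (s - r)) := by nlinarith [Nat.sub_add_cancel hrs.le]
      refine h2.trans (Nat.mul_le_mul_left _ ?_)
      calc 1 + (s - r) = Nat.succ (s - r) := by omega
        _ ≤ Nat.succ M * Nat.succ M := h1
        _ = _ := by rw [Nat.succ_eq_add_one]; ring
    have hMr : (1 + s : ℝ) ≤ (1 + r) * (1 + M) ^ 2 := by exact_mod_cast hMs'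
    obtain ⟨B', hB', hle⟩ := exists_supportedOn_norm_heisenberg_sub_le (hU j) (hc j) (hsa j)
      (fun t Z => hG.1 (j, t) Z) (J := J0 * wt j ^ p0) (C := J1 * wt j ^ p1) (k := 2 * (D + k))
      (fun t v => hb0 ⟨(j, t), v⟩) (fun t v => hb1 ⟨(j, t), v⟩) (u := u j) (ρ := r) (r := s)
      (R := M) (N := N) (by positivity) (by
        have : (r + M * M : ℝ) ≤ s := by exact_mod_cast hMs
        rw [hN] at this ⊢
        push_cast at this ⊢
        linarith) hB
    refine ⟨B', hB', ?_⟩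
    set x := J0 * wt j ^ p0 with hx
    have hx0 : 0 ≤ x := by positivity
    have hmin : min 1 ((ball (u j) (r : ℝ)).card * ((2 * x) ^ N / N.factorial)) * (1 + M) ^ (2 * (D + k))
        ≤ (1 + r) ^ D * (C * (c * (1 + 2 * x) ^ (2 * (D + k)) * 2 ^ (2 * (D + k)))) := by
      have hCr : 1 ≤ C * (1 + (r : ℝ)) ^ D := one_le_mul_of_one_le_of_one_le hC1 (one_le_pow₀ hr1)
      have h1 : min 1 ((ball (u j) (r : ℝ)).card * ((2 * x) ^ N / N.factorial)) ≤
          C * (1 + (r : ℝ)) ^ D * min 1 ((2 * x) ^ N / N.factorial) := by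
        rw [mul_min_of_nonneg _ _ (by positivity)]
        refine min_le_min (by simpa using hCr) ?_
        gcongr
        exact hball _ _ _
      have h2 : (1 + M : ℝ) ^ (2 * (D + k)) ≤ 2 ^ (2 * (D + k)) * (1 + N) ^ (2 * (D + k)) := by
        rw [← mul_pow, hN]
        gcongr
        push_cast
        linarith [(Nat.cast_nonneg N : (0 : ℝ) ≤ N)]
      have h3 : 0 ≤ min 1 ((2 * x) ^ N / N.factorial) := le_min zero_le_one (by positivity)
      calc _ ≤ (C * (1 + (r : ℝ)) ^ D * min 1 ((2 * x) ^ N / N.factorial)) *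
            (2 ^ (2 * (D + k)) * (1 + N) ^ (2 * (D + k))) := by gcongr
        _ = C * (1 + (r : ℝ)) ^ D * 2 ^ (2 * (D + k)) *
            (min 1 ((2 * x) ^ N / N.factorial) * (1 + N) ^ (2 * (D + k))) := by ring
        _ ≤ C * (1 + (r : ℝ)) ^ D * 2 ^ (2 * (D + k)) * (c * (1 + 2 * x) ^ (2 * (D + k))) := by
            exact mul_le_mul_of_nonneg_left (hcN _ _ (by positivity)) (by positivity)
        _ = _ := by ring
    set ε := min 1 ((ball (u j) (r : ℝ)).card * ((2 * x) ^ N / N.factorial)) with hε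
    have hε0 : 0 ≤ ε := le_min zero_le_one (by positivity)
    set y := C * (c * (1 + 2 * x) ^ (2 * (D + k)) * 2 ^ (2 * (D + k))) with hy
    have hy0 : 0 ≤ y := by positivity
    refine (mul_le_mul_of_nonneg_right hle (by positivity)).trans ?_
    have hbn : 0 ≤ ‖B‖ := norm_nonneg B
    generalize ‖B‖ = b at hbn
    have h1 := hball _ (u j) s
    have h2 : J1 * wt j ^ p1 ≤ (1 + r) ^ D * (J1 * wt j ^ p1) :=
      le_mul_of_one_le_left (by positivity) (one_le_pow₀ hr1)
    have h3 : 2 * C * (J1 * wt j ^ p1 + x * y) ≤ E j := by simp only [E]; linarith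
    have hz : 0 ≤ J1 * wt j ^ p1 := by positivity
    generalize J1 * wt j ^ p1 = z at h2 h3 hz
    calc _ ≤ (2 * b * ((C * (1 + s) ^ D) * (z / (1 + M) ^ (2 * (D + k)) + x * ε))) *
          (1 + s) ^ k := by gcongr
      _ = 2 * C * b * (z / (1 + M) ^ (2 * (D + k)) + x * ε) * (1 + s) ^ (D + k) := by
          rw [pow_add]; ring
      _ ≤ 2 * C * b * (z / (1 + M) ^ (2 * (D + k)) + x * ε) *
          ((1 + r) * (1 + M) ^ 2) ^ (D + k) := by gcongr
      _ = 2 * C * b * (1 + r) ^ (D + k) * (z + x * (ε * (1 + M) ^ (2 * (D + k)))) := by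
          rw [mul_pow, ← pow_mul]
          field_simp
      _ ≤ 2 * C * b * (1 + r) ^ (D + k) * ((1 + r) ^ D * z + x * ((1 + r) ^ D * y)) := by
          gcongr
      _ = (2 * C * (z + x * y)) * (1 + r) ^ (D + k + D) * b := by
          rw [pow_add _ (D + k) D]; ring
      _ ≤ E j * (1 + r) ^ (D + k + D) * b := by gcongr

end AlmostLocal

section SmoothFamilies

open MeasureTheory

variable {ι : Type*} {Λ : ι → Type*} [∀ n, Fintype (Λ n)] [∀ n, DecidableEq (Λ n)]
  [∀ n, MetricSpace (Λ n)] {q : ∀ n, Λ n → ℕ} [∀ n x, NeZero (q n x)]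
  {J : Type*} {f : J → ι} {u : ∀ j, Λ (f j)} {wt : J → ℝ}

/-! ### Integrals of almost local operators -/

lemma integrable_smul_of_norm_le {X E : Type*} [MeasurableSpace X] {μ : Measure X}
    [NormedAddCommGroup E] [NormedSpace ℝ E] {v c : X → ℝ} (hv : ∀ x, 0 ≤ v x) {p : ℕ}
    (hc : Integrable c μ) (hcp : Integrable (fun x => c x * v x ^ p) μ) {B : X → E}
    (hB : AEStronglyMeasurable B μ) {K : ℝ} (hK : ∀ x, ‖B x‖ ≤ K * v x ^ p) :
    Integrable (fun x => c x • B x) μ ∧ ‖∫ x, c x • B x ∂μ‖ ≤ K * ∫ x, ‖c x * v x ^ p‖ ∂μ := by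
  have hle : ∀ x, ‖c x • B x‖ ≤ K * ‖c x * v x ^ p‖ := fun x => by
    have h0 : 0 ≤ v x ^ p := pow_nonneg (hv x) p
    rw [norm_smul, norm_mul, Real.norm_of_nonneg h0]
    calc ‖c x‖ * ‖B x‖ ≤ ‖c x‖ * (K * v x ^ p) := by have := hK x; gcongr
      _ = _ := by ring
  refine ⟨(hcp.norm.const_mul K).mono' (hc.aestronglyMeasurable.smul hB) (ae_of_all _ hle), ?_⟩
  rw [← integral_const_mul]
  exact norm_integral_le_of_norm_le (hcp.norm.const_mul K) (ae_of_all _ hle)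

/-- An average of almost local operators is almost local if its weight `c` decays faster than any
power of the growth `v` of their constants. -/
theorem AlmostLocal.integral {X : Type*} [MeasurableSpace X] {μ : Measure X} {v c : X → ℝ}
    (hwt : ∀ j, 1 ≤ wt j) (hv : ∀ x, 1 ≤ v x) (hc : ∀ p : ℕ, Integrable (fun x => c x * v x ^ p) μ)
    {A : ∀ j, X → Operator (q (f j))} (hm : ∀ j, AEStronglyMeasurable (A j) μ)
    (hA : AlmostLocal (fun p : J × X => f p.1) (fun p => u p.1) (fun p => wt p.1 * v p.2)
      fun p => A p.1 p.2) :
    AlmostLocal f u wt fun j => ∫ x, c x • A j x ∂μ := by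
  have hc0 : Integrable c μ := by simpa using hc 0
  have hv0 : ∀ x, 0 ≤ v x := fun x => zero_le_one.trans (hv x)
  have hwt0 : ∀ j, 0 ≤ wt j := fun j => zero_le_one.trans (hwt j)
  obtain ⟨C, p, hC, hb⟩ := hA.1
  have hint := fun j => integrable_smul_of_norm_le (K := C * wt j ^ p) hv0 hc0 (hc p) (hm j)
    fun x => (hb (j, x)).trans (le_of_eq (by rw [mul_pow, mul_assoc]))
  have hI : ∀ p : ℕ, 0 ≤ ∫ x, ‖c x * v x ^ p‖ ∂μ := fun p =>
    integral_nonneg fun x => norm_nonneg _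
  refine ⟨⟨C * ∫ x, ‖c x * v x ^ p‖ ∂μ, p, mul_nonneg hC (hI p), fun j => ?_⟩, fun k => ?_⟩
  · exact (hint j).2.trans (le_of_eq (by ring))
  · obtain ⟨C', p', hC', hb'⟩ := hA.2 k
    refine ⟨C' * ∫ x, ‖c x * v x ^ p'‖ ∂μ, p', mul_nonneg hC' (hI p'), fun ⟨j, r⟩ => ?_⟩
    have hr : (0 : ℝ) < (1 + r) ^ k := by positivity
    have h1 : (∫ x, c x • A j x ∂μ) - cut (ball (u j) r) (∫ x, c x • A j x ∂μ) =
        ∫ x, c x • (A j x - cut (ball (u j) r) (A j x)) ∂μ := by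
      rw [← cutL_apply, ← ContinuousLinearMap.integral_comp_comm _ (hint j).1,
        ← integral_sub (hint j).1 ((cutL _).integrable_comp (hint j).1)]
      refine integral_congr_ae (ae_of_all _ fun x => ?_)
      simp only [smul_sub, ← cutL_apply]
      congr 1
      exact (cutL (ball (u j) (r : ℝ))).toLinearMap.map_smul_of_tower (c x) (A j x)
    have h2 := (integrable_smul_of_norm_le (K := C' * wt j ^ p' / (1 + r) ^ k) hv0 hc0 (hc p')
      ((hm j).sub ((cutL (ball (u j) (r : ℝ))).continuous.comp_aestronglyMeasurable (hm j)))
      fun x => by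
        have h3 := hb' ((j, x), r)
        simp only at h3
        rw [← le_div_iff₀ hr] at h3
        refine h3.trans (le_of_eq ?_)
        rw [mul_pow]; ring).2
    simp only
    rw [h1, ← le_div_iff₀ hr]
    exact h2.trans (le_of_eq (by ring))

/-! ### Smooth paths of almost local operators -/

lemma AlmostLocal.zero : AlmostLocal f u wt fun j => (0 : Operator (q (f j))) := by
  have h : ∀ j (Z : Finset (Λ (f j))), cut Z (0 : Operator (q (f j))) = 0 := fun j Z => by
    rw [← cutL_apply, map_zero]
  exact ⟨by simpa using Tempered.const 0, fun k => by simpa [h] using Tempered.const 0⟩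

/-- The derivatives of order `m` of the paths `g ↦ A j g` are almost local, uniformly along the
paths. -/
def DerivAlmostLocal (f : J → ι) (u : ∀ j, Λ (f j)) (w : J × ℝ → ℝ) (m : ℕ)
    (A : ∀ j, ℝ → Operator (q (f j))) : Prop :=
  AlmostLocal (fun p : J × ℝ => f p.1) (fun p => u p.1) w fun p => iteratedDeriv m (A p.1) p.2

/-- Smooth paths of local sums, on the whole real line, with uniform bounds. -/
structure IsSmoothLocalSum (f : J → ι) (w : J × ℝ → ℝ)
    (G : ∀ j, ℝ → Finset (Λ (f j)) → Operator (q (f j))) : Prop where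
  contDiff : ∀ j Z, ContDiff ℝ ∞ fun g => G j g Z
  isLocalSum : ∀ m, IsLocalSum (fun p : J × ℝ => f p.1) w
    fun p Z => iteratedDeriv m (fun g => G p.1 g Z) p.2

namespace IsSmoothLocalSum

variable {w : J × ℝ → ℝ} {G : ∀ j, ℝ → Finset (Λ (f j)) → Operator (q (f j))}

lemma deriv (hG : IsSmoothLocalSum f w G) :
    IsSmoothLocalSum f w fun j g Z => deriv (fun g => G j g Z) g where
  contDiff j Z := (contDiff_infty_iff_deriv.1 (hG.contDiff j Z)).2
  isLocalSum m := by simpa only [iteratedDeriv_succ'] using hG.isLocalSum (m + 1)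

lemma isLocalSum_self (hG : IsSmoothLocalSum f w G) :
    IsLocalSum (fun p : J × ℝ => f p.1) w fun p => G p.1 p.2 := by
  simpa only [iteratedDeriv_zero] using hG.isLocalSum 0

lemma comp (hG : IsSmoothLocalSum f w G) {J' : Type*} (e : J' → J) :
    IsSmoothLocalSum (fun j => f (e j)) (fun p => w (e p.1, p.2)) fun j => G (e j) where
  contDiff j := hG.contDiff (e j)
  isLocalSum m := (hG.isLocalSum m).comp fun p : J' × ℝ => (e p.1, p.2)

lemma trans (hG : IsSmoothLocalSum f w G) (hw : ∀ p, 0 ≤ w p) {w' : J × ℝ → ℝ}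
    (h : Tempered w' w) : IsSmoothLocalSum f w' G where
  contDiff := hG.contDiff
  isLocalSum m := (hG.isLocalSum m).trans hw h

lemma hasDerivAt (hG : IsSmoothLocalSum f w G) (j : J) (Z : Finset (Λ (f j))) (g : ℝ) :
    HasDerivAt (fun g => G j g Z) (_root_.deriv (fun g => G j g Z) g) g :=
  ((contDiff_infty_iff_deriv.1 (hG.contDiff j Z)).1 g).hasDerivAt

lemma contDiff_sum (hG : IsSmoothLocalSum f w G) (j : J) : ContDiff ℝ ∞ fun g => ∑ Z, G j g Z :=
  ContDiff.sum fun Z _ => hG.contDiff j Z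

lemma hasDerivAt_sum (hG : IsSmoothLocalSum f w G) (j : J) (g : ℝ) :
    HasDerivAt (fun g => ∑ Z, G j g Z) (∑ Z, _root_.deriv (fun g => G j g Z) g) g :=
  HasDerivAt.fun_sum fun Z _ => hG.hasDerivAt j Z g

end IsSmoothLocalSum

lemma HasDerivAt.opComm {𝔸 : Type*} [CStarAlgebra 𝔸] {A B : ℝ → 𝔸} {A' B' : 𝔸} {t : ℝ}
    (hA : HasDerivAt A A' t) (hB : HasDerivAt B B' t) :
    HasDerivAt (fun t => opComm (A t) (B t)) (opComm A' (B t) + opComm (A t) B') t := by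
  refine ((hA.mul hB).sub (hB.mul hA)).congr_deriv ?_
  simp only [_root_.opComm]
  abel

lemma ContDiff.opComm {𝔸 E : Type*} [CStarAlgebra 𝔸] [NormedAddCommGroup E] [NormedSpace ℝ E]
    {A B : E → 𝔸} {n : ℕ∞ω}
    (hA : ContDiff ℝ n A) (hB : ContDiff ℝ n B) : ContDiff ℝ n fun t => opComm (A t) (B t) :=
  (hA.mul hB).sub (hB.mul hA)

variable {w : J × ℝ → ℝ}

lemma iteratedDeriv_succ_opComm_sum {G : ∀ j, ℝ → Finset (Λ (f j)) → Operator (q (f j))}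
    (hG : IsSmoothLocalSum f w G) {A : ∀ j, ℝ → Operator (q (f j))}
    (hA : ∀ j, ContDiff ℝ ∞ (A j)) (m : ℕ) (j : J) (g : ℝ) :
    iteratedDeriv (m + 1) (fun g => opComm (∑ Z, G j g Z) (A j g)) g =
      iteratedDeriv m (fun g => opComm (∑ Z, deriv (fun g => G j g Z) g) (A j g)) g +
      iteratedDeriv m (fun g => opComm (∑ Z, G j g Z) (deriv (A j) g)) g := by
  have hA' := fun j => contDiff_infty_iff_deriv.1 (hA j)
  have hd : deriv (fun g => opComm (∑ Z, G j g Z) (A j g)) = fun g =>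
      opComm (∑ Z, deriv (fun g => G j g Z) g) (A j g) + opComm (∑ Z, G j g Z) (deriv (A j) g) :=
    funext fun g => ((hG.hasDerivAt_sum j g).opComm ((hA' j).1 g).hasDerivAt).deriv
  rw [iteratedDeriv_succ', hd]
  exact iteratedDeriv_fun_add
    (((hG.deriv.contDiff_sum j).opComm (hA j)).of_le (by exact_mod_cast le_top)).contDiffAt
    (((hG.contDiff_sum j).opComm (hA' j).2).of_le (by exact_mod_cast le_top)).contDiffAt

/-- Derivatives of the commutator of a smooth local sum and a smooth path of almost local
operators. -/
theorem DerivAlmostLocal.opComm (hΛ : UniformPolynomialGrowth Λ) (hw : ∀ p, 1 ≤ w p) (m : ℕ) :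
    ∀ {G : ∀ j, ℝ → Finset (Λ (f j)) → Operator (q (f j))} (_ : IsSmoothLocalSum f w G)
      {A : ∀ j, ℝ → Operator (q (f j))} (_ : ∀ j, ContDiff ℝ ∞ (A j))
      (_ : ∀ i ≤ m, DerivAlmostLocal f u w i A),
      DerivAlmostLocal f u w m fun j g => opComm (∑ Z, G j g Z) (A j g) := by
  induction m with
  | zero =>
    intro G hG A _ hA
    have h := AlmostLocal.opComm hΛ hw hG.isLocalSum_self (hA 0 le_rfl)
    simpa only [DerivAlmostLocal, iteratedDeriv_zero] using h
  | succ m ih =>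
    intro G hG A hAc hA
    have h1 := ih hG.deriv hAc fun i hi => hA i (by omega)
    have h2 := ih hG (A := fun j => deriv (A j)) (fun j => (contDiff_infty_iff_deriv.1 (hAc j)).2)
      fun i hi => by
        simpa only [DerivAlmostLocal, iteratedDeriv_succ'] using hA (i + 1) (by omega)
    have h3 := AlmostLocal.add hw h1 h2
    unfold DerivAlmostLocal
    simpa only [iteratedDeriv_succ_opComm_sum hG hAc] using h3

/-- The commutator with a smooth local sum and the `m`-th derivative commute up to terms that only
involve derivatives of lower order. -/
theorem DerivAlmostLocal.opComm_sub (hΛ : UniformPolynomialGrowth Λ) (hw : ∀ p, 1 ≤ w p) (m : ℕ) :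
    ∀ {G : ∀ j, ℝ → Finset (Λ (f j)) → Operator (q (f j))} (_ : IsSmoothLocalSum f w G)
      {A : ∀ j, ℝ → Operator (q (f j))} (_ : ∀ j, ContDiff ℝ ∞ (A j))
      (_ : ∀ i < m, DerivAlmostLocal f u w i A),
      AlmostLocal (fun p : J × ℝ => f p.1) (fun p => u p.1) w fun p =>
        iteratedDeriv m (fun g => _root_.opComm (∑ Z, G p.1 g Z) (A p.1 g)) p.2 -
          _root_.opComm (∑ Z, G p.1 p.2 Z) (iteratedDeriv m (A p.1) p.2) := by
  induction m with
  | zero =>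
    intro G _ A _ _
    simpa only [iteratedDeriv_zero, sub_self] using AlmostLocal.zero
  | succ m ih =>
    intro G hG A hAc hA
    have h1 := DerivAlmostLocal.opComm hΛ hw m hG.deriv hAc fun i hi => hA i (by omega)
    have h2 := ih hG (A := fun j => deriv (A j)) (fun j => (contDiff_infty_iff_deriv.1 (hAc j)).2)
      fun i hi => by
        simpa only [DerivAlmostLocal, iteratedDeriv_succ'] using hA (i + 1) (by omega)
    have h3 := AlmostLocal.add hw h1 h2
    simp only [iteratedDeriv_succ_opComm_sum hG hAc, iteratedDeriv_succ' (f := A _), add_sub_assoc]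
    exact h3

end SmoothFamilies

section Evolution

open MeasureTheory

/-! ### Smoothness of evolutions -/

lemma contDiff_of_hasDerivAt_mul {𝔸 : Type*} [CStarAlgebra 𝔸] {K U : ℝ → 𝔸} (hK : ContDiff ℝ ∞ K)
    (hU : ∀ t, HasDerivAt U ((-Complex.I) • (K t * U t)) t) : ContDiff ℝ ∞ U := by
  have hd : deriv U = fun t => (-Complex.I) • (K t * U t) := funext fun t => (hU t).deriv
  rw [contDiff_infty]
  intro n
  induction n with
  | zero =>
    exact contDiff_zero.2 (continuous_iff_continuousAt.2 fun t => (hU t).continuousAt)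
  | succ n ih =>
    push_cast
    rw [contDiff_succ_iff_deriv]
    refine ⟨fun t => (hU t).differentiableAt, by simp, ?_⟩
    rw [hd]
    exact ((hK.of_le (by exact_mod_cast le_top)).mul ih).const_smul (-Complex.I)

lemma opComm_real_smul_left {𝔸 : Type*} [CStarAlgebra 𝔸] (c : ℝ) (A B : 𝔸) :
    opComm (c • A) B = c • opComm A B := by
  simp only [opComm, smul_mul_assoc, mul_smul_comm, smul_sub]

lemma IsPropagator.hasDerivAt_schrodinger {𝔸 : Type*} [CStarAlgebra 𝔸] {K U : ℝ → 𝔸}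
    (hU : IsPropagator K U) (hK : ∀ t, IsSelfAdjoint (K t)) (A : 𝔸) (t : ℝ) :
    HasDerivAt (fun t => U t * A * star (U t))
      ((-Complex.I) • opComm (K t) (U t * A * star (U t))) t := by
  refine (((hU.2 t).mul_const A).mul (hU.hasDerivAt_star hK t)).congr_deriv ?_
  simp only [opComm, smul_mul_assoc, mul_smul_comm, smul_sub, neg_smul, neg_mul, mul_assoc]
  abel

/-- The unitary evolution `exp (-i t H)` of a time-independent Hamiltonian. -/
noncomputable def expU {𝔸 : Type*} [CStarAlgebra 𝔸] (H : 𝔸) (t : ℝ) : 𝔸 :=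
  NormedSpace.exp (t • ((-Complex.I) • H))

section ExpU

variable {𝔸 : Type*} [CStarAlgebra 𝔸]

lemma expU_smul (H : 𝔸) (c t : ℝ) : expU (c • H) t = expU H (c * t) := by
  rw [expU, expU, smul_comm (-Complex.I) c H, smul_smul, mul_comm]

lemma isPropagator_expU (H : 𝔸) : IsPropagator (fun _ => H) (expU H) := by
  refine ⟨by simp [expU], fun t => ?_⟩
  have h := hasDerivAt_exp_smul_const' (𝕂 := ℝ) ((-Complex.I) • H) t
  rw [smul_mul_assoc] at h
  exact h

lemma expU_zero (H : 𝔸) : expU H 0 = 1 := (isPropagator_expU H).1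

lemma expU_add (H : 𝔸) (s t : ℝ) : expU H (s + t) = expU H s * expU H t := by
  have : NormedAlgebra ℚ 𝔸 := NormedAlgebra.restrictScalars ℚ ℝ 𝔸
  rw [expU, add_smul, NormedSpace.exp_add_of_commute]
  · rfl
  · exact ((Commute.refl _).smul_left s).smul_right t

lemma contDiff_expU {E : Type*} [NormedAddCommGroup E] [NormedSpace ℝ E] {H : E → 𝔸} {t : E → ℝ}
    (hH : ContDiff ℝ ∞ H) (ht : ContDiff ℝ ∞ t) : ContDiff ℝ ∞ fun x => expU (H x) (t x) := by
  have hexp : ContDiff ℝ ∞ (NormedSpace.exp : 𝔸 → 𝔸) := contDiff_iff_contDiffAt.2 fun x =>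
    (NormedSpace.exp_analytic (𝕂 := ℝ) x).contDiffAt
  exact hexp.comp (ht.smul (hH.const_smul (-Complex.I)))

end ExpU

/-! ### Mixed partial derivatives -/

section Mixed

variable {E : Type*} [NormedAddCommGroup E] [NormedSpace ℝ E]

lemma hasDerivAt_partial_fst {F : ℝ × ℝ → E} (hF : ContDiff ℝ ∞ F) (s g : ℝ) :
    HasDerivAt (fun s => F (s, g)) (fderiv ℝ F (s, g) (1, 0)) s :=
  ((hF.differentiable (by simp)) (s, g)).hasFDerivAt.comp_hasDerivAt s
    ((hasDerivAt_id s).prodMk (hasDerivAt_const s g))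

lemma hasDerivAt_partial_snd {F : ℝ × ℝ → E} (hF : ContDiff ℝ ∞ F) (s g : ℝ) :
    HasDerivAt (fun g => F (s, g)) (fderiv ℝ F (s, g) (0, 1)) g :=
  ((hF.differentiable (by simp)) (s, g)).hasFDerivAt.comp_hasDerivAt g
    ((hasDerivAt_const g s).prodMk (hasDerivAt_id g))

lemma contDiff_fderiv_apply {F : ℝ × ℝ → E} (hF : ContDiff ℝ ∞ F) (v : ℝ × ℝ) :
    ContDiff ℝ ∞ fun p => fderiv ℝ F p v :=
  (hF.fderiv_right (m := ∞) (by simp)).clm_apply contDiff_const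

lemma deriv_deriv_swap {F : ℝ × ℝ → E} (hF : ContDiff ℝ ∞ F) (s g : ℝ) :
    deriv (fun s => deriv (fun g => F (s, g)) g) s =
      deriv (fun g => deriv (fun s => F (s, g)) s) g := by
  have h1 : (fun s => deriv (fun g => F (s, g)) g) = fun s => fderiv ℝ F (s, g) (0, 1) :=
    funext fun s => (hasDerivAt_partial_snd hF s g).deriv
  have h2 : (fun g => deriv (fun s => F (s, g)) s) = fun g => fderiv ℝ F (s, g) (1, 0) :=
    funext fun g => (hasDerivAt_partial_fst hF s g).deriv
  have h3 : ∀ v : ℝ × ℝ, fderiv ℝ (fun p => fderiv ℝ F p v) (s, g) =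
      (fderiv ℝ (fderiv ℝ F) (s, g)).flip v := fun v => by
    rw [fderiv_clm_apply (((hF.fderiv_right (m := ∞) (by simp)).differentiable (by simp)) _)
      (differentiableAt_const v)]
    simp
  rw [h1, h2, (hasDerivAt_partial_fst (contDiff_fderiv_apply hF (0, 1)) s g).deriv,
    (hasDerivAt_partial_snd (contDiff_fderiv_apply hF (1, 0)) s g).deriv, h3, h3]
  exact (hF.contDiffAt.isSymmSndFDerivAt (by simpa using WithTop.coe_le_coe.2 (le_top (a := (2 : ℕ∞))))) _ _

lemma contDiff_iteratedDeriv_snd (m : ℕ) : ∀ {F : ℝ × ℝ → E}, ContDiff ℝ ∞ F →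
    ContDiff ℝ ∞ fun p : ℝ × ℝ => iteratedDeriv m (fun g => F (p.1, g)) p.2 := by
  induction m with
  | zero => intro F hF; simpa using hF
  | succ m ih =>
    intro F hF
    have h := ih (contDiff_fderiv_apply hF (0, 1))
    have h2 : ∀ s, deriv (fun g => F (s, g)) = fun g => fderiv ℝ F (s, g) (0, 1) := fun s =>
      funext fun g => (hasDerivAt_partial_snd hF s g).deriv
    simpa only [iteratedDeriv_succ', h2] using h

/-- Differentiation in one variable commutes with repeated differentiation in the other. -/
lemma hasDerivAt_iteratedDeriv_snd (m : ℕ) : ∀ {F : ℝ × ℝ → E}, ContDiff ℝ ∞ F → ∀ s g,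
    HasDerivAt (fun s => iteratedDeriv m (fun g => F (s, g)) g)
      (iteratedDeriv m (fun g => deriv (fun s => F (s, g)) s) g) s := by
  induction m with
  | zero =>
    intro F hF s g
    simpa only [iteratedDeriv_zero, (hasDerivAt_partial_fst hF s g).deriv] using
      hasDerivAt_partial_fst hF s g
  | succ m ih =>
    intro F hF s g
    have h2 : ∀ s, deriv (fun g => F (s, g)) = fun g => fderiv ℝ F (s, g) (0, 1) := fun s =>
      funext fun g => (hasDerivAt_partial_snd hF s g).deriv
    have h := ih (contDiff_fderiv_apply hF (0, 1)) s g
    simp only [iteratedDeriv_succ', h2]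
    refine h.congr_deriv ?_
    congr 1
    funext g
    rw [← deriv_deriv_swap hF]
    simp only [h2]

end Mixed

/-! ### Paths of evolved operators -/

variable {ι : Type*} {Λ : ι → Type*} [∀ n, Fintype (Λ n)] [∀ n, DecidableEq (Λ n)]
  [∀ n, MetricSpace (Λ n)] {q : ∀ n, Λ n → ℕ}
  {J : Type*} {f : J → ι} {u : ∀ j, Λ (f j)} {wt : J → ℝ}

lemma weightAt_smul {V : Type*} [Fintype V] [DecidableEq V] [MetricSpace V] {q : V → ℕ} (k : ℕ)
    (c : ℝ) (Ψ : Finset V → Operator q) (v : V) :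
    weightAt k (fun Z => c • Ψ Z) v = |c| * weightAt k Ψ v := by
  rw [weightAt, weightAt, Finset.mul_sum]
  refine Finset.sum_congr rfl fun Z _ => ?_
  rw [norm_smul, Real.norm_eq_abs]
  ring

lemma IsLocalSum.smul {G : ∀ j, Finset (Λ (f j)) → Operator (q (f j))} (hG : IsLocalSum f wt G)
    (hwt : ∀ j, 1 ≤ wt j) {c : J → ℝ} (hc : Tempered wt fun j => |c j|) :
    IsLocalSum f wt fun j Z => c j • G j Z := by
  refine ⟨fun j Z => (hG.1 j Z).real_smul _, fun k => ?_⟩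
  have h := (hc.comp (fun p : Σ j, Λ (f j) => p.1)).mul (fun p : Σ j, Λ (f j) => hwt p.1) (hG.2 k)
    fun p => weightAt_nonneg _ _ _
  exact h.mono fun p => (weightAt_smul _ _ _ _).le

variable [∀ n x, NeZero (q n x)]

lemma iteratedDeriv_fun_smul_complex {E : Type*} [NormedAddCommGroup E] [NormedSpace ℂ E] (m : ℕ)
    (c : ℂ) (F : ℝ → E) (g : ℝ) :
    iteratedDeriv m (fun g => c • F g) g = c • iteratedDeriv m F g :=
  iteratedDeriv_fun_const_smul_field c F

/-- A Schrödinger evolution along a smooth local path turns almost local operators into smooth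
paths of almost local operators. -/
theorem DerivAlmostLocal.schrodinger (hΛ : UniformPolynomialGrowth Λ) (hwt : ∀ j, 1 ≤ wt j)
    {G : ∀ j, ℝ → Finset (Λ (f j)) → Operator (q (f j))}
    (hG : IsSmoothLocalSum f (fun p => wt p.1) G) (hsa : ∀ j t Z, IsSelfAdjoint (G j t Z))
    {U : ∀ j, ℝ → Operator (q (f j))} (hU : ∀ j, IsPropagator (fun t => ∑ Z, G j t Z) (U j))
    {A : ∀ j, Operator (q (f j))} (hA : AlmostLocal f u wt A) :
    (∀ j, ContDiff ℝ ∞ fun g => U j g * A j * star (U j g)) ∧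
    ∀ m, DerivAlmostLocal f u (fun p => wt p.1 * (1 + |p.2|)) m
      fun j g => U j g * A j * star (U j g) := by
  have hsas : ∀ j t, IsSelfAdjoint (∑ Z, G j t Z) := fun j t =>
    isSelfAdjoint_sum _ fun Z _ => hsa j t Z
  have hUs : ∀ j, ContDiff ℝ ∞ (U j) := fun j =>
    contDiff_of_hasDerivAt_mul (hG.contDiff_sum j) (hU j).2
  have hsm : ∀ j, ContDiff ℝ ∞ fun g => U j g * A j * star (U j g) := fun j =>
    ((hUs j).mul contDiff_const).mul
      ((starL' ℝ : Operator (q (f j)) ≃L[ℝ] _).contDiff.comp (hUs j))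
  refine ⟨hsm, ?_⟩
  have hw : ∀ p : J × ℝ, 1 ≤ wt p.1 * (1 + |p.2|) := fun p =>
    one_le_mul_of_one_le_of_one_le (hwt p.1) (by linarith [abs_nonneg p.2])
  have hle : ∀ p : J × ℝ, wt p.1 ≤ wt p.1 * (1 + |p.2|) := fun p =>
    le_mul_of_one_le_right (by linarith [hwt p.1]) (by linarith [abs_nonneg p.2])
  have habs : ∀ p : J × ℝ, |p.2| ≤ wt p.1 * (1 + |p.2|) := fun p => by
    nlinarith [hwt p.1, abs_nonneg p.2]
  have hwt0 : ∀ j, 0 ≤ wt j := fun j => zero_le_one.trans (hwt j)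
  have hGw : IsSmoothLocalSum f (fun p => wt p.1 * (1 + |p.2|)) G :=
    hG.trans (fun p => hwt0 p.1) (Tempered.self.mono hle)
  have hder : ∀ j g, HasDerivAt (fun g => U j g * A j * star (U j g))
      ((-Complex.I) • _root_.opComm (∑ Z, G j g Z) (U j g * A j * star (U j g))) g := fun j g => by
    exact (hU j).hasDerivAt_schrodinger (hsas j) (A j) g
  intro m
  induction m using Nat.strong_induction_on with
  | _ m ih =>
  cases m with
  | zero =>
    -- `star (U s)` is the propagator of the evolution that runs backwards from time `s` to time `0`,
    -- with that time rescaled to a unit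
    have hle' : Tempered (fun p : J × ℝ => wt p.1 * (1 + |p.2|)) fun p => wt p.1 :=
      Tempered.self.mono hle
    have habs' : Tempered (fun p : J × ℝ => wt p.1 * (1 + |p.2|)) fun p => |(-p.2)| :=
      Tempered.self.mono fun p => by rw [abs_neg]; exact habs p
    have h0 : IsLocalSum (fun p : (J × ℝ) × ℝ => f p.1.1) (fun p => wt p.1.1 * (1 + |p.1.2|))
        fun p Z => G p.1.1 (p.1.2 * (1 - p.2)) Z :=
      (hG.isLocalSum_self.comp fun p : (J × ℝ) × ℝ => (p.1.1, p.1.2 * (1 - p.2))).trans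
        (fun p => hwt0 p.1.1) (hle'.comp Prod.fst)
    have h1 := h0.smul (fun p => hw p.1) (habs'.comp Prod.fst)
    have hA' : AlmostLocal (J := J × ℝ) (fun p => f p.1) (fun p => u p.1)
        (fun p => wt p.1 * (1 + |p.2|)) fun p => A p.1 :=
      (hA.comp Prod.fst).trans (fun p => hwt0 p.1) hle'
    have hP : ∀ p : J × ℝ, IsPropagator (fun x => ∑ Z, (-p.2) • G p.1 (p.2 * (1 - x)) Z)
        fun x => U p.1 (p.2 * (1 - x)) * star (U p.1 p.2) := fun p => by
      have h := (hU p.1).reverse (hsas p.1) p.2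
      simp only [Finset.smul_sum] at h
      exact h
    have h2 := AlmostLocal.heisenberg (J := J × ℝ) hΛ hw
      (G := fun p x Z => (-p.2) • G p.1 (p.2 * (1 - x)) Z) (fun p Z => (((hG.contDiff p.1 Z).continuous).comp
        (by fun_prop : Continuous fun x : ℝ => p.2 * (1 - x))).const_smul (-p.2))
      (fun p t Z => (IsSelfAdjoint.all _).smul (hsa _ _ _)) h1 hP hA'
    have hz : ∀ p : J × ℝ, star (U p.1 (p.2 * (1 - 1)) * star (U p.1 p.2)) * A p.1 *
        (U p.1 (p.2 * (1 - 1)) * star (U p.1 p.2)) = U p.1 p.2 * A p.1 * star (U p.1 p.2) :=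
      fun p => by rw [sub_self, mul_zero, (hU p.1).1, one_mul, star_star]
    unfold DerivAlmostLocal
    simp only [iteratedDeriv_zero]
    exact (funext hz) ▸ h2
  | succ m =>
    have h1 := DerivAlmostLocal.opComm hΛ hw m hGw hsm fun i hi => ih i (by omega)
    have h2 := AlmostLocal.const_smul (J := J × ℝ) (f := fun p => f p.1) (u := fun p => u p.1)
      hw h1 (-Complex.I)
    unfold DerivAlmostLocal
    have hd : ∀ j, deriv (fun g => U j g * A j * star (U j g)) = fun g =>
      (-Complex.I) • _root_.opComm (∑ Z, G j g Z) (U j g * A j * star (U j g)) := fun j =>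
      funext fun g => (hder j g).deriv
    simp only [iteratedDeriv_succ', hd, iteratedDeriv_fun_smul_complex]
    exact h2

set_option maxHeartbeats 2000000 in
/-- The Heisenberg evolution over an arbitrary time `s` of a smooth path of almost local operators,
under a smooth path of local Hamiltonians: all derivatives along the path are almost local, with
constants that grow like a power of `s`. -/
theorem DerivAlmostLocal.heisenberg (hΛ : UniformPolynomialGrowth Λ) (hwt : ∀ j, 1 ≤ wt j)
    {G : ∀ j, ℝ → Finset (Λ (f j)) → Operator (q (f j))}
    (hG : IsSmoothLocalSum f (fun p => wt p.1) G) (hsa : ∀ j t Z, IsSelfAdjoint (G j t Z))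
    {A : ∀ j, ℝ → Operator (q (f j))} (hAc : ∀ j, ContDiff ℝ ∞ (A j))
    (hA : ∀ m, DerivAlmostLocal f u (fun p => wt p.1) m A) (m : ℕ) :
    DerivAlmostLocal (J := J × ℝ) (fun p => f p.1) (fun p => u p.1)
      (fun p => wt p.1.1 * (1 + |p.1.2|)) m fun p g =>
        star (expU (∑ Z, G p.1 g Z) p.2) * A p.1 g * expU (∑ Z, G p.1 g Z) p.2 := by
  let F : ∀ j, ℝ × ℝ → Operator (q (f j)) := fun j p =>
    star (expU (∑ Z, G j p.2 Z) p.1) * A j p.2 * expU (∑ Z, G j p.2 Z) p.1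
  have hsas : ∀ j t, IsSelfAdjoint (∑ Z, G j t Z) := fun j t =>
    isSelfAdjoint_sum _ fun Z _ => hsa j t Z
  have hF : ∀ j, ContDiff ℝ ∞ (F j) := fun j => by
    have h := contDiff_expU ((hG.contDiff_sum j).comp contDiff_snd) (contDiff_fst (E := ℝ) (F := ℝ))
    exact (((starL' ℝ : Operator (q (f j)) ≃L[ℝ] _).contDiff.comp h).mul
      ((hAc j).comp contDiff_snd)).mul h
  have hFg : ∀ j s, ContDiff ℝ ∞ fun g => F j (s, g) := fun j s =>
    (hF j).comp (contDiff_const.prodMk contDiff_id)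
  have hFs : ∀ j s g, deriv (fun s => F j (s, g)) s =
      Complex.I • _root_.opComm (∑ Z, G j g Z) (F j (s, g)) := fun j s g => by
    have hP := isPropagator_expU (∑ Z, G j g Z)
    have hu := hP.mem_unitary (fun _ => hsas j g) s
    have hcomm : star (expU (∑ Z, G j g Z) s) * (∑ Z, G j g Z) * expU (∑ Z, G j g Z) s =
        ∑ Z, G j g Z := by
      rw [mul_assoc, ← hP.commute (fun _ => hsas j g) (fun _ => rfl), ← mul_assoc,
        Unitary.star_mul_self_of_mem hu, one_mul]
    refine ((hP.hasDerivAt_heisenberg (fun _ => hsas j g) (hasDerivAt_const s (A j g))).congr_deriv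
      ?_).deriv
    rw [zero_add, mul_smul_comm, smul_mul_assoc, star_mul_opComm_mul hu, hcomm]
  have hwt0 : ∀ j, 0 ≤ wt j := fun j => zero_le_one.trans (hwt j)
  have hw : ∀ p : J × ℝ, 1 ≤ wt p.1 * (1 + |p.2|) := fun p =>
    one_le_mul_of_one_le_of_one_le (hwt p.1) (by linarith [abs_nonneg p.2])
  have hle : ∀ p : J × ℝ, wt p.1 ≤ wt p.1 * (1 + |p.2|) := fun p =>
    le_mul_of_one_le_right (by linarith [hwt p.1]) (by linarith [abs_nonneg p.2])
  have habs : ∀ p : J × ℝ, |p.2| ≤ wt p.1 * (1 + |p.2|) := fun p => by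
    nlinarith [hwt p.1, abs_nonneg p.2]
  have hG' : IsSmoothLocalSum (J := J × ℝ) (fun p => f p.1) (fun p => wt p.1.1 * (1 + |p.1.2|))
      fun p => G p.1 :=
    (hG.comp Prod.fst).trans (fun p => hwt0 _) (Tempered.self.mono fun p => hle p.1)
  induction m using Nat.strong_induction_on with
  | _ m ih =>
  -- the inhomogeneity in the equation of motion of the `m`-th derivative
  let S : ∀ j, ℝ × ℝ → Operator (q (f j)) := fun j p =>
    iteratedDeriv m (fun g => _root_.opComm (∑ Z, G j g Z) (F j (p.1, g))) p.2 -
      _root_.opComm (∑ Z, G j p.2 Z) (iteratedDeriv m (fun g => F j (p.1, g)) p.2)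
  have hS : AlmostLocal (J := (J × ℝ) × ℝ) (fun p => f p.1.1) (fun p => u p.1.1)
      (fun p => wt p.1.1 * (1 + |p.1.2|)) fun p => S p.1.1 (p.1.2, p.2) :=
    DerivAlmostLocal.opComm_sub (J := J × ℝ) (f := fun p => f p.1) (u := fun p => u p.1)
      (w := fun p => wt p.1.1 * (1 + |p.1.2|)) hΛ (fun p => hw p.1) m hG'
      (A := fun p g => F p.1 (p.2, g)) (fun p => hFg p.1 p.2) ih
  have hSc : ∀ j, Continuous (S j) := fun j => by
    have h1 : ContDiff ℝ ∞ fun p : ℝ × ℝ => _root_.opComm (∑ Z, G j p.2 Z) (F j p) :=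
      ((hG.contDiff_sum j).comp contDiff_snd).opComm (hF j)
    exact ((contDiff_iteratedDeriv_snd m h1).sub (((hG.contDiff_sum j).comp contDiff_snd).opComm
      (contDiff_iteratedDeriv_snd m (hF j)))).continuous
  have hy : ∀ j s g, HasDerivAt (fun s => iteratedDeriv m (fun g => F j (s, g)) g)
      (Complex.I • _root_.opComm (∑ Z, G j g Z) (iteratedDeriv m (fun g => F j (s, g)) g) +
        Complex.I • S j (s, g)) s := fun j s g => by
    refine (hasDerivAt_iteratedDeriv_snd m (hF j) s g).congr_deriv ?_
    simp only [hFs, iteratedDeriv_fun_smul_complex, S]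
    rw [← smul_add, add_sub_cancel]
  -- Duhamel's formula for that equation, with time rescaled to the unit interval
  have hduh : ∀ j s g, iteratedDeriv m (fun g => F j (s, g)) g =
      star (expU (∑ Z, G j g Z) s) * iteratedDeriv m (A j) g * expU (∑ Z, G j g Z) s +
      Complex.I • s • ∫ v, (Set.Ioc (0 : ℝ) 1).indicator (fun _ => (1 : ℝ)) v •
        (star (expU (∑ Z, G j g Z) (s * (1 - v))) * S j (s * v, g) *
          expU (∑ Z, G j g Z) (s * (1 - v))) := by
    intro j s g
    set H := ∑ Z, G j g Z with hH
    have hHs : IsSelfAdjoint H := hsas j g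
    let y : ℝ → Operator (q (f j)) := fun s => iteratedDeriv m (fun g => F j (s, g)) g
    let z : ℝ → Operator (q (f j)) := fun v =>
      star (expU H (s * (1 - v))) * y (s * v) * expU H (s * (1 - v))
    let z' : ℝ → Operator (q (f j)) := fun v =>
      Complex.I • s • (star (expU H (s * (1 - v))) * S j (s * v, g) * expU H (s * (1 - v)))
    have hexpc : Continuous fun v : ℝ => expU H (s * (1 - v)) :=
      (isPropagator_expU H).continuous.comp (by fun_prop)
    have hz'c : Continuous z' :=
      (((hexpc.star.mul ((hSc j).comp (by fun_prop))).mul hexpc).const_smul s).const_smul Complex.I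
    have hz : ∀ v, HasDerivAt z (z' v) v := fun v => by
      have hP : IsPropagator (fun _ => (-s) • H) (fun v => expU H (-s * v)) := by
        have := isPropagator_expU ((-s) • H)
        simpa only [← expU_smul] using this
      have hys : HasDerivAt (fun v => y (s * v))
          (s • (Complex.I • _root_.opComm H (y (s * v)) + Complex.I • S j (s * v, g))) v := by
        have h1 : HasDerivAt (fun v : ℝ => s * v) s v := by
          simpa using (hasDerivAt_id v).const_mul s
        exact (hy j (s * v) g).scomp v h1
      have h2 := hP.hasDerivAt_heisenberg (fun _ => (IsSelfAdjoint.all _).smul hHs) hys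
      have h3 := (h2.const_mul (star (expU H s))).mul_const (expU H s)
      have hexp : ∀ v, expU H (s * (1 - v)) = expU H (-s * v) * expU H s := fun v => by
        rw [← expU_add]; congr 1; ring
      have h4 : s • (Complex.I • _root_.opComm H (y (s * v)) + Complex.I • S j (s * v, g)) +
          Complex.I • _root_.opComm ((-s) • H) (y (s * v)) = Complex.I • s • S j (s * v, g) := by
        have : _root_.opComm ((-s) • H) (y (s * v)) = (-s) • _root_.opComm H (y (s * v)) := by
          exact opComm_real_smul_left _ _ _
        rw [this, smul_add, smul_comm s Complex.I, smul_comm s Complex.I, neg_smul, smul_neg]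
        abel
      rw [h4] at h3
      refine (h3.congr_deriv ?_).congr_of_eventuallyEq (Filter.Eventually.of_forall fun v => ?_)
      · simp only [z', hexp, star_mul, mul_smul_comm, smul_mul_assoc, mul_assoc]
      · simp only [z, hexp, star_mul, mul_assoc]
    have hint := intervalIntegral.integral_eq_sub_of_hasDerivAt (a := 0) (b := 1)
      (fun v _ => hz v) (hz'c.intervalIntegrable _ _)
    have hz1 : z 1 = y s := by simp [z, expU_zero]
    have hz0 : z 0 = star (expU H s) * iteratedDeriv m (A j) g * expU H s := by
      simp [z, y, F, expU_zero]
    rw [hz1, hz0, intervalIntegral.integral_of_le zero_le_one] at hint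
    change y s = _
    rw [eq_add_of_sub_eq' hint.symm]
    congr 1
    simp only [z']
    rw [integral_smul, integral_smul, ← integral_indicator measurableSet_Ioc]
    congr 3
    funext v
    by_cases hv : v ∈ Set.Ioc (0 : ℝ) 1 <;> simp [hv]
  have hLG : IsLocalSum (fun p : (J × ℝ) × ℝ => f p.1.1) (fun p => wt p.1.1 * (1 + |p.1.2|))
      fun p => G p.1.1 p.2 := hG'.isLocalSum_self
  have hexpP : ∀ (j : J) (s g : ℝ), IsPropagator (fun _ => ∑ Z, s • G j g Z)
      fun x => expU (∑ Z, G j g Z) (s * x) := fun j s g => by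
    have := isPropagator_expU (s • ∑ Z, G j g Z)
    simpa only [← expU_smul, Finset.smul_sum] using this
  -- the homogeneous part
  have h1 : AlmostLocal (J := (J × ℝ) × ℝ) (fun p => f p.1.1) (fun p => u p.1.1)
      (fun p => wt p.1.1 * (1 + |p.1.2|)) fun p =>
        star (expU (∑ Z, G p.1.1 p.2 Z) p.1.2) * iteratedDeriv m (A p.1.1) p.2 *
          expU (∑ Z, G p.1.1 p.2 Z) p.1.2 := by
    have h := AlmostLocal.heisenberg (J := (J × ℝ) × ℝ) (f := fun p => f p.1.1)
      (u := fun p => u p.1.1) hΛ (fun p => hw p.1) (G := fun p _ Z => p.1.2 • G p.1.1 p.2 Z)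
      (fun p Z => continuous_const) (fun p t Z => (IsSelfAdjoint.all _).smul (hsa _ _ _))
      ((hLG.smul (fun p => hw p.1) (Tempered.self.mono fun p => habs p.1)).comp Prod.fst)
      (fun p => hexpP p.1.1 p.1.2 p.2) (A := fun p => iteratedDeriv m (A p.1.1) p.2)
      (((hA m).comp fun p : (J × ℝ) × ℝ => (p.1.1, p.2)).trans (fun p => hwt0 _)
        (Tempered.self.mono fun p => hle p.1))
    simpa only [mul_one] using h
  -- the integral over the inhomogeneity
  have h2 : AlmostLocal (J := (J × ℝ) × ℝ) (fun p => f p.1.1) (fun p => u p.1.1)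
      (fun p => wt p.1.1 * (1 + |p.1.2|)) fun p =>
        ∫ v, (Set.Ioc (0 : ℝ) 1).indicator (fun _ => (1 : ℝ)) v •
        (star (expU (∑ Z, G p.1.1 p.2 Z) (p.1.2 * (1 - v))) * S p.1.1 (p.1.2 * v, p.2) *
          expU (∑ Z, G p.1.1 p.2 Z) (p.1.2 * (1 - v))) := by
    have hw3 : ∀ p : ((J × ℝ) × ℝ) × ℝ, 1 ≤ wt p.1.1.1 * (1 + |p.1.1.2|) * (1 + |p.2|) := fun p =>
      one_le_mul_of_one_le_of_one_le (hw p.1.1) (by linarith [abs_nonneg p.2])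
    have hle3 : ∀ p : ((J × ℝ) × ℝ) × ℝ, wt p.1.1.1 * (1 + |p.1.1.2|) ≤
        wt p.1.1.1 * (1 + |p.1.1.2|) * (1 + |p.2|) := fun p =>
      le_mul_of_one_le_right (by linarith [hw p.1.1]) (by linarith [abs_nonneg p.2])
    have hb1 : ∀ p : ((J × ℝ) × ℝ) × ℝ, wt p.1.1.1 * (1 + |p.1.1.2 * p.2|) ≤
        wt p.1.1.1 * (1 + |p.1.1.2|) * (1 + |p.2|) := fun p => by
      rw [abs_mul, mul_assoc]
      refine mul_le_mul_of_nonneg_left ?_ (hwt0 _)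
      nlinarith [abs_nonneg p.1.1.2, abs_nonneg p.2]
    have hb2 : ∀ p : ((J × ℝ) × ℝ) × ℝ, |p.1.1.2 * (1 - p.2)| ≤
        wt p.1.1.1 * (1 + |p.1.1.2|) * (1 + |p.2|) := fun p => by
      rw [abs_mul]
      have h3 : |1 - p.2| ≤ 1 + |p.2| := by simpa using abs_sub (1 : ℝ) p.2
      have h4 := habs p.1.1
      gcongr
      exact zero_le_one.trans (hw p.1.1)
    refine AlmostLocal.integral (J := (J × ℝ) × ℝ) (v := fun v => 1 + |v|) (fun p => hw p.1)
      (fun v => by linarith [abs_nonneg v]) (fun a => ?_) (fun p => ?_) ?_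
    · have h3 : (fun v : ℝ => (Set.Ioc (0 : ℝ) 1).indicator (fun _ => (1 : ℝ)) v * (1 + |v|) ^ a) =
          (Set.Ioc (0 : ℝ) 1).indicator fun v => (1 + |v|) ^ a := by
        funext v
        by_cases hv : v ∈ Set.Ioc (0 : ℝ) 1 <;> simp [hv]
      rw [h3, integrable_indicator_iff measurableSet_Ioc]
      exact ((by fun_prop : Continuous fun v : ℝ => (1 + |v|) ^ a).integrableOn_Icc).mono_set
        Set.Ioc_subset_Icc_self
    · have hexpc : Continuous fun v : ℝ => expU (∑ Z, G p.1.1 p.2 Z) (p.1.2 * (1 - v)) :=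
        (isPropagator_expU _).continuous.comp (by fun_prop)
      exact ((hexpc.star.mul ((hSc p.1.1).comp (by fun_prop))).mul hexpc).aestronglyMeasurable
    · have h := AlmostLocal.heisenberg (J := ((J × ℝ) × ℝ) × ℝ) (f := fun p => f p.1.1.1)
        (u := fun p => u p.1.1.1) hΛ hw3
        (G := fun p _ Z => (p.1.1.2 * (1 - p.2)) • G p.1.1.1 p.1.2 Z)
        (fun p Z => continuous_const) (fun p t Z => (IsSelfAdjoint.all _).smul (hsa _ _ _))
        ((((hLG.comp Prod.fst).trans (fun p => zero_le_one.trans (hw p.1.1))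
          (Tempered.self.mono hle3)).smul hw3 (Tempered.self.mono hb2)).comp Prod.fst)
        (fun p => hexpP p.1.1.1 (p.1.1.2 * (1 - p.2)) p.1.2)
        (A := fun p => S p.1.1.1 (p.1.1.2 * p.2, p.1.2))
        ((hS.comp fun p : ((J × ℝ) × ℝ) × ℝ => ((p.1.1.1, p.1.1.2 * p.2), p.1.2)).trans
          (fun p => zero_le_one.trans (hw (p.1.1.1, p.1.1.2 * p.2))) (Tempered.self.mono hb1))
      simpa only [mul_one] using h
  have h3 := h2.smul (fun p => hw p.1) (c := fun p : (J × ℝ) × ℝ => (p.1.2 : ℂ))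
    (Tempered.self.mono fun p => by rw [Complex.norm_real]; exact habs p.1)
  have h4 := h1.add (fun p : (J × ℝ) × ℝ => hw p.1)
    (h3.const_smul (fun p : (J × ℝ) × ℝ => hw p.1) Complex.I)
  unfold DerivAlmostLocal
  refine Eq.mp ?_ h4
  congr 1
  funext p
  rw [Complex.coe_smul]
  exact (hduh p.1.1 p.1.2 p.2).symm

end Evolution

section Conversions

/-! ### Iterated derivatives -/

lemma ContDiff.iteratedDeriv_clm {E F : Type*} [NormedAddCommGroup E] [NormedSpace ℝ E]
    [NormedAddCommGroup F] [NormedSpace ℝ F] (L : E →L[ℝ] F) (m : ℕ) :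
    ∀ {f : ℝ → E}, ContDiff ℝ ∞ f → ∀ g,
      iteratedDeriv m (fun t => L (f t)) g = L (iteratedDeriv m f g) := by
  induction m with
  | zero => intro f _ g; simp
  | succ m ih =>
    intro f hf g
    have h := contDiff_infty_iff_deriv.1 hf
    have hd : deriv (fun t => L (f t)) = fun t => L (deriv f t) := funext fun t =>
      (L.hasFDerivAt.comp_hasDerivAt t (h.1 t).hasDerivAt).deriv
    rw [iteratedDeriv_succ', hd, ih h.2, iteratedDeriv_succ']

lemma iteratedDeriv_finset_sum {E α : Type*} [NormedAddCommGroup E] [NormedSpace ℝ E]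
    {f : α → ℝ → E} (hf : ∀ i, ContDiff ℝ ∞ (f i)) (s : Finset α) (m : ℕ) (g : ℝ) :
    iteratedDeriv m (fun t => ∑ i ∈ s, f i t) g = ∑ i ∈ s, iteratedDeriv m (f i) g := by
  classical
  induction s using Finset.induction_on with
  | empty => simp
  | insert a s ha ih =>
    simp only [Finset.sum_insert ha]
    rw [iteratedDeriv_fun_add ((hf a).of_le (by exact_mod_cast le_top)).contDiffAt
      ((ContDiff.sum fun i _ => hf i).of_le (by exact_mod_cast le_top)).contDiffAt, ih]

/-- A smooth function all of whose derivatives are bounded. -/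
def BddSmooth (φ : ℝ → ℝ) : Prop :=
  ContDiff ℝ ∞ φ ∧ ∀ m, ∃ C : ℝ, ∀ x, |iteratedDeriv m φ x| ≤ C

lemma BddSmooth.deriv {φ : ℝ → ℝ} (hφ : BddSmooth φ) : BddSmooth (deriv φ) :=
  ⟨(contDiff_infty_iff_deriv.1 hφ.1).2, fun m => by
    simpa only [← iteratedDeriv_succ'] using hφ.2 (m + 1)⟩

lemma BddSmooth.mul {φ ψ : ℝ → ℝ} (hφ : BddSmooth φ) (hψ : BddSmooth ψ) :
    BddSmooth fun x => φ x * ψ x := by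
  refine ⟨hφ.1.mul hψ.1, fun m => ?_⟩
  induction m generalizing φ ψ with
  | zero =>
    obtain ⟨C, hC⟩ := hφ.2 0
    obtain ⟨C', hC'⟩ := hψ.2 0
    refine ⟨C * C', fun x => ?_⟩
    simp only [iteratedDeriv_zero] at hC hC' ⊢
    rw [abs_mul]
    exact mul_le_mul (hC x) (hC' x) (abs_nonneg _) ((abs_nonneg _).trans (hC x))
  | succ m ih =>
    obtain ⟨C, hC⟩ := ih hφ.deriv hψ
    obtain ⟨C', hC'⟩ := ih hφ hψ.deriv
    refine ⟨C + C', fun x => ?_⟩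
    have h1 := contDiff_infty_iff_deriv.1 hφ.1
    have h2 := contDiff_infty_iff_deriv.1 hψ.1
    have hd : _root_.deriv (fun x => φ x * ψ x) =
        fun x => _root_.deriv φ x * ψ x + φ x * _root_.deriv ψ x :=
      funext fun x => ((h1.1 x).hasDerivAt.mul (h2.1 x).hasDerivAt).deriv
    rw [iteratedDeriv_succ', hd, iteratedDeriv_fun_add
      ((h1.2.mul hψ.1).of_le (by exact_mod_cast le_top)).contDiffAt
      ((hφ.1.mul h2.2).of_le (by exact_mod_cast le_top)).contDiffAt]
    exact (abs_add_le _ _).trans (add_le_add (hC x) (hC' x))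

lemma bddSmooth_one : BddSmooth fun _ => 1 :=
  ⟨contDiff_const, fun m => ⟨1, fun x => by rw [iteratedDeriv_const]; split_ifs <;> simp⟩⟩

lemma bddSmooth_smoothTransition : BddSmooth Real.smoothTransition := by
  have hs : ContDiff ℝ ∞ Real.smoothTransition := Real.smoothTransition.contDiff
  refine ⟨hs, fun m => ?_⟩
  obtain ⟨C, hC⟩ := isCompact_Icc.exists_bound_of_continuousOn (s := Set.Icc (0 : ℝ) 1)
    (hs.continuous_iteratedDeriv m (by exact_mod_cast le_top)).continuousOn
  have hc : ∀ (c x : ℝ), |c| ≤ 1 → Real.smoothTransition =ᶠ[nhds x] (fun _ => c) →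
      |iteratedDeriv m Real.smoothTransition x| ≤ 1 := fun c x h1 h => by
    rw [h.iteratedDeriv_eq, iteratedDeriv_const]
    split_ifs <;> simp [h1]
  refine ⟨max C 1, fun x => ?_⟩
  rcases lt_or_ge x 0 with h | h
  · refine (hc 0 x (by simp) ?_).trans (le_max_right _ _)
    filter_upwards [Iio_mem_nhds h] with y hy
    exact Real.smoothTransition.zero_of_nonpos (le_of_lt hy)
  · rcases lt_or_ge 1 x with h1 | h1
    · refine (hc 1 x (by simp) ?_).trans (le_max_right _ _)
      filter_upwards [Ioi_mem_nhds h1] with y hy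
      exact Real.smoothTransition.one_of_one_le (le_of_lt hy)
    · exact (hC x ⟨h, h1⟩).trans (le_max_left _ _)

/-! ### Reparametrized paths -/

variable {ι : Type*} {Λ : ι → Type*} [∀ n, Fintype (Λ n)] [∀ n, DecidableEq (Λ n)]
  [∀ n, MetricSpace (Λ n)] {q : ∀ n, Λ n → ℕ}

lemma weightAt_add_le {V : Type*} [Fintype V] [DecidableEq V] [MetricSpace V] {q : V → ℕ} (k : ℕ)
    (Ψ Ψ' : Finset V → Operator q) (v : V) :
    weightAt k (fun Z => Ψ Z + Ψ' Z) v ≤ weightAt k Ψ v + weightAt k Ψ' v := by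
  rw [weightAt, weightAt, weightAt, ← Finset.sum_add_distrib]
  refine Finset.sum_le_sum fun Z _ => ?_
  have := Metric.diam_nonneg (s := (Z : Set V))
  rw [← add_mul, ← add_mul]
  exact mul_le_mul_of_nonneg_right (mul_le_mul_of_nonneg_right (norm_add_le _ _) (by positivity))
    (by positivity)

lemma hasDerivAt_smul_comp {E : Type*} [NormedAddCommGroup E] [NormedSpace ℝ E] {F : ℝ → E}
    (hF : ContDiffOn ℝ ∞ F (Set.Icc 0 1)) {φ θ : ℝ → ℝ} (hφ : ContDiff ℝ ∞ φ) (hθ : ContDiff ℝ ∞ θ)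
    (hθI : ∀ x, θ x ∈ Set.Icc (0 : ℝ) 1) (g : ℝ) :
    HasDerivAt (fun g => φ g • F (θ g)) (deriv φ g • F (θ g) +
      (φ g * deriv θ g) • derivWithin F (Set.Icc 0 1) (θ g)) g := by
  have h1 := (contDiff_infty_iff_deriv.1 hφ).1 g
  have h2 := (contDiff_infty_iff_deriv.1 hθ).1 g
  have h3 := ((hF.differentiableOn (by simp)) (θ g) (hθI g)).hasDerivWithinAt
  have h4 : HasDerivAt (fun g => F (θ g)) (deriv θ g • derivWithin F (Set.Icc 0 1) (θ g)) g :=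
    h3.scomp_hasDerivAt g h2.hasDerivAt hθI
  refine (h1.hasDerivAt.smul h4).congr_deriv ?_
  rw [add_comm, mul_smul]

lemma exists_weightAt_iteratedDeriv_smul_comp_le {θ : ℝ → ℝ} (hθ : BddSmooth θ)
    (hθI : ∀ x, θ x ∈ Set.Icc (0 : ℝ) 1) (k m : ℕ) :
    ∀ {h : ∀ n, ℝ → Finset (Λ n) → Operator (q n)}
      (_ : ∀ n Z, ContDiffOn ℝ ∞ (fun g => h n g Z) (Set.Icc 0 1))
      (_ : ∀ m : ℕ, ∃ C : ℝ, ∀ (n : ι), ∀ g ∈ Set.Icc (0 : ℝ) 1, ∀ u : Λ n,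
        weightAt k (fun Z => iteratedDerivWithin m (fun s => h n s Z) (Set.Icc 0 1) g) u ≤ C)
      {φ : ℝ → ℝ} (_ : BddSmooth φ),
      ∃ C : ℝ, ∀ n g (u : Λ n),
        weightAt k (fun Z => iteratedDeriv m (fun g => φ g • h n (θ g) Z) g) u ≤ C := by
  induction m with
  | zero =>
    intro h _ hb φ hφ
    obtain ⟨C, hC⟩ := hb 0
    obtain ⟨C', hC'⟩ := hφ.2 0
    refine ⟨C' * C, fun n g u => ?_⟩
    simp only [iteratedDeriv_zero, iteratedDerivWithin_zero] at hC hC' ⊢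
    rw [weightAt_smul]
    exact mul_le_mul (hC' g) (hC n _ (hθI g) u) (weightAt_nonneg _ _ _) ((abs_nonneg _).trans (hC' g))
  | succ m ih =>
    intro h hs hb φ hφ
    have hs' : ∀ n Z, ContDiffOn ℝ ∞ (fun g => derivWithin (fun g => h n g Z) (Set.Icc 0 1) g)
        (Set.Icc 0 1) := fun n Z => (hs n Z).derivWithin uniqueDiffOn_Icc_zero_one (by simp)
    obtain ⟨C, hC⟩ := ih hs hb hφ.deriv
    obtain ⟨C', hC'⟩ := ih (h := fun n g Z => derivWithin (fun g => h n g Z) (Set.Icc 0 1) g) hs'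
      (fun m => by
        obtain ⟨C, hC⟩ := hb (m + 1)
        exact ⟨C, by simpa only [iteratedDerivWithin_succ'] using hC⟩) (hφ.mul hθ.deriv)
    refine ⟨C + C', fun n g u => ?_⟩
    have hc1 : ∀ Z, ContDiff ℝ ∞ fun g => deriv φ g • h n (θ g) Z := fun Z =>
      hφ.deriv.1.smul ((hs n Z).comp_contDiff hθ.1 hθI)
    have hc2 : ∀ Z, ContDiff ℝ ∞ fun g =>
        (φ g * deriv θ g) • derivWithin (fun g => h n g Z) (Set.Icc 0 1) (θ g) := fun Z =>
      (hφ.mul hθ.deriv).1.smul ((hs' n Z).comp_contDiff hθ.1 hθI)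
    have hd : ∀ Z, iteratedDeriv (m + 1) (fun g => φ g • h n (θ g) Z) g =
        iteratedDeriv m (fun g => deriv φ g • h n (θ g) Z) g + iteratedDeriv m (fun g =>
          (φ g * deriv θ g) • derivWithin (fun g => h n g Z) (Set.Icc 0 1) (θ g)) g := fun Z => by
      rw [iteratedDeriv_succ', ← iteratedDeriv_fun_add
        ((hc1 Z).of_le (by exact_mod_cast le_top)).contDiffAt
        ((hc2 Z).of_le (by exact_mod_cast le_top)).contDiffAt]
      congr 1
      funext g
      exact (hasDerivAt_smul_comp (hs n Z) hφ.1 hθ.1 hθI g).deriv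
    simp only [hd]
    exact (weightAt_add_le _ _ _ _).trans (add_le_add (hC n g u) (hC' n g u))

section Support

variable [∀ n x, NeZero (q n x)]

lemma SupportedOn.iteratedDeriv {V : Type*} [Fintype V] [DecidableEq V] {q : V → ℕ}
    [∀ x, NeZero (q x)] {Z : Finset V} {A : ℝ → Operator q} (hA : ContDiff ℝ ∞ A)
    (h : ∀ g, SupportedOn Z (A g)) (m : ℕ) (g : ℝ) : SupportedOn Z (iteratedDeriv m A g) := by
  have h1 := hA.iteratedDeriv_clm ((cutL Z).restrictScalars ℝ) m g
  have h2 : (fun t => (cutL Z).restrictScalars ℝ (A t)) = A := funext fun t => cut_eq_self (h t)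
  rw [h2] at h1
  rw [h1]
  exact supportedOn_cut _ _

/-- A smooth local path, reparametrized so as to be defined on the whole real line. -/
theorem IsSmoothLocalPath.isSmoothLocalSum {h : ∀ n, ℝ → Finset (Λ n) → Operator (q n)}
    (hh : IsSmoothLocalPath h) {θ φ : ℝ → ℝ} (hθ : BddSmooth θ)
    (hθI : ∀ x, θ x ∈ Set.Icc (0 : ℝ) 1) (hφ : BddSmooth φ) :
    IsSmoothLocalSum (fun n => n) (fun _ => 1) fun n g Z => φ g • h n (θ g) Z where
  contDiff n Z := hφ.1.smul ((hh.2.1 n Z).comp_contDiff hθ.1 hθI)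
  isLocalSum m := by
    refine ⟨fun p Z => SupportedOn.iteratedDeriv
      (hφ.1.smul ((hh.2.1 p.1 Z).comp_contDiff hθ.1 hθI))
      (fun g => (hh.1 p.1 _ (hθI g) Z).2.real_smul _) m p.2, fun k => ?_⟩
    obtain ⟨C, hC⟩ := exists_weightAt_iteratedDeriv_smul_comp_le hθ hθI k m hh.2.1 (hh.2.2 k) hφ
    exact (Tempered.const C).mono fun p => hC _ _ _

end Support

/-! ### From local sums to almost local terms at the sites -/

/-- The part of `∑_Z G_Z` that is attributed to the site `u`: each term is distributed evenly over
the sites of its region. -/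
noncomputable def siteTerm {V : Type*} [Fintype V] [DecidableEq V] {q : V → ℕ}
    (G : Finset V → Operator q) (u : V) : Operator q :=
  ∑ Z with u ∈ Z, ((Z.card : ℝ)⁻¹) • G Z

lemma sum_siteTerm {V : Type*} [Fintype V] [DecidableEq V] {q : V → ℕ}
    (G : Finset V → Operator q) : ∑ u, siteTerm G u + G ∅ = ∑ Z, G Z := by
  have h1 : ∑ u, siteTerm G u = ∑ Z ∈ Finset.univ.erase ∅, G Z := by
    simp only [siteTerm, Finset.sum_filter]
    rw [Finset.sum_comm, ← Finset.sum_erase (a := ∅) _ (by simp)]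
    refine Finset.sum_congr rfl fun Z hZ => ?_
    have h0 : (Z.card : ℝ) ≠ 0 := by
      simpa using (Finset.mem_erase.1 hZ).1
    rw [← Finset.sum_filter, Finset.sum_const, Finset.filter_mem_eq_inter, Finset.univ_inter,
      ← Nat.cast_smul_eq_nsmul ℝ, smul_smul, mul_inv_cancel₀ h0, one_smul]
  rw [h1, Finset.sum_erase_add _ _ (Finset.mem_univ _)]

lemma isSelfAdjoint_siteTerm {V : Type*} [Fintype V] [DecidableEq V] {q : V → ℕ}
    {G : Finset V → Operator q} (h : ∀ Z, IsSelfAdjoint (G Z)) (u : V) :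
    IsSelfAdjoint (siteTerm G u) :=
  isSelfAdjoint_sum _ fun Z _ => (IsSelfAdjoint.all _).smul (h Z)

lemma norm_inv_card_smul_le {V : Type*} [Fintype V] [DecidableEq V] {q : V → ℕ}
    (Z : Finset V) (A : Operator q) : ‖((Z.card : ℝ)⁻¹) • A‖ ≤ ‖A‖ := by
  rw [norm_smul, Real.norm_of_nonneg (by positivity)]
  refine mul_le_of_le_one_left (norm_nonneg _) ?_
  exact Nat.cast_inv_le_one _

section Site

variable [∀ n x, NeZero (q n x)] {J : Type*} {f : J → ι} {wt : J → ℝ}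

lemma sum_norm_mul_pow_le_weightAt {V : Type*} [Fintype V] [DecidableEq V] [MetricSpace V]
    {q : V → ℕ} (G : Finset V → Operator q) (k : ℕ) (u : V) {s : Finset (Finset V)}
    (hs : ∀ Z ∈ s, u ∈ Z) : ∑ Z ∈ s, ‖G Z‖ * (1 + Metric.diam (Z : Set V)) ^ k ≤ weightAt k G u := by
  have h0 : ∀ Z : Finset V, 0 ≤ Metric.diam (Z : Set V) := fun Z => Metric.diam_nonneg
  calc _ ≤ ∑ Z ∈ s, ‖G Z‖ * Z.card * (1 + Metric.diam (Z : Set V)) ^ k := by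
        refine Finset.sum_le_sum fun Z hZ => ?_
        have h1 : (1 : ℝ) ≤ Z.card := by exact_mod_cast Finset.card_pos.2 ⟨u, hs Z hZ⟩
        have := h0 Z
        exact mul_le_mul_of_nonneg_right (le_mul_of_one_le_right (norm_nonneg _) h1) (by positivity)
    _ ≤ _ := Finset.sum_le_sum_of_subset_of_nonneg (fun Z hZ => by simp [hs Z hZ]) fun Z _ _ => by
        have := h0 Z
        exact mul_nonneg (mul_nonneg (norm_nonneg _) (by positivity)) (by positivity)

/-- A region that contains `u` but is not contained in `ball u r` has a diameter larger than `r`, so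
the decay of the terms in the diameter gives the decay in the distance. -/
theorem IsLocalSum.almostLocal_siteTerm {G : ∀ j, Finset (Λ (f j)) → Operator (q (f j))}
    (hG : IsLocalSum f wt G) :
    AlmostLocal (J := Σ j, Λ (f j)) (fun p => f p.1) (fun p => p.2) (fun p => wt p.1)
      fun p => siteTerm (G p.1) p.2 := by
  refine AlmostLocal.of_approx ((hG.2 0).mono fun p => ?_) fun k => ?_
  · refine (norm_sum_le _ _).trans ((Finset.sum_le_sum fun Z _ => norm_inv_card_smul_le Z _).trans ?_)
    simpa using sum_norm_mul_pow_le_weightAt (G p.1) 0 p.2 (s := {Z | p.2 ∈ Z}) (by simp)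
  · obtain ⟨C, a, hC, hb⟩ := hG.2 k
    refine ⟨C, a, hC, fun p s => ?_⟩
    refine ⟨∑ Z with p.2 ∈ Z ∧ Z ⊆ ball p.2 s, ((Z.card : ℝ)⁻¹) • G p.1 Z,
      SupportedOn.sum fun Z hZ => ((hG.1 p.1 Z).real_smul _).mono (Finset.mem_filter.1 hZ).2.2,
      le_trans ?_ (hb p)⟩
    have h1 : siteTerm (G p.1) p.2 - ∑ Z with p.2 ∈ Z ∧ Z ⊆ ball p.2 s, ((Z.card : ℝ)⁻¹) • G p.1 Z =
        ∑ Z with p.2 ∈ Z ∧ ¬ Z ⊆ ball p.2 s, ((Z.card : ℝ)⁻¹) • G p.1 Z := by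
      rw [siteTerm, ← Finset.filter_filter, ← Finset.filter_filter,
        ← Finset.sum_filter_add_sum_filter_not _ (fun Z => Z ⊆ ball p.2 s), add_sub_cancel_left]
    rw [h1]
    refine (mul_le_mul_of_nonneg_right (norm_sum_le _ _) (by positivity)).trans ?_
    rw [Finset.sum_mul]
    refine le_trans (Finset.sum_le_sum fun Z hZ => ?_)
      (sum_norm_mul_pow_le_weightAt (G p.1) k p.2 (s := {Z | p.2 ∈ Z ∧ ¬ Z ⊆ ball p.2 s})
        (by simp +contextual))
    obtain ⟨hu, hZs⟩ := (Finset.mem_filter.1 hZ).2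
    obtain ⟨y, hy, hys⟩ := Finset.not_subset.1 hZs
    have h2 : (s : ℝ) ≤ Metric.diam (Z : Set (Λ (f p.1))) :=
      (not_le.1 fun h => hys (mem_ball.2 h)).le.trans
        (Metric.dist_le_diam_of_mem Z.finite_toSet.isBounded hy hu)
    refine mul_le_mul (norm_inv_card_smul_le Z _) ?_ (by positivity) (norm_nonneg _)
    gcongr

theorem IsSmoothLocalSum.derivAlmostLocal_siteTerm {w : J × ℝ → ℝ}
    {G : ∀ j, ℝ → Finset (Λ (f j)) → Operator (q (f j))} (hG : IsSmoothLocalSum f w G) (m : ℕ) :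
    DerivAlmostLocal (J := Σ j, Λ (f j)) (fun p => f p.1) (fun p => p.2) (fun p => w (p.1.1, p.2)) m
      fun p g => siteTerm (G p.1 g) p.2 := by
  have h := (hG.isLocalSum m).almostLocal_siteTerm.comp
    fun p : (Σ j, Λ (f j)) × ℝ => (⟨(p.1.1, p.2), p.1.2⟩ : Σ p : J × ℝ, Λ (f p.1))
  have h2 : ∀ (p : Σ j, Λ (f j)) g, iteratedDeriv m (fun g => siteTerm (G p.1 g) p.2) g =
      siteTerm (fun Z => iteratedDeriv m (fun g => G p.1 g Z) g) p.2 := fun p g => by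
    simp only [siteTerm]
    rw [iteratedDeriv_finset_sum fun Z => (hG.contDiff p.1 Z).const_smul _]
    refine Finset.sum_congr rfl fun Z _ => ?_
    exact iteratedDeriv_fun_const_smul_field _ _
  unfold DerivAlmostLocal
  simp only [h2]
  exact h

lemma IsSmoothLocalSum.contDiff_siteTerm {w : J × ℝ → ℝ}
    {G : ∀ j, ℝ → Finset (Λ (f j)) → Operator (q (f j))} (hG : IsSmoothLocalSum f w G)
    (p : Σ j, Λ (f j)) : ContDiff ℝ ∞ fun g => siteTerm (G p.1 g) p.2 :=
  ContDiff.sum fun Z _ => (hG.contDiff p.1 Z).const_smul _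

end Site

/-! ### From almost local terms at the sites to local sums -/

section Interaction

/-- The terms of `∑_u K_u + E`, where each `K_u` is decomposed into shells around `u`. -/
noncomputable def shellSum {V : Type*} [Fintype V] [DecidableEq V] [MetricSpace V] {q : V → ℕ}
    [∀ x, NeZero (q x)] (K : V → Operator q) (Z : Finset V) : Operator q :=
  ∑ u, ∑ r ∈ Finset.range (numShells V), if ball u (r : ℝ) = Z then shell u r (K u) else 0

section Single

variable {V : Type*} [Fintype V] [DecidableEq V] [MetricSpace V] {q : V → ℕ} [∀ x, NeZero (q x)]

lemma sum_shellSum (K : V → Operator q) : ∑ Z, shellSum K Z = ∑ u, K u := by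
  simp only [shellSum]
  rw [Finset.sum_comm]
  refine Finset.sum_congr rfl fun u _ => ?_
  rw [Finset.sum_comm]
  simp [sum_shell_eq]

lemma supportedOn_shellSum (K : V → Operator q) (Z : Finset V) : SupportedOn Z (shellSum K Z) := by
  refine SupportedOn.sum fun u _ => SupportedOn.sum fun r _ => ?_
  split_ifs with h
  · exact h ▸ supportedOn_shell u r (K u)
  · exact supportedOn_zero _

lemma isSelfAdjoint_shellSum {K : V → Operator q} (hK : ∀ u, IsSelfAdjoint (K u)) (Z : Finset V) :
    IsSelfAdjoint (shellSum K Z) := by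
  refine isSelfAdjoint_sum _ fun u _ => isSelfAdjoint_sum _ fun r _ => ?_
  split_ifs
  · rw [IsSelfAdjoint, ← shell_star, (hK u).star_eq]
  · exact IsSelfAdjoint.zero _

/-- `shell u r` as a bounded linear map. -/
noncomputable def shellL (u : V) (r : ℕ) : Operator q →L[ℝ] Operator q :=
  match r with
  | 0 => (cutL (ball u (0 : ℕ))).restrictScalars ℝ
  | r + 1 => (cutL (ball u (r + 1 : ℕ))).restrictScalars ℝ - (cutL (ball u r)).restrictScalars ℝ

lemma shellL_apply (u : V) (r : ℕ) (A : Operator q) : shellL u r A = shell u r A := by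
  cases r <;> rfl

lemma contDiff_shell {A : ℝ → Operator q} (hA : ContDiff ℝ ∞ A) (u : V) (r : ℕ) :
    ContDiff ℝ ∞ fun g => shell u r (A g) := by
  simp only [← shellL_apply]
  exact (shellL u r).contDiff.comp hA

lemma contDiff_shellSum {K : V → ℝ → Operator q} (hK : ∀ u, ContDiff ℝ ∞ (K u)) (Z : Finset V) :
    ContDiff ℝ ∞ fun g => shellSum (fun u => K u g) Z := by
  refine ContDiff.sum fun u _ => ContDiff.sum fun r _ => ?_
  split_ifs
  · exact contDiff_shell (hK u) u r
  · exact contDiff_const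

lemma iteratedDeriv_shellSum {K : V → ℝ → Operator q} (hK : ∀ u, ContDiff ℝ ∞ (K u)) (Z : Finset V)
    (m : ℕ) (g : ℝ) : iteratedDeriv m (fun g => shellSum (fun u => K u g) Z) g =
      shellSum (fun u => iteratedDeriv m (K u) g) Z := by
  have hs : ∀ u (r : ℕ), ContDiff ℝ ∞ fun g =>
      if ball u (r : ℝ) = Z then shell u r (K u g) else 0 := fun u r => by
    split_ifs
    · exact contDiff_shell (hK u) u r
    · exact contDiff_const
  simp only [shellSum]
  rw [iteratedDeriv_finset_sum fun u => ContDiff.sum fun r _ => hs u r]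
  refine Finset.sum_congr rfl fun u _ => ?_
  rw [iteratedDeriv_finset_sum fun r => hs u r]
  refine Finset.sum_congr rfl fun r _ => ?_
  split_ifs
  · simpa only [shellL_apply] using (hK u).iteratedDeriv_clm (shellL u r) m g
  · simp

lemma diam_ball_le (u : V) (r : ℕ) : Metric.diam (ball u (r : ℝ) : Set V) ≤ 2 * r := by
  refine Metric.diam_le_of_forall_dist_le (by positivity) fun x hx y hy => ?_
  have h1 := mem_ball.1 hx
  have h2 := mem_ball.1 hy
  linarith [dist_triangle_right x y u]

lemma weightAt_shellSum_le (K : V → Operator q) (k : ℕ) (v : V) :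
    weightAt k (shellSum K) v ≤ ∑ r ∈ Finset.range (numShells V), ∑ u ∈ ball v (r : ℝ),
      ‖shell u r (K u)‖ * (ball u (r : ℝ)).card * (1 + 2 * r) ^ k := by
  have h0 : ∀ Z : Finset V, 0 ≤ Metric.diam (Z : Set V) := fun Z => Metric.diam_nonneg
  have h1 : ∀ Z : Finset V, ‖shellSum K Z‖ * Z.card * (1 + Metric.diam (Z : Set V)) ^ k ≤
      ∑ u, ∑ r ∈ Finset.range (numShells V), if ball u (r : ℝ) = Z then
        ‖shell u r (K u)‖ * (ball u (r : ℝ)).card * (1 + 2 * r) ^ k else 0 := fun Z => by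
    have h2 : ‖shellSum K Z‖ ≤ ∑ u, ∑ r ∈ Finset.range (numShells V),
        ‖if ball u (r : ℝ) = Z then shell u r (K u) else 0‖ :=
      (norm_sum_le _ _).trans (Finset.sum_le_sum fun u _ => norm_sum_le _ _)
    have := h0 Z
    rw [mul_assoc]
    refine (mul_le_mul_of_nonneg_right h2 (by positivity)).trans ?_
    rw [Finset.sum_mul]
    refine Finset.sum_le_sum fun u _ => ?_
    rw [Finset.sum_mul]
    refine Finset.sum_le_sum fun r _ => ?_
    split_ifs with h
    · rw [mul_assoc, ← h]
      refine mul_le_mul_of_nonneg_left ?_ (norm_nonneg _)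
      refine mul_le_mul_of_nonneg_left ?_ (by positivity)
      exact pow_le_pow_left₀ (by linarith [h0 (ball u (r : ℝ))]) (by linarith [diam_ball_le u r]) _
    · simp
  rw [weightAt]
  refine (Finset.sum_le_sum fun Z _ => h1 Z).trans (le_of_eq ?_)
  rw [Finset.sum_comm, Finset.sum_congr rfl fun u _ => Finset.sum_comm, Finset.sum_comm]
  refine Finset.sum_congr rfl fun r _ => ?_
  have h3 : ball v (r : ℝ) = Finset.univ.filter fun u => v ∈ ball u (r : ℝ) := by
    ext u; simp [mem_ball, dist_comm]
  rw [h3, Finset.sum_filter]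
  refine Finset.sum_congr rfl fun u _ => ?_
  simp [Finset.sum_ite_eq]

end Single

variable [∀ n x, NeZero (q n x)]

/-- A smooth path of sums `∑_u K_u(g) + E` of almost local operators is a smooth path of local
Hamiltonians. -/
theorem exists_isSmoothLocalPath (hΛ : UniformPolynomialGrowth Λ)
    {K : ∀ n, Λ n → ℝ → Operator (q n)} (hc : ∀ n u, ContDiff ℝ ∞ (K n u))
    (hsa : ∀ n u g, IsSelfAdjoint (K n u g))
    (hK : ∀ m, DerivAlmostLocal (J := Σ n, Λ n) (fun p => p.1) (fun p => p.2) (fun p => 1 + |p.2|) m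
      fun p => K p.1 p.2)
    {E : ∀ n, Operator (q n)} (hE : ∀ n, IsSelfAdjoint (E n) ∧ SupportedOn ∅ (E n)) :
    ∃ k : ∀ n, ℝ → Finset (Λ n) → Operator (q n), IsSmoothLocalPath k ∧
      ∀ n g, ∑ Z, k n g Z = ∑ u, K n u g + E n := by
  have hsm : ∀ n Z, ContDiff ℝ ∞ fun g => shellSum (fun u => K n u g) Z := fun n Z =>
    contDiff_shellSum (hc n) Z
  refine ⟨fun n g Z => shellSum (fun u => K n u g) Z + if Z = ∅ then E n else 0,
    ⟨fun n g _ Z => ⟨?_, ?_⟩, fun n Z => ?_, fun k m => ?_⟩, fun n g => ?_⟩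
  · refine (isSelfAdjoint_shellSum (fun u => hsa _ _ _) Z).add ?_
    split_ifs
    · exact (hE n).1
    · exact IsSelfAdjoint.zero _
  · refine (supportedOn_shellSum _ Z).add ?_
    split_ifs with h
    · exact h ▸ (hE n).2
    · exact supportedOn_zero _
  · exact ((hsm n Z).add contDiff_const).contDiffOn
  · obtain ⟨C, D, hC1, hball⟩ := hΛ.exists_card_ball_le
    obtain ⟨C', p, hC', hb⟩ := (hK m).shell (fun p => by linarith [abs_nonneg p.2]) (D + D + k + 2)
    obtain ⟨S, hS0, hS⟩ := exists_sum_inv_sq_le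
    refine ⟨C' * 2 ^ p * C * C * 2 ^ k * S, fun n g hg v => ?_⟩
    have h1 : weightAt k (fun Z => iteratedDerivWithin m (fun s => shellSum (fun u => K n u s) Z +
        if Z = ∅ then E n else 0) (Set.Icc 0 1) g) v =
        weightAt k (shellSum fun u => iteratedDeriv m (K n u) g) v := by
      refine Finset.sum_congr rfl fun Z hZ => ?_
      have hne : Z ≠ ∅ := Finset.ne_empty_of_mem (Finset.mem_filter.1 hZ).2
      simp only [hne, if_false, add_zero]
      rw [iteratedDerivWithin_eq_iteratedDeriv uniqueDiffOn_Icc_zero_one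
        ((hsm n Z).of_le (by exact_mod_cast le_top)).contDiffAt hg,
        iteratedDeriv_shellSum (hc n)]
    rw [h1]
    refine (weightAt_shellSum_le _ _ _).trans ?_
    have h2 : ∀ (r : ℕ) (u : Λ n), ‖shell u r (iteratedDeriv m (K n u) g)‖ *
        (ball u (r : ℝ)).card * (1 + 2 * r) ^ k ≤
        C' * 2 ^ p * C * 2 ^ k / ((1 + r) ^ D * (1 + r) ^ 2) := fun r u => by
      have h3 := hb ((⟨n, u⟩, g), r)
      simp only at h3
      have h4 : (1 + |g|) ^ p ≤ 2 ^ p := by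
        rw [abs_of_nonneg hg.1]; exact pow_le_pow_left₀ (by linarith [hg.1]) (by linarith [hg.2]) _
      have h5 : (1 + 2 * (r : ℝ)) ^ k ≤ 2 ^ k * (1 + r) ^ k := by
        rw [← mul_pow]; gcongr; linarith
      have h6 : 0 ≤ ‖shell u r (iteratedDeriv m (K n u) g)‖ := norm_nonneg _
      generalize ‖shell u r (iteratedDeriv m (K n u) g)‖ = a at h3 h6
      rw [le_div_iff₀ (by positivity)]
      calc a * (ball u (r : ℝ)).card * (1 + 2 * r) ^ k * ((1 + r) ^ D * (1 + r) ^ 2) ≤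
            a * (C * (1 + r) ^ D) * (2 ^ k * (1 + r) ^ k) * ((1 + r) ^ D * (1 + r) ^ 2) := by
              gcongr
              exact hball n u r
        _ = (a * (1 + r) ^ (D + D + k + 2)) * (C * 2 ^ k) := by ring
        _ ≤ (C' * 2 ^ p) * (C * 2 ^ k) := by
              have : C' * (1 + |g|) ^ p ≤ C' * 2 ^ p := by gcongr
              exact mul_le_mul_of_nonneg_right (h3.trans this) (by positivity)
        _ = _ := by ring
    calc _ ≤ ∑ r ∈ Finset.range (numShells (Λ n)), C' * 2 ^ p * C * C * 2 ^ k * (1 / (1 + (r : ℝ)) ^ 2) := by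
          refine Finset.sum_le_sum fun r _ => ?_
          refine (Finset.sum_le_sum fun u _ => h2 r u).trans ?_
          rw [Finset.sum_const, nsmul_eq_mul]
          refine (mul_le_mul_of_nonneg_right (hball n v r) (by positivity)).trans (le_of_eq ?_)
          field_simp
      _ ≤ _ := by
          rw [← Finset.mul_sum]
          gcongr
          exact hS _
  · rw [Finset.sum_add_distrib, sum_shellSum]
    simp

end Interaction

end Conversions

section Forward

/-! ### Expectation values -/

section Expect

variable {E : Type*} [NormedAddCommGroup E] [InnerProductSpace ℂ E]

/-- The matrix element `A ↦ ⟨x| A |y⟩`. -/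
noncomputable def elementL (x y : E) : BoundedOperator E →L[ℂ] ℂ :=
  (innerSL ℂ x).comp (ContinuousLinearMap.apply ℂ E y)

lemma elementL_apply (x y : E) (A : BoundedOperator E) : elementL x y A = inner ℂ x (A y) := rfl

/-- The expectation value `A ↦ ⟨φ| A |φ⟩`. -/
noncomputable def expectL (φ : E) : BoundedOperator E →L[ℂ] ℂ := elementL φ φ

lemma expectL_apply (φ : E) (A : BoundedOperator E) : expectL φ A = inner ℂ φ (A φ) := rfl

lemma norm_expectL_le {φ : E} (hφ : ‖φ‖ = 1) (A : BoundedOperator E) : ‖expectL φ A‖ ≤ ‖A‖ := by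
  rw [expectL_apply]
  refine (norm_inner_le_norm _ _).trans ?_
  simpa [hφ] using A.le_opNorm φ

variable [CompleteSpace E]

lemma inner_map_eq_expectL (U A : BoundedOperator E) (φ : E) :
    inner ℂ (U φ) (A (U φ)) = expectL φ (star U * A * U) := by
  rw [expectL_apply, mul_apply_eq_comp, mul_apply_eq_comp,
    ContinuousLinearMap.star_eq_adjoint, ContinuousLinearMap.adjoint_inner_right]

lemma norm_map_of_mem_unitary {U : BoundedOperator E} (hU : U ∈ unitary (BoundedOperator E))
    (φ : E) : ‖U φ‖ = ‖φ‖ := by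
  have h : inner ℂ (U φ) (U φ) = inner ℂ φ φ := by
    have := inner_map_eq_expectL U 1 φ
    rwa [mul_one, Unitary.star_mul_self_of_mem hU] at this
  rw [@norm_eq_sqrt_re_inner ℂ, h, ← @norm_eq_sqrt_re_inner ℂ]

lemma star_apply_apply_of_mem_unitary {U : BoundedOperator E}
    (hU : U ∈ unitary (BoundedOperator E)) (φ : E) : star U (U φ) = φ := by
  rw [← mul_apply_eq_comp, Unitary.star_mul_self_of_mem hU]; rfl

end Expect

lemma IsGroundStateWithGap.conj {V : Type*} [Fintype V] [DecidableEq V] {q : V → ℕ}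
    {H U : Operator q} {Δ : ℝ} {φ : ManyBody q} (h : IsGroundStateWithGap H Δ φ)
    (hU : U ∈ unitary (Operator q)) : IsGroundStateWithGap (U * H * star U) Δ (U φ) := by
  obtain ⟨h1, E, hE, hgap⟩ := h
  refine ⟨by rw [norm_map_of_mem_unitary hU, h1], E, ?_, fun ψ hψ => ?_⟩
  · rw [mul_apply_eq_comp, mul_apply_eq_comp,
      star_apply_apply_of_mem_unitary hU, hE, map_smul]
  · have h2 := hgap (star U ψ) (by
      rw [ContinuousLinearMap.star_eq_adjoint, ContinuousLinearMap.adjoint_inner_right]; exact hψ)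
    have h3 : inner ℂ ψ ((U * H * star U) ψ) = inner ℂ (star U ψ) (H (star U ψ)) := by
      rw [inner_map_eq_expectL, star_star]; rfl
    rwa [h3, ← norm_map_of_mem_unitary (Unitary.star_mem hU) ψ]

variable {ι : Type*} {Λ : ι → Type*} [∀ n, Fintype (Λ n)] [∀ n, DecidableEq (Λ n)]
  [∀ n, MetricSpace (Λ n)] {q : ∀ n, Λ n → ℕ} [∀ n x, NeZero (q n x)]
  {J : Type*} {f : J → ι} {u : ∀ j, Λ (f j)} {w : J × ℝ → ℝ}

lemma DerivAlmostLocal.const {A : ∀ j, Operator (q (f j))}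
    (hA : AlmostLocal (fun p : J × ℝ => f p.1) (fun p => u p.1) w fun p => A p.1) (m : ℕ) :
    DerivAlmostLocal f u w m fun j _ => A j := by
  unfold DerivAlmostLocal
  simp only [iteratedDeriv_const]
  cases m with
  | zero => simpa using hA
  | succ m => simpa using AlmostLocal.zero

/-- The expectation values of almost local operators are smooth along the evolution of a state by
a smooth local path. -/
theorem tempered_iteratedDeriv_expectL (hΛ : UniformPolynomialGrowth Λ) (hw : ∀ p, 1 ≤ w p)
    {G : ∀ j, ℝ → Finset (Λ (f j)) → Operator (q (f j))} (hG : IsSmoothLocalSum f w G)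
    (hsa : ∀ j t Z, IsSelfAdjoint (G j t Z))
    {U : ∀ j, ℝ → Operator (q (f j))} (hU : ∀ j, IsPropagator (fun t => ∑ Z, G j t Z) (U j))
    {φ : ∀ j, ManyBody (q (f j))} (hφ : ∀ j, ‖φ j‖ = 1) (m : ℕ) :
    ∀ {A : ∀ j, ℝ → Operator (q (f j))} (_ : ∀ j, ContDiff ℝ ∞ (A j))
      (_ : ∀ i, DerivAlmostLocal f u w i A),
      Tempered w fun p => ‖iteratedDeriv m
        (fun g => expectL (φ p.1) (star (U p.1 g) * A p.1 g * U p.1 g)) p.2‖ := by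
  have hsas : ∀ j t, IsSelfAdjoint (∑ Z, G j t Z) := fun j t =>
    isSelfAdjoint_sum _ fun Z _ => hsa j t Z
  induction m with
  | zero =>
    intro A _ hA
    have h := (hA 0).1
    simp only [iteratedDeriv_zero] at h ⊢
    refine h.mono fun p => ?_
    rw [← norm_star_mul_mul ((hU p.1).mem_unitary (hsas p.1) p.2) (A p.1 p.2)]
    exact norm_expectL_le (hφ p.1) _
  | succ m ih =>
    intro A hAc hA
    have hA' := fun j => contDiff_infty_iff_deriv.1 (hAc j)
    have hc : ∀ j, ContDiff ℝ ∞ fun g => Complex.I • opComm (∑ Z, G j g Z) (A j g) := fun j =>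
      ((hG.contDiff_sum j).opComm (hAc j)).const_smul _
    have h := ih (A := fun j g => deriv (A j) g + Complex.I • opComm (∑ Z, G j g Z) (A j g))
      (fun j => (hA' j).2.add (hc j)) fun i => by
        have h1 := DerivAlmostLocal.opComm hΛ hw i hG hAc fun i _ => hA i
        have h2 := AlmostLocal.const_smul (J := J × ℝ) (f := fun p => f p.1) (u := fun p => u p.1)
          hw h1 Complex.I
        have h3 := hA (i + 1)
        unfold DerivAlmostLocal at h3
        simp only [iteratedDeriv_succ'] at h3
        have h4 := AlmostLocal.add (J := J × ℝ) (f := fun p => f p.1) (u := fun p => u p.1) hw h3 h2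
        have h5 : ∀ j g, iteratedDeriv i
            (fun g => deriv (A j) g + Complex.I • opComm (∑ Z, G j g Z) (A j g)) g =
            iteratedDeriv i (deriv (A j)) g +
              Complex.I • iteratedDeriv i (fun g => opComm (∑ Z, G j g Z) (A j g)) g :=
          fun j g => by
            rw [iteratedDeriv_fun_add ((hA' j).2.of_le (by exact_mod_cast le_top)).contDiffAt
              ((hc j).of_le (by exact_mod_cast le_top)).contDiffAt, iteratedDeriv_fun_smul_complex]
        unfold DerivAlmostLocal
        simp only [h5]
        exact h4
    have hd : ∀ j, deriv (fun g => expectL (φ j) (star (U j g) * A j g * U j g)) = fun g =>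
        expectL (φ j) (star (U j g) *
          (deriv (A j) g + Complex.I • opComm (∑ Z, G j g Z) (A j g)) * U j g) := fun j =>
      funext fun g => ((((expectL (φ j)).restrictScalars ℝ).hasFDerivAt.comp_hasDerivAt g
        ((hU j).hasDerivAt_heisenberg (hsas j) ((hA' j).1 g).hasDerivAt))).deriv
    simpa only [iteratedDeriv_succ', hd] using h

lemma almostLocal_of_supportedOn {r : ℝ} {Z : ∀ j, Finset (Λ (f j))} (hu : ∀ j, u j ∈ Z j)
    (hr : ∀ j, Metric.diam (Z j : Set (Λ (f j))) ≤ r) {A : ∀ j, Operator (q (f j))}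
    (hA : ∀ j, SupportedOn (Z j) (A j)) (hA1 : ∀ j, ‖A j‖ ≤ 1) {wt : J → ℝ} :
    AlmostLocal f u wt A := by
  refine ⟨(Tempered.const 1).mono hA1, fun k => (Tempered.const (2 * (1 + |r|) ^ k)).mono
    fun p => ?_⟩
  by_cases h : r ≤ p.2
  · have h1 : Z p.1 ⊆ ball (u p.1) p.2 := fun x hx => mem_ball.2
      ((Metric.dist_le_diam_of_mem (Z p.1).finite_toSet.isBounded hx (hu p.1)).trans
        ((hr p.1).trans h))
    rw [cut_eq_self ((hA p.1).mono h1), sub_self, norm_zero, zero_mul]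
    positivity
  · have h1 : ‖A p.1 - cut (ball (u p.1) p.2) (A p.1)‖ ≤ 2 := by
      refine (norm_sub_le _ _).trans ?_
      linarith [hA1 p.1, norm_cut_le (ball (u p.1) p.2) (A p.1)]
    refine mul_le_mul h1 (pow_le_pow_left₀ (by positivity) ?_ _) (by positivity) zero_le_two
    linarith [le_abs_self r, not_le.1 h]

/-! ### States related by a local unitary evolution are in the same phase -/

/-- The expectation values in a state evolved by a smooth local path depend smoothly on the
parameter of the path, uniformly in the system. -/
theorem hasSmoothLocalExpectations_of_isPropagator (hΛ : UniformPolynomialGrowth Λ)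
    {G : ∀ n, ℝ → Finset (Λ n) → Operator (q n)}
    (hG : IsSmoothLocalSum (fun n => n) (fun _ => 1) G) (hsa : ∀ n t Z, IsSelfAdjoint (G n t Z))
    {U : ∀ n, ℝ → Operator (q n)} (hU : ∀ n, IsPropagator (fun t => ∑ Z, G n t Z) (U n))
    {φ : ∀ n, ManyBody (q n)} (hφ : ∀ n, ‖φ n‖ = 1) :
    HasSmoothLocalExpectations fun n g => U n g (φ n) := by
  have hsas : ∀ n t, IsSelfAdjoint (∑ Z, G n t Z) := fun j t =>
    isSelfAdjoint_sum _ fun Z _ => hsa j t Z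
  have hUs : ∀ n, ContDiff ℝ ∞ (U n) := fun n =>
    contDiff_of_hasDerivAt_mul (hG.contDiff_sum n) (hU n).2
  have hsm : ∀ n (O : Operator (q n)),
      ContDiff ℝ ∞ fun g => expectL (φ n) (star (U n g) * O * U n g) := fun n O =>
    ((expectL (φ n)).restrictScalars ℝ).contDiff.comp
      ((((starL' ℝ : Operator (q n) ≃L[ℝ] _).contDiff.comp (hUs n)).mul contDiff_const).mul (hUs n))
  simp only [HasSmoothLocalExpectations, inner_map_eq_expectL]
  refine ⟨fun n O => (hsm n O).contDiffOn, fun m r => ?_⟩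
  let J := {p : (Σ n, Λ n × Finset (Λ n) × Operator (q n)) // p.2.1 ∈ p.2.2.1 ∧
    Metric.diam (p.2.2.1 : Set (Λ p.1)) ≤ r ∧ SupportedOn p.2.2.1 p.2.2.2 ∧ ‖p.2.2.2‖ ≤ 1}
  have hA : AlmostLocal (J := J × ℝ) (fun p => p.1.1.1) (fun p => p.1.1.2.1) (fun _ => 1)
      fun p => p.1.1.2.2.2 :=
    almostLocal_of_supportedOn (r := r) (Z := fun p => p.1.1.2.2.1) (fun p => p.1.2.1)
      (fun p => p.1.2.2.1) (fun p => p.1.2.2.2.1) (fun p => p.1.2.2.2.2)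
  obtain ⟨C, a, hC, hb⟩ := tempered_iteratedDeriv_expectL (J := J) (f := fun p => p.1.1)
    (u := fun p => p.1.2.1) (w := fun _ => 1) hΛ (fun _ => le_rfl)
    (hG.comp fun p : J => p.1.1) (fun p => hsa _) (fun p => hU _) (fun p => hφ p.1.1) m
    (A := fun p _ => p.1.2.2.2) (fun p => contDiff_const)
    (fun i => DerivAlmostLocal.const hA i)
  refine ⟨max C 1, fun n Z O hZ hO g hg => ?_⟩
  rw [iteratedDerivWithin_eq_iteratedDeriv uniqueDiffOn_Icc_zero_one
    ((hsm n O).of_le (by exact_mod_cast le_top)).contDiffAt hg]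
  rcases Z.eq_empty_or_nonempty with rfl | ⟨v, hv⟩
  · obtain ⟨c, rfl⟩ := hO.eq_smul_one
    have h1 : (fun g => expectL (φ n) (star (U n g) * (c • 1) * U n g)) =
        fun _ => expectL (φ n) (c • 1) := funext fun g => by
      rw [mul_smul_comm, smul_mul_assoc, mul_one, (hU n).star_mul_self (hsas n)]
    rw [h1, iteratedDeriv_const]
    have h2 : ‖expectL (φ n) (c • 1)‖ ≤ max C 1 * ‖(c • 1 : Operator (q n))‖ :=
      (norm_expectL_le (hφ n) _).trans
        (le_mul_of_one_le_left (norm_nonneg _) (le_max_right _ _))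
    split_ifs
    · exact h2
    · rw [norm_zero]; positivity
  · have h1 : O = (‖O‖ : ℂ) • ((‖O‖⁻¹ : ℂ) • O) := by
      rcases eq_or_ne O 0 with rfl | h0
      · simp
      · rw [smul_smul, mul_inv_cancel₀ (by simpa using h0), one_smul]
    have h2 : ‖(‖O‖⁻¹ : ℂ) • O‖ ≤ 1 := by
      rw [norm_smul, norm_inv, Complex.norm_real, norm_norm]
      exact inv_mul_le_one
    have h3 := hb (⟨⟨n, v, Z, (‖O‖⁻¹ : ℂ) • O⟩, hv, hZ, hO.smul _, h2⟩, g)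
    have h4 : (fun g => expectL (φ n) (star (U n g) * O * U n g)) = fun g =>
        (‖O‖ : ℂ) • expectL (φ n) (star (U n g) * ((‖O‖⁻¹ : ℂ) • O) * U n g) := funext fun g => by
      rw [← map_smul, ← smul_mul_assoc, ← mul_smul_comm, ← h1]
    rw [h4, iteratedDeriv_fun_smul_complex, norm_smul, Complex.norm_real, norm_norm, mul_comm]
    refine mul_le_mul_of_nonneg_right ?_ (norm_nonneg _)
    simp only [one_pow, mul_one] at h3
    exact h3.trans (le_max_left _ _)

/-- The evolution conjugates the Hamiltonian of `Φ₀` into a path of local Hamiltonians with the same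
gap. -/
theorem RelatedByLocalUnitary.inSamePhase (hΛ : UniformPolynomialGrowth Λ)
    {Φ₀ Φ₁ : ∀ n, ManyBody (q n)} (h₀ : IsGappedState Φ₀) (h : RelatedByLocalUnitary Φ₀ Φ₁) :
    InSamePhase Φ₀ Φ₁ := by
  obtain ⟨k, U, hk, hU, hΦ⟩ := h
  obtain ⟨h, hloc, Δ, hΔ, hgap⟩ := h₀
  have hθI : ∀ x, Real.smoothTransition x ∈ Set.Icc (0 : ℝ) 1 := fun x =>
    ⟨Real.smoothTransition.nonneg x, Real.smoothTransition.le_one x⟩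
  have hθ := bddSmooth_smoothTransition
  have hG := hk.isSmoothLocalSum hθ hθI hθ.deriv
  set G : ∀ n, ℝ → Finset (Λ n) → Operator (q n) := fun n g Z =>
    deriv Real.smoothTransition g • k n (Real.smoothTransition g) Z with hGdef
  let V : ∀ n, ℝ → Operator (q n) := fun n g => U n (Real.smoothTransition g)
  have hsa : ∀ n t Z, IsSelfAdjoint (G n t Z) := fun n t Z =>
    (IsSelfAdjoint.all _).smul (hk.1 n _ (hθI t) Z).1
  have hsas : ∀ n t, IsSelfAdjoint (∑ Z, G n t Z) := fun j t =>
    isSelfAdjoint_sum _ fun Z _ => hsa j t Z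
  have hV : ∀ n, IsPropagator (fun t => ∑ Z, G n t Z) (V n) := fun n => by
    refine ⟨by simp only [V, Real.smoothTransition.zero, (hU n).1], fun t => ?_⟩
    have h1 := ((contDiff_infty_iff_deriv.1 hθ.1).1 t).hasDerivAt
    refine (((hU n).2 _ (hθI t)).scomp_hasDerivAt t h1 hθI).congr_deriv ?_
    simp only [hGdef, V, ← Finset.smul_sum]
    rw [smul_mul_assoc, smul_comm]
  have hun := fun n g => (hV n).mem_unitary (hsas n) g
  have hh : IsLocalSum (fun n => n) (fun _ => 1) h :=
    ⟨fun n Z => (hloc.1 n Z).2, fun k => by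
      obtain ⟨C, hC⟩ := hloc.2 k
      exact (Tempered.const C).mono fun p => hC p.1 p.2⟩
  obtain ⟨hsm, hd⟩ := DerivAlmostLocal.schrodinger (J := Σ n, Λ n) (f := fun p => p.1)
    (u := fun p => p.2) (wt := fun _ => 1) hΛ (fun _ => le_rfl) (hG.comp fun p : Σ n, Λ n => p.1)
    (fun p => hsa p.1) (fun p => hV p.1) hh.almostLocal_siteTerm
  simp only [one_mul] at hd
  obtain ⟨h', hh', hsum⟩ := exists_isSmoothLocalPath hΛ
    (K := fun n u g => V n g * siteTerm (h n) u * star (V n g)) (fun n u => hsm ⟨n, u⟩)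
    (fun n u g => (isSelfAdjoint_siteTerm (fun Z => (hloc.1 n Z).1) u).conjugate _) hd
    (E := fun n => h n ∅) (fun n => hloc.1 n ∅)
  have hsum' : ∀ n g, ∑ Z, h' n g Z = V n g * (∑ Z, h n Z) * star (V n g) := fun n g => by
    obtain ⟨c, hc⟩ := (hloc.1 n ∅).2.eq_smul_one
    rw [hsum, ← sum_siteTerm, mul_add, add_mul, Finset.mul_sum, Finset.sum_mul, hc]
    rw [mul_smul_comm, smul_mul_assoc, mul_one, Unitary.mul_star_self_of_mem (hun n g)]
  refine ⟨h', fun n g => V n g (Φ₀ n), hh', fun n => ?_, fun n => ?_, ⟨Δ, hΔ, fun n g _ => ?_⟩,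
    hasSmoothLocalExpectations_of_isPropagator hΛ hG hsa hV fun n => (hgap n).1⟩
  · simp only [(hV n).1]; rfl
  · simp only [V, Real.smoothTransition.one, hΦ n]
  · simp only [hsum']
    exact (hgap n).conj (hun n g)

end Forward

section Filter

open MeasureTheory

/-! ### A filter function for the spectral gap -/

/-- A rapidly decaying real function of integral `1` whose Fourier transform vanishes at all
frequencies of modulus at least `Δ`. -/
lemma exists_bandlimited {Δ : ℝ} (hΔ : 0 < Δ) : ∃ w : ℝ → ℝ, Continuous w ∧
    (∀ p : ℕ, Integrable fun t => |w t| * (1 + |t|) ^ p) ∧ ∫ t, w t = 1 ∧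
    ∀ ξ : ℝ, Δ ≤ |ξ| → ∫ t, (w t : ℂ) * Complex.exp ((ξ * t : ℝ) * Complex.I) = 0 := by
  have hr : 0 < Δ / (2 * Real.pi) := by positivity
  -- frequencies in Mathlib's Fourier transform are in units of `2π`
  let χ : ContDiffBump (0 : ℝ) := ⟨Δ / (2 * Real.pi) / 2, Δ / (2 * Real.pi), by positivity,
    by linarith⟩
  have hχ : HasCompactSupport fun x => (χ x : ℂ) :=
    χ.hasCompactSupport.comp_left (g := fun x : ℝ => (x : ℂ)) Complex.ofReal_zero
  have hχs : ContDiff ℝ ∞ fun x => (χ x : ℂ) := Complex.ofRealCLM.contDiff.comp χ.contDiff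
  let F : SchwartzMap ℝ ℂ := hχ.toSchwartzMap hχs
  let v : SchwartzMap ℝ ℂ := FourierTransform.fourierInv F
  have hF : ∀ ξ : ℝ, ∫ t, v t * Complex.exp ((ξ * t : ℝ) * Complex.I) = χ (-ξ / (2 * Real.pi)) := by
    intro ξ
    have h1 : FourierTransform.fourier v = F := FourierTransform.fourier_fourierInv_eq F
    have h2 : FourierTransform.fourier (v : ℝ → ℂ) (-ξ / (2 * Real.pi)) = F (-ξ / (2 * Real.pi)) := by
      rw [← SchwartzMap.fourier_coe, h1]
    rw [Real.fourier_real_eq_integral_exp_smul] at h2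
    rw [show F (-ξ / (2 * Real.pi)) = χ (-ξ / (2 * Real.pi)) from rfl] at h2
    rw [← h2]
    refine integral_congr_ae (ae_of_all _ fun t => ?_)
    simp only [smul_eq_mul]
    rw [mul_comm]
    congr 4
    field_simp
  have hvi : ∀ ξ : ℝ, Integrable fun t => v t * Complex.exp ((ξ * t : ℝ) * Complex.I) := fun ξ => by
    refine v.integrable.mono (v.continuous.mul (by fun_prop)).aestronglyMeasurable
      (ae_of_all _ fun t => ?_)
    rw [norm_mul, Complex.norm_exp_ofReal_mul_I, mul_one]
  have hre : ∀ ξ : ℝ, ∫ t, ((v t).re : ℂ) * Complex.exp ((ξ * t : ℝ) * Complex.I) =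
      (χ (-ξ / (2 * Real.pi)) + χ (ξ / (2 * Real.pi))) / 2 := fun ξ => by
    have h1 : ∀ t, ((v t).re : ℂ) * Complex.exp ((ξ * t : ℝ) * Complex.I) =
        (v t * Complex.exp ((ξ * t : ℝ) * Complex.I) +
          starRingEnd ℂ (v t * Complex.exp ((-ξ * t : ℝ) * Complex.I))) / 2 := fun t => by
      rw [map_mul, ← Complex.exp_conj, map_mul, Complex.conj_ofReal, Complex.conj_I,
        Complex.re_eq_add_conj]
      push_cast
      ring_nf
    have h2 : Integrable fun t =>
        starRingEnd ℂ (v t * Complex.exp ((-ξ * t : ℝ) * Complex.I)) :=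
      (Complex.conjCLE : ℂ →L[ℝ] ℂ).integrable_comp (hvi (-ξ))
    simp only [h1]
    rw [integral_div, integral_add (hvi ξ) h2,
      integral_conj, hF, hF, Complex.conj_ofReal, neg_neg]
  refine ⟨fun t => (v t).re, Complex.continuous_re.comp v.continuous, fun p => ?_, ?_, fun ξ hξ => ?_⟩
  · have h1 := ((v.integrable.norm).add (v.integrable_pow_mul volume p)).const_mul (2 ^ (p - 1))
    refine h1.mono' ((Complex.continuous_re.comp v.continuous).abs.mul
      (by fun_prop)).aestronglyMeasurable (ae_of_all _ fun t => ?_)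
    rw [Real.norm_of_nonneg (by positivity)]
    have h2 := add_pow_le zero_le_one (abs_nonneg t) p
    have h3 := Complex.abs_re_le_norm (v t)
    simp only [Pi.add_apply, Real.norm_eq_abs]
    calc _ ≤ ‖v t‖ * (2 ^ (p - 1) * (1 ^ p + |t| ^ p)) := by gcongr
      _ = _ := by rw [one_pow]; ring
  · have h1 := hre 0
    have h2 : χ 0 = 1 := χ.one_of_mem_closedBall (by simp [χ.rIn_pos.le])
    simp only [zero_mul, Complex.ofReal_zero, Complex.exp_zero, mul_one, neg_zero, zero_div, h2] at h1
    rw [integral_complex_ofReal] at h1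
    norm_num at h1
    exact_mod_cast h1
  · have h3 : ∀ y : ℝ, |y| = |ξ| → χ (y / (2 * Real.pi)) = 0 := fun y hy =>
      χ.zero_of_le_dist (by
        rw [Real.dist_eq, sub_zero, abs_div, hy, abs_of_pos (by positivity : 0 < 2 * Real.pi)]
        exact div_le_div_of_nonneg_right hξ (by positivity))
    rw [hre, h3 _ (abs_neg ξ), h3 _ rfl]
    simp

/-- Integrating a time evolution against the kernel `c`, at the time `z.1 * z.2`, inverts the
energy difference `ξ` up to a factor of `i`, as long as `|ξ| ≥ Δ`. -/
lemma exists_filter {Δ : ℝ} (hΔ : 0 < Δ) : ∃ c : ℝ × ℝ → ℝ,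
    (∀ p : ℕ, Integrable fun z => c z * (1 + |z.1 * z.2|) ^ p) ∧
    ∀ ξ : ℝ, Δ ≤ |ξ| →
      ∫ z : ℝ × ℝ, (c z : ℂ) * Complex.exp ((ξ * (z.1 * z.2) : ℝ) * Complex.I) = Complex.I / ξ := by
  obtain ⟨w, hwc, hwi, hw1, hw0⟩ := exists_bandlimited hΔ
  -- for fixed `t`, the integral of `t * exp (i ξ t x)` over `x` is `(exp (i ξ t) - 1) / (i ξ)`; the
  -- integral of the first part against `w` vanishes, and that of `w` is `1`
  let c : ℝ × ℝ → ℝ := fun z => w z.1 * z.1 * (Set.Ioc (0 : ℝ) 1).indicator (fun _ => 1) z.2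
  have hcm : Measurable c := (hwc.measurable.comp measurable_fst |>.mul measurable_fst).mul
    ((measurable_const.indicator measurableSet_Ioc).comp measurable_snd)
  have hci : ∀ p : ℕ, Integrable fun z => c z * (1 + |z.1 * z.2|) ^ p := fun p => by
    have h1 : Integrable ((Set.Ioc (0 : ℝ) 1).indicator fun _ => (1 : ℝ)) :=
      (integrable_indicator_iff measurableSet_Ioc).2 (integrableOn_const (by simp))
    refine ((hwi (p + 1)).mul_prod h1).mono' (hcm.mul (by fun_prop)).aestronglyMeasurable
      (ae_of_all _ fun z => ?_)
    by_cases hz : z.2 ∈ Set.Ioc (0 : ℝ) 1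
    · simp only [c, Set.indicator_of_mem hz, mul_one]
      rw [norm_mul, norm_mul, Real.norm_eq_abs, Real.norm_eq_abs, Real.norm_of_nonneg (by positivity),
        abs_mul, abs_of_pos hz.1, mul_assoc, pow_succ']
      have h2 : |z.1| * z.2 ≤ |z.1| := mul_le_of_le_one_right (abs_nonneg _) hz.2
      have h3 := abs_nonneg z.1
      have h4 := hz.1
      gcongr
      linarith
    · simp [c, Set.indicator_of_notMem hz]
  refine ⟨c, hci, fun ξ hξ => ?_⟩
  have hξ0 : (ξ : ℂ) ≠ 0 := by
    rintro h
    rw [Complex.ofReal_eq_zero.1 h, abs_zero] at hξ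
    linarith
  have hint : Integrable fun z : ℝ × ℝ =>
      (c z : ℂ) * Complex.exp ((ξ * (z.1 * z.2) : ℝ) * Complex.I) := by
    have h1 : Integrable c := by simpa using hci 0
    have h2 : Measurable fun z : ℝ × ℝ => Complex.exp ((ξ * (z.1 * z.2) : ℝ) * Complex.I) := by
      fun_prop
    refine h1.mono ((Complex.measurable_ofReal.comp hcm).mul h2).aestronglyMeasurable
      (ae_of_all _ fun z => ?_)
    change ‖(c z : ℂ) * Complex.exp ((ξ * (z.1 * z.2) : ℝ) * Complex.I)‖ ≤ ‖c z‖
    rw [norm_mul, Complex.norm_exp_ofReal_mul_I, mul_one, Complex.norm_real]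
  have hin : ∀ t : ℝ, ∫ x, (c (t, x) : ℂ) * Complex.exp ((ξ * (t * x) : ℝ) * Complex.I) =
      ((w t : ℂ) * Complex.exp ((ξ * t : ℝ) * Complex.I) - w t) / (Complex.I * ξ) := fun t => by
    have h1 : (fun x => (c (t, x) : ℂ) * Complex.exp ((ξ * (t * x) : ℝ) * Complex.I)) =
        (Set.Ioc (0 : ℝ) 1).indicator fun x =>
          (w t : ℂ) * (t * Complex.exp ((ξ * (t * x) : ℝ) * Complex.I)) := by
      funext x
      by_cases hx : x ∈ Set.Ioc (0 : ℝ) 1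
      · simp [c, hx, mul_assoc]
      · simp [c, hx]
    have h2 : ∀ x : ℝ, HasDerivAt (fun x : ℝ => (w t : ℂ) / (Complex.I * ξ) *
        Complex.exp ((ξ * (t * x) : ℝ) * Complex.I))
        ((w t : ℂ) * (t * Complex.exp ((ξ * (t * x) : ℝ) * Complex.I))) x := fun x => by
      have h3 : HasDerivAt (fun x : ℝ => ((ξ * (t * x) : ℝ) : ℂ) * Complex.I)
          ((ξ * t : ℝ) * Complex.I) x := by
        have h4 : HasDerivAt (fun x : ℝ => ξ * (t * x)) (ξ * t) x := by
          simpa using ((hasDerivAt_id x).const_mul t).const_mul ξ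
        exact h4.ofReal_comp.mul_const _
      refine (h3.cexp.const_mul _).congr_deriv ?_
      push_cast
      field_simp
    rw [h1, integral_indicator measurableSet_Ioc, ← intervalIntegral.integral_of_le zero_le_one,
      intervalIntegral.integral_eq_sub_of_hasDerivAt (fun x _ => h2 x)
        ((by fun_prop : Continuous fun x : ℝ =>
          (w t : ℂ) * (t * Complex.exp ((ξ * (t * x) : ℝ) * Complex.I))).intervalIntegrable _ _)]
    simp
    ring
  have hwi0 : Integrable fun t => (w t : ℂ) := by
    have := hwi 0
    simp only [pow_zero, mul_one] at this
    exact (integrable_norm_iff hwc.aestronglyMeasurable).1 this |>.ofReal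
  have hwe : Integrable fun t => (w t : ℂ) * Complex.exp ((ξ * t : ℝ) * Complex.I) := by
    refine hwi0.mono (by fun_prop) (ae_of_all _ fun z => ?_)
    rw [norm_mul, Complex.norm_exp_ofReal_mul_I, mul_one]
  rw [Measure.volume_eq_prod] at hint ⊢
  rw [integral_prod _ hint]
  simp only [hin]
  rw [integral_div, integral_sub hwe hwi0, hw0 ξ hξ, integral_complex_ofReal, hw1]
  rw [zero_sub, Complex.ofReal_one, neg_div, one_div, mul_inv, Complex.inv_I]
  ring

/-! ### Smooth dependence of integrals on a parameter -/

/-- Differentiation under the integral sign, to all orders. -/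
lemma iteratedDeriv_integral_smul {X E : Type*} [MeasurableSpace X] {μ : Measure X}
    [NormedAddCommGroup E] [NormedSpace ℝ E] {v c : X → ℝ} (hv : ∀ x, 1 ≤ v x)
    (hc : ∀ p : ℕ, Integrable (fun x => c x * v x ^ p) μ) {F : X → ℝ → E}
    (hF : ∀ x, ContDiff ℝ ∞ (F x))
    (hm : ∀ m g, AEStronglyMeasurable (fun x => iteratedDeriv m (F x) g) μ)
    (hb : ∀ m, ∃ (C : ℝ) (p : ℕ), ∀ x g, ‖iteratedDeriv m (F x) g‖ ≤ C * v x ^ p) :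
    (ContDiff ℝ ∞ fun g => ∫ x, c x • F x g ∂μ) ∧
    ∀ m g, iteratedDeriv m (fun g => ∫ x, c x • F x g ∂μ) g =
      ∫ x, c x • iteratedDeriv m (F x) g ∂μ := by
  have hc0 : Integrable c μ := by simpa using hc 0
  have hv0 : ∀ x, 0 ≤ v x := fun x => zero_le_one.trans (hv x)
  have hd : ∀ m g, HasDerivAt (fun g => ∫ x, c x • iteratedDeriv m (F x) g ∂μ)
      (∫ x, c x • iteratedDeriv (m + 1) (F x) g ∂μ) g := fun m g => by
    obtain ⟨C, p, hC⟩ := hb m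
    obtain ⟨C', p', hC'⟩ := hb (m + 1)
    refine (hasDerivAt_integral_of_dominated_loc_of_deriv_le (s := Set.univ)
      (F := fun g x => c x • iteratedDeriv m (F x) g)
      (F' := fun g x => c x • iteratedDeriv (m + 1) (F x) g)
      (bound := fun x => C' * ‖c x * v x ^ p'‖) Filter.univ_mem
      (Filter.Eventually.of_forall fun g => hc0.aestronglyMeasurable.smul (hm m g))
      (integrable_smul_of_norm_le hv0 hc0 (hc p) (hm m g) fun x => hC x g).1
      (hc0.aestronglyMeasurable.smul (hm (m + 1) g)) (ae_of_all _ fun x g _ => ?_)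
      ((hc p').norm.const_mul C') (ae_of_all _ fun x g _ => ?_)).2
    · rw [norm_smul, norm_mul, Real.norm_of_nonneg (pow_nonneg (hv0 x) p')]
      calc ‖c x‖ * ‖iteratedDeriv (m + 1) (F x) g‖ ≤ ‖c x‖ * (C' * v x ^ p') := by
            have := hC' x g; gcongr
        _ = _ := by ring
    · rw [iteratedDeriv_succ]
      exact (((hF x).differentiable_iteratedDeriv m (by exact_mod_cast ENat.natCast_lt_top m))
        g).hasDerivAt.const_smul (c x)
  have hi : ∀ m, iteratedDeriv m (fun g => ∫ x, c x • F x g ∂μ) =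
      fun g => ∫ x, c x • iteratedDeriv m (F x) g ∂μ := fun m => by
    induction m with
    | zero => simp
    | succ m ih =>
      rw [iteratedDeriv_succ, ih]
      exact funext fun g => (hd m g).deriv
  refine ⟨contDiff_of_differentiable_iteratedDeriv fun m _ => ?_, fun m g => by rw [hi]⟩
  rw [hi]
  exact fun g => (hd m g).differentiableAt

end Filter

section Backward

open MeasureTheory InnerProductSpace

/-! ### Quasi-adiabatic continuation -/

/-- The Heisenberg evolution of `A` under `H` at the time `z.1 * z.2`, averaged with the weight
`c z`. -/
noncomputable def filtered {𝔸 : Type*} [CStarAlgebra 𝔸] (c : ℝ × ℝ → ℝ) (H A : 𝔸) : 𝔸 :=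
  ∫ z : ℝ × ℝ, c z • (star (expU H (z.1 * z.2)) * A * expU H (z.1 * z.2))

section Filtered

variable {𝔸 : Type*} [CStarAlgebra 𝔸] {c : ℝ × ℝ → ℝ} {H : 𝔸}

lemma continuous_conj_expU (H A : 𝔸) :
    Continuous fun z : ℝ × ℝ => star (expU H (z.1 * z.2)) * A * expU H (z.1 * z.2) := by
  have h : Continuous fun z : ℝ × ℝ => expU H (z.1 * z.2) :=
    (isPropagator_expU H).continuous.comp (by fun_prop)
  exact (h.star.mul continuous_const).mul h

lemma isSelfAdjoint_filtered {A : 𝔸} (hA : IsSelfAdjoint A) : IsSelfAdjoint (filtered c H A) := by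
  rw [IsSelfAdjoint, filtered]
  have h := (starL' ℝ : 𝔸 ≃L[ℝ] 𝔸).integral_comp_comm
    (μ := (volume : Measure (ℝ × ℝ))) fun z : ℝ × ℝ =>
      c z • (star (expU H (z.1 * z.2)) * A * expU H (z.1 * z.2))
  refine h.symm.trans (integral_congr_ae (ae_of_all _ fun z => ?_))
  simp [hA.star_eq, mul_assoc]

variable [IsDedekindFiniteMonoid 𝔸]

lemma integrable_filtered (hc : Integrable c) (hH : IsSelfAdjoint H) (A : 𝔸) :
    Integrable fun z : ℝ × ℝ => c z • (star (expU H (z.1 * z.2)) * A * expU H (z.1 * z.2)) :=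
  (integrable_smul_of_norm_le (v := fun _ => 1) (p := 0) (K := ‖A‖) (fun _ => zero_le_one) hc
    (by simpa using hc) (continuous_conj_expU H A).aestronglyMeasurable fun z => by
      rw [norm_star_mul_mul ((isPropagator_expU H).mem_unitary (fun _ => hH) _)]; simp).1

lemma filtered_sum (hc : Integrable c) (hH : IsSelfAdjoint H) {α : Type*} (s : Finset α)
    (A : α → 𝔸) : ∑ i ∈ s, filtered c H (A i) = filtered c H (∑ i ∈ s, A i) := by
  simp only [filtered]
  rw [← integral_finsetSum _ fun i _ => integrable_filtered hc hH (A i)]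
  refine integral_congr_ae (ae_of_all _ fun z => ?_)
  simp only [Finset.mul_sum, Finset.sum_mul, Finset.smul_sum]

lemma filtered_neg (A : 𝔸) : filtered c H (-A) = -filtered c H A := by
  simp only [filtered, mul_neg, neg_mul, smul_neg, integral_neg]

lemma conj_expU_opComm (hH : IsSelfAdjoint H) (A : 𝔸) {P : 𝔸} (hP : H * P = P * H) (s : ℝ) :
    opComm (star (expU H s) * A * expU H s) P = star (expU H s) * opComm A P * expU H s := by
  have hu := (isPropagator_expU H).mem_unitary (fun _ => hH) s
  have h1 : expU H s * P = P * expU H s :=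
    (isPropagator_expU H).commute (fun _ => hH) (fun _ => hP) s
  have h2 : star (expU H s) * P * expU H s = P := by
    rw [mul_assoc, ← h1, ← mul_assoc, Unitary.star_mul_self_of_mem hu, one_mul]
  rw [star_mul_opComm_mul hu, h2]

lemma opComm_filtered (hc : Integrable c) (hH : IsSelfAdjoint H) (A : 𝔸) {P : 𝔸}
    (hP : H * P = P * H) : opComm (filtered c H A) P = filtered c H (opComm A P) := by
  let L : 𝔸 →L[ℝ] 𝔸 := (ContinuousLinearMap.mul ℝ 𝔸).flip P - ContinuousLinearMap.mul ℝ 𝔸 P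
  have h := L.integral_comp_comm (integrable_filtered hc hH A)
  refine (h.symm.trans (integral_congr_ae (ae_of_all _ fun z => ?_)) : L _ = _)
  have h1 : ∀ (a : ℝ) (B : 𝔸), L (a • B) = a • opComm B P := fun a B => by
    rw [map_smul]; rfl
  simp only [h1, conj_expU_opComm hH A hP]

end Filtered

section Spectral

variable {E : Type*} [NormedAddCommGroup E] [InnerProductSpace ℂ E] [CompleteSpace E]

lemma expU_apply_of_eigenvector {H : BoundedOperator E} (hH : IsSelfAdjoint H)
    [IsDedekindFiniteMonoid (BoundedOperator E)] {a : ℝ} {v : E}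
    (hv : H v = (a : ℂ) • v) (s : ℝ) :
    expU H s v = Complex.exp ((-(a * s) : ℝ) * Complex.I) • v := by
  have hP := isPropagator_expU H
  have hcomm : ∀ s, H * expU H s = expU H s * H := fun s =>
    (hP.commute (fun _ => hH) (fun _ => rfl) s).symm
  have hd : ∀ s, HasDerivAt (fun s : ℝ => Complex.exp ((a * s : ℝ) * Complex.I) • expU H s v) 0 s := by
    intro s
    have h1 : HasDerivAt (fun s : ℝ => expU H s v) ((-Complex.I) • (a : ℂ) • expU H s v) s := by
      have h2 := (((ContinuousLinearMap.apply ℂ E v).restrictScalars ℝ).hasFDerivAt).comp_hasDerivAt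
        s (hP.2 s)
      refine h2.congr_deriv ?_
      rw [hcomm]
      simp [hv]
    have h3 : HasDerivAt (fun s : ℝ => Complex.exp ((a * s : ℝ) * Complex.I))
        (Complex.exp ((a * s : ℝ) * Complex.I) * (a * Complex.I)) s := by
      have h4 : HasDerivAt (fun s : ℝ => a * s) a s := by simpa using (hasDerivAt_id s).const_mul a
      exact (h4.ofReal_comp.mul_const Complex.I).cexp
    refine (h3.smul h1).congr_deriv ?_
    rw [smul_smul, smul_smul, ← add_smul]
    ring_nf
    simp
  have h := is_const_of_deriv_eq_zero (fun t => (hd t).differentiableAt) (fun t => (hd t).deriv) s 0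
  simp only [mul_zero, Complex.ofReal_zero, zero_mul, Complex.exp_zero, one_smul, expU_zero] at h
  have h2 : Complex.exp ((-(a * s) : ℝ) * Complex.I) • (1 : BoundedOperator E) v =
      expU H s v := by
    rw [← h, smul_smul, ← Complex.exp_add]
    push_cast
    ring_nf
    simp
  exact h2.symm

end Spectral

section GroundState

variable {V : Type*} [Fintype V] [DecidableEq V] {q : V → ℕ}

/-- An eigenvector is a multiple of the ground state, or orthogonal to it and above the gap. -/
lemma IsGroundStateWithGap.rankOne_eigenvector {H : Operator q} (hH : IsSelfAdjoint H) {Δ : ℝ}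
    (hΔ : 0 < Δ) {φ : ManyBody q} (hφ : ‖φ‖ = 1) {E₀ : ℝ} (hE : H φ = (E₀ : ℂ) • φ)
    (hgap : ∀ ψ : ManyBody q, inner ℂ φ ψ = 0 → (E₀ + Δ) * ‖ψ‖ ^ 2 ≤ (inner ℂ ψ (H ψ)).re)
    {v : ManyBody q} (hv0 : ‖v‖ = 1) {a : ℝ} (hv : H v = (a : ℂ) • v) :
    (a = E₀ ∧ rankOne ℂ φ φ v = v) ∨ (E₀ + Δ ≤ a ∧ rankOne ℂ φ φ v = 0) := by
  have hself : ∀ {b : ℝ} {ψ : ManyBody q}, H ψ = (b : ℂ) • ψ →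
      (inner ℂ ψ (H ψ)).re = b * ‖ψ‖ ^ 2 := fun {b ψ} h => by
    rw [h, inner_smul_right, inner_self_eq_norm_sq_to_K]
    simp [← Complex.ofReal_pow]
  by_cases ha : a = E₀
  · left
    refine ⟨ha, ?_⟩
    subst ha
    have h1 : inner ℂ φ (v - rankOne ℂ φ φ v) = 0 := by
      simp [hφ]
    have h2 : H (v - rankOne ℂ φ φ v) = (a : ℂ) • (v - rankOne ℂ φ φ v) := by
      rw [map_sub, hv, rankOne_apply, map_smul, hE, smul_sub, smul_comm]
    have h3 := hgap _ h1
    rw [hself h2] at h3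
    have h4 : ‖v - rankOne ℂ φ φ v‖ ^ 2 ≤ 0 := by
      nlinarith [sq_nonneg ‖v - rankOne ℂ φ φ v‖]
    have h5 : ‖v - rankOne ℂ φ φ v‖ = 0 := by
      exact pow_eq_zero_iff (two_ne_zero) |>.1 (le_antisymm h4 (sq_nonneg _))
    exact (sub_eq_zero.1 (norm_eq_zero.1 h5)).symm
  · right
    have h1 : inner ℂ φ v = 0 := by
      have h2 : inner ℂ φ (H v) = inner ℂ (H φ) v := by
        conv_rhs => rw [← hH.star_eq, ContinuousLinearMap.star_eq_adjoint,
          ContinuousLinearMap.adjoint_inner_left]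
      rw [hv, hE, inner_smul_right, inner_smul_left, Complex.conj_ofReal, ← sub_eq_zero,
        ← sub_mul] at h2
      exact (mul_eq_zero.1 h2).resolve_left (by
        rw [sub_eq_zero]; exact_mod_cast ha)
    have h3 := hgap v h1
    rw [hself hv, hv0] at h3
    exact ⟨by linarith, by simp [h1]⟩

/-- On operators that only connect the ground state with excited states, the filtered evolution
inverts the commutator with the Hamiltonian. -/
theorem IsGroundStateWithGap.filtered_opComm {H : Operator q} (hH : IsSelfAdjoint H) {Δ : ℝ}
    (hΔ : 0 < Δ) {φ : ManyBody q} (h : IsGroundStateWithGap H Δ φ) {c : ℝ × ℝ → ℝ}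
    (hc : Integrable c)
    (hcΔ : ∀ ξ : ℝ, Δ ≤ |ξ| →
      ∫ z : ℝ × ℝ, (c z : ℂ) * Complex.exp ((ξ * (z.1 * z.2) : ℝ) * Complex.I) = Complex.I / ξ)
    {X : Operator q} (hX : X * rankOne ℂ φ φ + rankOne ℂ φ φ * X = X) :
    filtered c H (opComm H X) = Complex.I • X := by
  obtain ⟨hφ, E₀, hE, hgap⟩ := h
  have hsym : (H : ManyBody q →ₗ[ℂ] ManyBody q).IsSymmetric := hH.isSymmetric
  let e := hsym.eigenvectorBasis rfl
  let lam := hsym.eigenvalues rfl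
  have he : ∀ i, H (e i) = (lam i : ℂ) • e i := fun i => hsym.apply_eigenvectorBasis rfl i
  have he1 : ∀ i, ‖e i‖ = 1 := fun i => e.orthonormal.1 i
  have hPadj : ∀ x y : ManyBody q, inner ℂ x (rankOne ℂ φ φ y) = inner ℂ (rankOne ℂ φ φ x) y :=
    fun x y => by
      simp only [rankOne_apply, inner_smul_right, inner_smul_left, inner_conj_symm]
      ring
  have hHadj : ∀ x y : ManyBody q, inner ℂ x (H y) = inner ℂ (H x) y := fun x y => (hsym x y).symm
  have key : ∀ i j, inner ℂ (e i) (filtered c H (opComm H X) (e j)) =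
      inner ℂ (e i) ((Complex.I • X) (e j)) := fun i j => by
    have h1 : inner ℂ (e i) (filtered c H (opComm H X) (e j)) =
        (∫ z : ℝ × ℝ, (c z : ℂ) * Complex.exp (((lam i - lam j) * (z.1 * z.2) : ℝ) * Complex.I)) *
          ((lam i - lam j : ℝ) * inner ℂ (e i) (X (e j))) := by
      have h2 := ((elementL (e i) (e j)).restrictScalars ℝ).integral_comp_comm
        (integrable_filtered hc hH (opComm H X))
      rw [← integral_mul_const]
      refine (h2.symm.trans (integral_congr_ae (ae_of_all _ fun z => ?_)) :
        (elementL (e i) (e j)).restrictScalars ℝ _ = _)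
      simp only [map_smul]
      rw [ContinuousLinearMap.coe_restrictScalars', elementL_apply, Complex.real_smul, mul_assoc (c z : ℂ)]
      congr 1
      rw [mul_apply_eq_comp, mul_apply_eq_comp,
        ContinuousLinearMap.star_eq_adjoint, ContinuousLinearMap.adjoint_inner_right,
        expU_apply_of_eigenvector hH (he i), expU_apply_of_eigenvector hH (he j), map_smul,
        inner_smul_left, inner_smul_right, ← Complex.exp_conj, ← mul_assoc, ← Complex.exp_add]
      congr 1
      · congr 1
        simp only [map_mul, Complex.conj_ofReal, Complex.conj_I]
        push_cast
        ring
      · rw [opComm, sub_apply, mul_apply_eq_comp,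
          mul_apply_eq_comp, inner_sub_right, hHadj, he, he, map_smul, inner_smul_left,
          inner_smul_right, Complex.conj_ofReal]
        push_cast
        ring
    have h2 : inner ℂ (e i) (X (e j)) = inner ℂ (e i) (X (rankOne ℂ φ φ (e j))) +
        inner ℂ (rankOne ℂ φ φ (e i)) (X (e j)) := by
      conv_lhs => rw [← hX]
      rw [add_apply, mul_apply_eq_comp, mul_apply_eq_comp,
        inner_add_right, hPadj]
    rw [h1, smul_apply, inner_smul_right]
    have hgap' : ∀ {ξ : ℝ}, Δ ≤ |ξ| → ∀ y : ℂ,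
        (∫ z : ℝ × ℝ, (c z : ℂ) * Complex.exp ((ξ * (z.1 * z.2) : ℝ) * Complex.I)) * (ξ * y) =
          Complex.I * y := fun {ξ} hξ y => by
      have h0 : (ξ : ℂ) ≠ 0 := by
        rintro h
        rw [Complex.ofReal_eq_zero.1 h, abs_zero] at hξ
        linarith
      rw [hcΔ ξ hξ]
      field_simp
    -- a nonzero matrix element connects the ground state with an excited state
    rcases rankOne_eigenvector hH hΔ hφ hE hgap (he1 i) (he i) with ⟨hi, hPi⟩ | ⟨hi, hPi⟩ <;>
    rcases rankOne_eigenvector hH hΔ hφ hE hgap (he1 j) (he j) with ⟨hj, hPj⟩ | ⟨hj, hPj⟩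
    · rw [hPi, hPj] at h2
      have h3 : inner ℂ (e i) (X (e j)) = 0 := by linear_combination -h2
      rw [h3]; ring
    · exact hgap' (by rw [abs_sub_comm]; exact le_trans (by linarith) (le_abs_self _)) _
    · exact hgap' (le_trans (by linarith) (le_abs_self _)) _
    · rw [hPi, hPj] at h2
      simp only [map_zero, inner_zero_right, inner_zero_left, add_zero] at h2
      rw [h2]; ring
  refine ContinuousLinearMap.coe_injective (e.toBasis.ext fun j => ?_)
  refine ext_inner_left_basis e.toBasis fun i => ?_
  simp only [OrthonormalBasis.coe_toBasis]
  exact key i j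

/-- The ground state projection follows the evolution generated by the filtered derivative of the
Hamiltonian. -/
theorem hasDerivAt_groundState_projection {H : ℝ → Operator q} {H' P' : Operator q} {t : ℝ}
    (hH : HasDerivAt H H' t) (hsa : ∀ t, IsSelfAdjoint (H t)) {Δ : ℝ} (hΔ : 0 < Δ)
    {φ : ℝ → ManyBody q} (h : ∀ t, IsGroundStateWithGap (H t) Δ (φ t))
    (hP : HasDerivAt (fun t => (rankOne ℂ (φ t) (φ t) : Operator q)) P' t) {c : ℝ × ℝ → ℝ}
    (hc : Integrable c)
    (hcΔ : ∀ ξ : ℝ, Δ ≤ |ξ| →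
      ∫ z : ℝ × ℝ, (c z : ℂ) * Complex.exp ((ξ * (z.1 * z.2) : ℝ) * Complex.I) = Complex.I / ξ)
    {A : Operator q} (hA : ∃ a : ℂ, H' = A + a • 1) :
    P' = Complex.I • opComm (filtered c (H t) A) (rankOne ℂ (φ t) (φ t)) := by
  have hPP : ∀ t, (rankOne ℂ (φ t) (φ t) : Operator q) * rankOne ℂ (φ t) (φ t) =
      rankOne ℂ (φ t) (φ t) := fun t => isIdempotentElem_rankOne_self (h t).1
  have hcomm : ∀ t, H t * rankOne ℂ (φ t) (φ t) = rankOne ℂ (φ t) (φ t) * H t := fun t => by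
    obtain ⟨-, E₀, hE, -⟩ := h t
    ext1 x
    have h1 : inner ℂ (φ t) (H t x) = E₀ * inner ℂ (φ t) x := by
      have h2 : inner ℂ (φ t) (H t x) = inner ℂ (H t (φ t)) x := ((hsa t).isSymmetric _ _).symm
      rw [h2, hE, inner_smul_left, Complex.conj_ofReal]
    rw [mul_apply_eq_comp, mul_apply_eq_comp, rankOne_apply, rankOne_apply,
      map_smul, hE, h1, smul_smul, mul_comm]
  have h1 : P' * rankOne ℂ (φ t) (φ t) + rankOne ℂ (φ t) (φ t) * P' = P' := by
    have h2 := hP.mul hP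
    have h3 : (fun t => (rankOne ℂ (φ t) (φ t) : Operator q)) *
        (fun t => (rankOne ℂ (φ t) (φ t) : Operator q)) = fun t => rankOne ℂ (φ t) (φ t) :=
      funext hPP
    rw [h3] at h2
    exact h2.unique hP
  have h2 : opComm H' (rankOne ℂ (φ t) (φ t)) = -opComm (H t) P' := by
    have h3 := hH.opComm hP
    have h4 : (fun t => opComm (H t) (rankOne ℂ (φ t) (φ t))) = fun _ => (0 : Operator q) :=
      funext fun t => sub_eq_zero.2 (hcomm t)
    rw [h4] at h3
    exact eq_neg_of_add_eq_zero_left (h3.unique (hasDerivAt_const t 0))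
  obtain ⟨a, ha⟩ := hA
  have h3 : opComm A (rankOne ℂ (φ t) (φ t)) = -opComm (H t) P' := by
    rw [← h2, ha]
    simp [opComm, add_mul, mul_add]
  rw [opComm_filtered hc (hsa t) A (hcomm t), h3, filtered_neg,
    (h t).filtered_opComm (hsa t) hΔ hc hcΔ h1, smul_neg, smul_smul, Complex.I_mul_I]
  simp

/-- The matrix elements of the projection onto a state are expectation values of matrix units. -/
lemma contDiff_rankOne_of_expectation {φ : ℝ → ManyBody q}
    (h : ∀ O : Operator q, ContDiff ℝ ∞ fun g => inner ℂ (φ g) (O (φ g))) :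
    ContDiff ℝ ∞ fun g => (rankOne ℂ (φ g) (φ g) : Operator q) := by
  let e := EuclideanSpace.basisFun ((x : V) → Fin (q x)) ℂ
  have h1 : ∀ g, (rankOne ℂ (φ g) (φ g) : Operator q) =
      ∑ i, ∑ j, inner ℂ (φ g) ((rankOne ℂ (e j) (e i) : Operator q) (φ g)) •
        rankOne ℂ (e i) (e j) := fun g => by
    have h2 : (rankOne ℂ (φ g) (φ g) : Operator q) = rankOne ℂ
        (∑ i, inner ℂ (e i) (φ g) • e i) (∑ j, inner ℂ (e j) (φ g) • e j) := by
      rw [e.sum_repr']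
    rw [h2]
    simp only [map_sum, map_smul, map_smulₛₗ, sum_apply, smul_apply, rankOne_apply,
      inner_smul_right, inner_conj_symm, Finset.smul_sum, smul_smul]
    rw [Finset.sum_comm]
    refine Finset.sum_congr rfl fun i _ => Finset.sum_congr rfl fun j _ => ?_
    rw [mul_comm]
  simp only [h1]
  exact ContDiff.sum fun i _ => ContDiff.sum fun j _ => (h _).smul contDiff_const

end GroundState

end Backward

section Continuation

open MeasureTheory InnerProductSpace

variable {ι : Type*} {Λ : ι → Type*} [∀ n, Fintype (Λ n)] [∀ n, DecidableEq (Λ n)]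
  [∀ n, MetricSpace (Λ n)] {q : ∀ n, Λ n → ℕ} [∀ n x, NeZero (q n x)]
  {J : Type*} {f : J → ι} {u : ∀ j, Λ (f j)}

/-- Filtering preserves smooth paths of almost local operators. -/
theorem DerivAlmostLocal.filtered (hΛ : UniformPolynomialGrowth Λ) {c : ℝ × ℝ → ℝ}
    (hc : ∀ p : ℕ, Integrable fun z => c z * (1 + |z.1 * z.2|) ^ p)
    {G : ∀ j, ℝ → Finset (Λ (f j)) → Operator (q (f j))}
    (hG : IsSmoothLocalSum f (fun _ => 1) G) (hsa : ∀ j t Z, IsSelfAdjoint (G j t Z))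
    {A : ∀ j, ℝ → Operator (q (f j))} (hAc : ∀ j, ContDiff ℝ ∞ (A j))
    (hA : ∀ m, DerivAlmostLocal f u (fun _ => 1) m A) :
    (∀ j, ContDiff ℝ ∞ fun g => _root_.filtered c (∑ Z, G j g Z) (A j g)) ∧
    ∀ m, DerivAlmostLocal f u (fun _ => 1) m fun j g => _root_.filtered c (∑ Z, G j g Z) (A j g) := by
  let F : ∀ j, ℝ × ℝ → Operator (q (f j)) := fun j p =>
    star (expU (∑ Z, G j p.2 Z) p.1) * A j p.2 * expU (∑ Z, G j p.2 Z) p.1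
  have hF : ∀ j, ContDiff ℝ ∞ (F j) := fun j => by
    have h := contDiff_expU ((hG.contDiff_sum j).comp contDiff_snd) (contDiff_fst (E := ℝ) (F := ℝ))
    exact (((starL' ℝ : Operator (q (f j)) ≃L[ℝ] _).contDiff.comp h).mul
      ((hAc j).comp contDiff_snd)).mul h
  have hheis : ∀ m, DerivAlmostLocal (J := J × ℝ) (fun p => f p.1) (fun p => u p.1)
      (fun p => 1 + |p.1.2|) m fun p g => F p.1 (p.2, g) := fun m => by
    have h := DerivAlmostLocal.heisenberg (wt := fun _ => 1) hΛ (fun _ => le_rfl) hG hsa hAc hA m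
    simpa only [one_mul] using h
  have hFm : ∀ j m g, AEStronglyMeasurable (fun z : ℝ × ℝ =>
      iteratedDeriv m (fun g => F j (z.1 * z.2, g)) g) volume := fun j m g =>
    ((contDiff_iteratedDeriv_snd m (hF j)).continuous.comp
      (by fun_prop : Continuous fun z : ℝ × ℝ => (z.1 * z.2, g))).aestronglyMeasurable
  have hv : ∀ z : ℝ × ℝ, 1 ≤ 1 + |z.1 * z.2| := fun z => by linarith [abs_nonneg (z.1 * z.2)]
  have hint : ∀ j, (ContDiff ℝ ∞ fun g => ∫ z : ℝ × ℝ, c z • F j (z.1 * z.2, g)) ∧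
      ∀ m g, iteratedDeriv m (fun g => ∫ z : ℝ × ℝ, c z • F j (z.1 * z.2, g)) g =
        ∫ z : ℝ × ℝ, c z • iteratedDeriv m (fun g => F j (z.1 * z.2, g)) g := fun j => by
    refine iteratedDeriv_integral_smul (F := fun (z : ℝ × ℝ) g => F j (z.1 * z.2, g)) hv hc
      (fun z => (hF j).comp (contDiff_const.prodMk contDiff_id)) (hFm j) fun m => ?_
    obtain ⟨C, p, -, hb⟩ := (hheis m).1
    exact ⟨C, p, fun z g => hb ((j, z.1 * z.2), g)⟩
  refine ⟨fun j => (hint j).1, fun m => ?_⟩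
  have h1 : AlmostLocal (J := J × ℝ) (fun p => f p.1) (fun p => u p.1) (fun _ => 1) fun p =>
      ∫ z : ℝ × ℝ, c z • iteratedDeriv m (fun g => F p.1 (z.1 * z.2, g)) p.2 := by
    refine AlmostLocal.integral (J := J × ℝ) (fun _ => le_rfl) hv hc (fun p => hFm p.1 m p.2) ?_
    have h := (hheis m).comp fun p : (J × ℝ) × (ℝ × ℝ) => ((p.1.1, p.2.1 * p.2.2), p.1.2)
    simpa only [one_mul] using h
  unfold DerivAlmostLocal
  refine Eq.mp ?_ h1
  congr 1
  funext p
  exact ((hint p.1).2 m p.2).symm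

lemma opComm_neg_left {𝔸 : Type*} [CStarAlgebra 𝔸] (A B : 𝔸) : opComm (-A) B = -opComm A B := by
  simp only [opComm, neg_mul, mul_neg, neg_sub]
  abel

/-- A state that follows the evolution by `U`, as a projection, follows it as a vector up to a
phase. -/
lemma exists_phase {E : Type*} [NormedAddCommGroup E] [InnerProductSpace ℂ E] [CompleteSpace E]
    {U : BoundedOperator E} (hU : U ∈ unitary (BoundedOperator E)) {φ₀ φ₁ : E} (h₀ : ‖φ₀‖ = 1) (h₁ : ‖φ₁‖ = 1)
    (h : U * rankOne ℂ φ₀ φ₀ = rankOne ℂ φ₁ φ₁ * U) :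
    ∃ a : ℝ, φ₁ = Complex.exp ((-(a * 1) : ℝ) * Complex.I) • U φ₀ := by
  set z : ℂ := inner ℂ φ₁ (U φ₀) with hz
  have h1 : U φ₀ = z • φ₁ := by
    have h2 := congrArg (fun A : BoundedOperator E => A φ₀) h
    simpa [mul_apply_eq_comp, h₀] using h2
  have hz1 : ‖z‖ = 1 := by
    have h2 := congrArg norm h1
    rwa [norm_map_of_mem_unitary hU, norm_smul, h₀, h₁, mul_one, eq_comm] at h2
  have hz2 : Complex.exp (z.arg * Complex.I) = z := by
    simpa [hz1] using Complex.norm_mul_exp_arg_mul_I z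
  refine ⟨z.arg, ?_⟩
  rw [h1, smul_smul]
  nth_rw 2 [← hz2]
  rw [← Complex.exp_add]
  simp

/-- The evolution generated by `K + a`. -/
lemma IsPropagator.smul_exp {𝔸 : Type*} [CStarAlgebra 𝔸] {K U : ℝ → 𝔸} (hU : IsPropagator K U)
    (a : ℝ) : IsPropagator (fun t => K t + (a : ℂ) • 1)
      fun t => Complex.exp ((-(a * t) : ℝ) * Complex.I) • U t := by
  refine ⟨by simp [hU.1], fun t => ?_⟩
  have h4 : HasDerivAt (fun s : ℝ => -(a * s)) (-a) t := by
    have h1 : HasDerivAt (fun s : ℝ => a * s) a t := by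
      simpa using (hasDerivAt_id t).const_mul a
    exact h1.neg
  have h3 := (h4.ofReal_comp.mul_const Complex.I).cexp
  refine (h3.smul (hU.2 t)).congr_deriv ?_
  simp only [add_mul, smul_mul_assoc, one_mul, mul_smul_comm, smul_add, smul_smul]
  congr 1
  · ring_nf
  · congr 1
    push_cast
    ring

/-! ### States in the same phase are related by a local unitary evolution -/

/-- The quasi-adiabatic evolution carries the ground state along a gapped path. -/
theorem InSamePhase.relatedByLocalUnitary (hΛ : UniformPolynomialGrowth Λ)
    {Φ₀ Φ₁ : ∀ n, ManyBody (q n)} (h : InSamePhase Φ₀ Φ₁) : RelatedByLocalUnitary Φ₀ Φ₁ := by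
  obtain ⟨h, Φ, hloc, hΦ0, hΦ1, ⟨Δ, hΔ, hgap⟩, hexp⟩ := h
  have hθI : ∀ x, Real.smoothTransition x ∈ Set.Icc (0 : ℝ) 1 := fun x =>
    ⟨Real.smoothTransition.nonneg x, Real.smoothTransition.le_one x⟩
  have hθ := bddSmooth_smoothTransition
  have hG := hloc.isSmoothLocalSum hθ hθI bddSmooth_one
  simp only [one_smul] at hG
  set G : ∀ n, ℝ → Finset (Λ n) → Operator (q n) := fun n g Z =>
    h n (Real.smoothTransition g) Z with hGdef
  let Ψ : ∀ n, ℝ → ManyBody (q n) := fun n g => Φ n (Real.smoothTransition g)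
  have hsa : ∀ n t Z, IsSelfAdjoint (G n t Z) := fun n t Z => (hloc.1 n _ (hθI t) Z).1
  have hsas : ∀ n t, IsSelfAdjoint (∑ Z, G n t Z) := fun j t =>
    isSelfAdjoint_sum _ fun Z _ => hsa j t Z
  have hgs : ∀ n t, IsGroundStateWithGap (∑ Z, G n t Z) Δ (Ψ n t) := fun n t => hgap n _ (hθI t)
  have hPs : ∀ n, ContDiff ℝ ∞ fun g => (rankOne ℂ (Ψ n g) (Ψ n g) : Operator (q n)) := fun n =>
    contDiff_rankOne_of_expectation fun O => (hexp.1 n O).comp_contDiff hθ.1 hθI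
  obtain ⟨c, hci, hcΔ⟩ := exists_filter hΔ
  have hc0 : Integrable c := by simpa using hci 0
  let G' : ∀ n, ℝ → Finset (Λ n) → Operator (q n) := fun n g Z => deriv (fun g => G n g Z) g
  have hG' : IsSmoothLocalSum (fun n => n) (fun _ => 1) G' := hG.deriv
  have hsa' : ∀ n t Z, IsSelfAdjoint (G' n t Z) := fun n t Z => by
    have h1 := (starL' ℝ : Operator (q n) ≃L[ℝ] _).hasFDerivAt.comp_hasDerivAt t
      (hG.hasDerivAt n Z t)
    have h2 : (starL' ℝ : Operator (q n) ≃L[ℝ] _) ∘ (fun g => G n g Z) = fun g => G n g Z :=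
      funext fun g => (hsa n g Z).star_eq
    rw [h2] at h1
    exact h1.unique (hG.hasDerivAt n Z t)
  obtain ⟨hKc, hK⟩ := DerivAlmostLocal.filtered (J := Σ n, Λ n) (f := fun p => p.1)
    (u := fun p => p.2) hΛ hci (hG.comp fun p : Σ n, Λ n => p.1) (fun p => hsa p.1)
    (A := fun p g => siteTerm (G' p.1 g) p.2) hG'.contDiff_siteTerm hG'.derivAlmostLocal_siteTerm
  let K : ∀ n, Λ n → ℝ → Operator (q n) := fun n u g =>
    -filtered c (∑ Z, G n g Z) (siteTerm (G' n g) u)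
  have hKc' : ∀ n u, ContDiff ℝ ∞ (K n u) := fun n u => (hKc ⟨n, u⟩).neg
  have hKsa : ∀ n u g, IsSelfAdjoint (K n u g) := fun n u g =>
    (isSelfAdjoint_filtered (isSelfAdjoint_siteTerm (hsa' n g) u)).neg
  have hK' : ∀ m, DerivAlmostLocal (J := Σ n, Λ n) (fun p => p.1) (fun p => p.2)
      (fun p => 1 + |p.2|) m fun p => K p.1 p.2 := fun m => by
    have h1 := AlmostLocal.const_smul (J := (Σ n, Λ n) × ℝ) (f := fun p => p.1.1)
      (u := fun p => p.1.2) (wt := fun _ => 1) (fun _ => le_rfl) (hK m) (-1)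
    have h2 := h1.trans (fun _ => zero_le_one) (wt' := fun p => 1 + |p.2|) (Tempered.const 1)
    have h3 : ∀ (p : Σ n, Λ n) g, iteratedDeriv m (K p.1 p.2) g = (-1 : ℂ) • iteratedDeriv m
        (fun g => filtered c (∑ Z, G p.1 g Z) (siteTerm (G' p.1 g) p.2)) g := fun p g => by
      rw [← iteratedDeriv_fun_smul_complex]
      simp only [neg_smul, one_smul, K]
    unfold DerivAlmostLocal
    simp only [h3]
    exact h2
  have hKsum : ∀ n g, ∑ u, K n u g = -filtered c (∑ Z, G n g Z) (∑ u, siteTerm (G' n g) u) :=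
    fun n g => by
      simp only [K]
      rw [Finset.sum_neg_distrib, filtered_sum hc0 (hsas n g)]
  have hKs : ∀ n g, IsSelfAdjoint (∑ u, K n u g) := fun n g =>
    isSelfAdjoint_sum _ fun u _ => hKsa n u g
  choose U hU using fun n => exists_isPropagator (K := fun g => ∑ u, K n u g)
    (continuous_finsetSum _ fun u _ => (hKc' n u).continuous)
  have hun := fun n g => (hU n).mem_unitary (hKs n) g
  -- the ground state projections follow the evolution
  have hproj : ∀ n, U n 1 * rankOne ℂ (Φ₀ n) (Φ₀ n) = rankOne ℂ (Φ₁ n) (Φ₁ n) * U n 1 := fun n => by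
    have hd : ∀ g, HasDerivAt (fun g => star (U n g) * rankOne ℂ (Ψ n g) (Ψ n g) * U n g) 0 g :=
      fun g => by
        have h1 := ((contDiff_infty_iff_deriv.1 (hPs n)).1 g).hasDerivAt
        have h2 := hasDerivAt_groundState_projection (hG.hasDerivAt_sum n g) (hsas n) hΔ (hgs n) h1
          hc0 hcΔ (A := ∑ u, siteTerm (G' n g) u) (by
            obtain ⟨a, ha⟩ := (((hG.deriv.isLocalSum 0).1 (n, g) ∅)).eq_smul_one
            simp only [iteratedDeriv_zero] at ha
            refine ⟨a, ?_⟩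
            rw [← ha]
            exact (sum_siteTerm (G' n g)).symm)
        refine ((hU n).hasDerivAt_heisenberg (hKs n) h1).congr_deriv ?_
        rw [h2, hKsum, opComm_neg_left, smul_neg, add_neg_cancel, mul_zero, zero_mul]
    have h1 := IsPropagator.eq_of_hasDerivAt_zero hd 1
    simp only [(hU n).1, star_one, one_mul, mul_one, Ψ, Real.smoothTransition.zero,
      Real.smoothTransition.one, hΦ0, hΦ1] at h1
    rw [← h1, ← mul_assoc, ← mul_assoc, Unitary.mul_star_self_of_mem (hun n 1), one_mul]
  have hn0 : ∀ n, ‖Φ₀ n‖ = 1 := fun n => by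
    rw [← hΦ0]; exact (hgap n 0 ⟨le_rfl, zero_le_one⟩).1
  have hn1 : ∀ n, ‖Φ₁ n‖ = 1 := fun n => by
    rw [← hΦ1]; exact (hgap n 1 ⟨zero_le_one, le_rfl⟩).1
  choose a ha using fun n => exists_phase (hun n 1) (hn0 n) (hn1 n) (hproj n)
  -- a constant term in the generator accounts for the phase
  obtain ⟨k, hk, hsum⟩ := exists_isSmoothLocalPath hΛ hKc' hKsa hK'
    (E := fun n => (a n : ℂ) • 1) fun n => ⟨by simp [IsSelfAdjoint], (supportedOn_one ∅).smul _⟩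
  refine ⟨k, fun n t => Complex.exp ((-(a n * t) : ℝ) * Complex.I) • U n t, hk, fun n => ?_, ha⟩
  have h1 := (hU n).smul_exp (a n)
  simp only [hsum]
  exact ⟨h1.1, fun s _ => (h1.2 s).hasDerivWithinAt⟩

end Continuation

theorem mainTheorem2 {ι : Type*} (Λ : ι → Type*) [∀ n, Fintype (Λ n)]
    [∀ n, DecidableEq (Λ n)] [∀ n, MetricSpace (Λ n)] (hΛ : UniformPolynomialGrowth Λ)
    (q : ∀ n, Λ n → ℕ) (Φ₀ Φ₁ : ∀ n, ManyBody (q n))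
    (h₀ : IsGappedState Φ₀) (h₁ : IsGappedState Φ₁) :
    InSamePhase Φ₀ Φ₁ ↔ RelatedByLocalUnitary Φ₀ Φ₁ := by
  -- a unit vector exists only if no local Hilbert space is trivial
  have : ∀ n x, NeZero (q n x) := fun n x => ⟨fun hx => by
    obtain ⟨h, -, Δ, -, hgap⟩ := h₀
    have : IsEmpty ((x : Λ n) → Fin (q n x)) :=
      ⟨fun σ => (Fin.cast hx (σ x)).elim0⟩
    have h1 := (hgap n).1
    rw [Subsingleton.elim (Φ₀ n) 0, norm_zero] at h1
    exact zero_ne_one h1⟩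
  exact ⟨fun h => h.relatedByLocalUnitary hΛ, fun h => h.inSamePhase hΛ h₀⟩
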